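/- **Setting.** Let $m\ge 1$ be an integer, let $\mathbf g:[\xi_s,\xi_e]\to\mathbb R^2$ be a regular $C^{m+2}$ parametrization of a curve $\Gamma$, and let $\rho\ge 1$. Put $\boldsymbol\tau=\mathbf g'/\|\mathbf g'\|$, $\mathbf n=(\tau_2,-\tau_1)$, $\kappa=(g_1'g_2''-g_2'g_1'')/\|\mathbf g'\|^3$ and $P_\Gamma(\eta,\xi)=\mathbf g(\xi)+\eta\,\mathbf n(\xi)$. Let $\epsilon>0$ be such that $P_\Gamma$ is one-to-one on $[-\epsilon,\epsilon]\times[\xi_s,\xi_e]$, let $R_\Gamma$ be its inverse there, and write $N_\Gamma(\delta)=P_\Gamma([-\delta,\delta]\times[\xi_s,\xi_e])$. Let $K$ be an axis-parallel closed rectangle of aspect ratio at most $\rho$ and diameter $h<\epsilon$ whose interior meets $\Gamma$, with $K\subset N_\Gamma(h)$ and $h\max_{[\xi_s,\xi_e]}|\kappa|\le\frac12$. Let $a_K$ and $b_K$ be the minimum and the maximum of the $\xi$-components of $R_\Gamma(A)$ over the four vertices $A$ of $K$. The Frenet fictitious element of $K$ is $\hat K_F=[-h,h]\times[a_K,b_K]$.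 It is cut by $\hat\Gamma=\{0\}\times[a_K,b_K]$ into $\hat K_F^-=\hat K_F\cap\{\eta<0\}$ and $\hat K_F^+=\hat K_F\cap\{\eta\ge0\}$. Let $\beta^\pm>0$ and $\hat\beta=\beta^\pm$ on $\hat K_F^\pm$. For a function $v$ on $\hat K_F$ put $v^\pm=v|_{\hat K_F^\pm}$, let $[v]$ be the difference of the traces of $v^+$ and $v^-$ on $\hat\Gamma$, and let $$|v|_{k,\hat K_F}^2=\sum_{s=\pm}\ \sum_{i+j=k}\big\|\partial_\eta^i\partial_\xi^j v^s\big\|^2_{L^2(\hat K_F^s)}.$$ The Laplacian in the coordinates $(\eta,\xi)$ is $$\mathcal L(v)=v_{\eta\eta}+J_0v_{\xi\xi}+J_1v_\eta+J_2v_\xi,\qquad J_0=\frac{\psi^2}{\|\mathbf g'\|^2},\quad J_1=\kappa\psi,\quad J_2=-\frac{\psi^2}{\|\mathbf g'\|^2}\Big(\eta\kappa'\psi+\frac{\mathbf g'\cdot\mathbf g''}{\|\mathbf g'\|^2}\Big),\quad \psi=\frac1{1+\eta\kappa}.$$ Let $\hat{\mathcal V}$ be the local Frenet immersed finite element space: the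 functions $\hat\phi$ on $\hat K_F$ whose restrictions to $\hat K_F^\pm$ are polynomials of degree at most $m$ in each variable, such that for all polynomials $v$ of degree at most $m$ $$\int_{\hat\Gamma}[\hat\phi]\,v=0,\qquad \int_{\hat\Gamma}[\hat\beta\hat\phi_\eta]\,v=0,\qquad \int_{\hat\Gamma}\big[\hat\beta\,\partial_\eta^j\mathcal L(\hat\phi)\big]\,v=0\quad(0\le j\le m-2).$$ **Theorem.** There is a constant $C>0$, depending only on $m$, $\mathbf g$ and $\rho$ (thus not on $\epsilon$, on $K$ and its size and position relative to $\Gamma$, on $\beta^\pm$ or on $\hat u$), such that the following holds for all $\epsilon$, $K$ and $\beta^\pm$ as above. Let $\hat u$ be a function on $\hat K_F$ with $\hat u^\pm\in H^{m+1}(\hat K_F^\pm)$ and $$[\hat u]=0,\qquad [\hat\beta\hat u_\eta]=0,\qquad \big[\hat\beta\,\partial_\eta^j\mathcal L(\hat u)\big]=0\quad(0\le j\le m-2)$$ on $\hat\Gamma$. Then $\hat u$ has a unique $L^2(\hat K_F)$-orthogonal projection $\hat\Pi\hat u$ onto $\hat{\mathcal V}$, and $$\big|\hat\Pi\hat u-\hat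 u\big|_{i,\hat K_F}\le C\,h^{m+1-i}\,|\hat u|_{m+1,\hat K_F},\qquad i=0,1,\dots,m+1.$$ -/

import Mathlib

open Set Filter Topology MeasureTheory
open scoped ContDiff

noncomputable section

namespace FrenetIFE

/-! ## The interface curve and the Frenet transformation -/

/-- The physical `x`-`y` plane. -/
abbrev Plane : Type := EuclideanSpace ℝ (Fin 2)

/-- A regular parametrized curve `g : [ξs, ξe] → ℝ²` of class `C^k`. Only the values of `g` on
`[ξs, ξe]` are ever used (derivatives are one-sided at the end points). -/
structure InterfaceCurve (k : ℕ) where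
  ξs : ℝ
  ξe : ℝ
  lt : ξs < ξe
  g : ℝ → Plane
  contDiffOn : ContDiffOn ℝ k g (Icc ξs ξe)
  regular : ∀ ξ ∈ Icc ξs ξe, derivWithin g (Icc ξs ξe) ξ ≠ 0

namespace InterfaceCurve

variable {k : ℕ} (Γ : InterfaceCurve k)

/-- The parameter interval `[ξs, ξe]`. -/
def I : Set ℝ := Icc Γ.ξs Γ.ξe

/-- The interface `Γ` as a set of points of the plane. -/
def image : Set Plane := Γ.g '' Γ.I

/-- `g'`. -/
def g1 : ℝ → Plane := derivWithin Γ.g Γ.I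

/-- `g''`. -/
def g2 : ℝ → Plane := derivWithin Γ.g1 Γ.I

/-- The unit tangent vector `τ = g' / ‖g'‖`. -/
def tangent (ξ : ℝ) : Plane := ‖Γ.g1 ξ‖⁻¹ • Γ.g1 ξ

/-- The unit normal vector `n = Q τ` with `Q = [[0, 1], [-1, 0]]`. -/
def normal (ξ : ℝ) : Plane := !₂[Γ.tangent ξ 1, -Γ.tangent ξ 0]

/-- The signed curvature `κ = (g' ∧ g'') / ‖g'‖³`, where `u ∧ v = uᵀ Q v = u₁ v₂ - u₂ v₁`. -/
def curvature (ξ : ℝ) : ℝ :=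
  (Γ.g1 ξ 0 * Γ.g2 ξ 1 - Γ.g1 ξ 1 * Γ.g2 ξ 0) / ‖Γ.g1 ξ‖ ^ 3

/-- `κ'`. -/
def curvature1 : ℝ → ℝ := derivWithin Γ.curvature Γ.I

/-- The Frenet transformation `P_Γ(η, ξ) = g(ξ) + η n(ξ)`. -/
def P (p : ℝ × ℝ) : Plane := Γ.g p.2 + p.1 • Γ.normal p.2

/-- `[-ε, ε] × [ξs, ξe]`. -/
def tubeDomain (ε : ℝ) : Set (ℝ × ℝ) := Icc (-ε) ε ×ˢ Γ.I

/-- The tubular neighbourhood `N_Γ(ε) = P_Γ([-ε, ε] × [ξs, ξe])`. -/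
def tube (ε : ℝ) : Set Plane := Γ.P '' Γ.tubeDomain ε

/-- `ε` is an admissible half-width of a tubular neighbourhood: `P_Γ` is one-to-one on
`[-ε, ε] × [ξs, ξe]` (it is onto `N_Γ(ε)` by definition). -/
def IsTubeWidth (ε : ℝ) : Prop := 0 < ε ∧ InjOn Γ.P (Γ.tubeDomain ε)

/-- The inverse Frenet transformation `R_Γ : N_Γ(ε) → [-ε, ε] × [ξs, ξe]`. -/
def R (ε : ℝ) : Plane → ℝ × ℝ := Function.invFunOn Γ.P (Γ.tubeDomain ε)

/-- `ψ(η, ξ) = (1 + η κ(ξ))⁻¹`. -/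
def psi (p : ℝ × ℝ) : ℝ := (1 + p.1 * Γ.curvature p.2)⁻¹

/-- The coefficient `J₀` of `u_ξξ` in the transformed Laplacian. -/
def J0 (p : ℝ × ℝ) : ℝ := (Γ.psi p / ‖Γ.g1 p.2‖) ^ 2

/-- The coefficient `J₁` of `u_η` in the transformed Laplacian. -/
def J1 (p : ℝ × ℝ) : ℝ := Γ.curvature p.2 * Γ.psi p

/-- The coefficient `J₂` of `u_ξ` in the transformed Laplacian. -/
def J2 (p : ℝ × ℝ) : ℝ :=
  -(Γ.psi p / ‖Γ.g1 p.2‖) ^ 2 *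
    (p.1 * Γ.curvature1 p.2 * Γ.psi p + inner ℝ (Γ.g1 p.2) (Γ.g2 p.2) / ‖Γ.g1 p.2‖ ^ 2)

/-- The transformed Laplacian `u_ηη + J₀ u_ξξ + J₁ u_η + J₂ u_ξ`, as a function of the four
derivatives `u_ηη`, `u_ξξ`, `u_η`, `u_ξ` (which may be classical or weak). -/
def lap (uηη uξξ uη uξ : ℝ × ℝ → ℝ) (p : ℝ × ℝ) : ℝ :=
  uηη p + Γ.J0 p * uξξ p + Γ.J1 p * uη p + Γ.J2 p * uξ p

end InterfaceCurve

/-! ## Interface elements and Frenet fictitious elements -/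

/-- A closed axis-parallel rectangle `[x, x + p] × [y, y + q]` of the physical plane. -/
structure RectElement where
  x : ℝ
  y : ℝ
  p : ℝ
  q : ℝ
  p_pos : 0 < p
  q_pos : 0 < q

namespace RectElement

variable (K : RectElement)

def toSet : Set Plane := {A | A 0 ∈ Icc K.x (K.x + K.p) ∧ A 1 ∈ Icc K.y (K.y + K.q)}

/-- The diameter of the element. -/
def h : ℝ := Metric.diam K.toSet

/-- The aspect ratio is at most `ρ`. -/
def AspectLe (ρ : ℝ) : Prop := K.p ≤ ρ * K.q ∧ K.q ≤ ρ * K.p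

/-- The four vertices. -/
def A1 : Plane := !₂[K.x, K.y]
def A2 : Plane := !₂[K.x + K.p, K.y]
def A3 : Plane := !₂[K.x + K.p, K.y + K.q]
def A4 : Plane := !₂[K.x, K.y + K.q]

end RectElement

/-- The rectangle `[-h, h] × [a, b]` of the `η`-`ξ` plane, cut by the line `η = 0`. -/
structure FrenetRect where
  h : ℝ
  a : ℝ
  b : ℝ

namespace FrenetRect

variable (F : FrenetRect)

/-- The closed rectangle. -/
def full : Set (ℝ × ℝ) := Icc (-F.h) F.h ×ˢ Icc F.a F.b

/-- The open part `η > 0`. -/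
def plus : Set (ℝ × ℝ) := Ioo 0 F.h ×ˢ Ioo F.a F.b

/-- The open part `η < 0`. -/
def minus : Set (ℝ × ℝ) := Ioo (-F.h) 0 ×ˢ Ioo F.a F.b

end FrenetRect

namespace InterfaceCurve

variable {k : ℕ} (Γ : InterfaceCurve k)

/-- `K` is an interface element: `Γ` meets the interior of `K`. -/
def IsInterfaceElement (K : RectElement) : Prop := (interior K.toSet ∩ Γ.image).Nonempty

/-- The Frenet fictitious element `[-h, h] × [a_K, b_K]` of `K`: here `h` is the diameter of `K`,
and `a_K`, `b_K` are the smallest and the largest of the `ξ`-coordinates of the vertices. -/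
def frenetElement (ε : ℝ) (K : RectElement) : FrenetRect where
  h := K.h
  a := min (min (Γ.R ε K.A1).2 (Γ.R ε K.A2).2) (min (Γ.R ε K.A3).2 (Γ.R ε K.A4).2)
  b := max (max (Γ.R ε K.A1).2 (Γ.R ε K.A2).2) (max (Γ.R ε K.A3).2 (Γ.R ε K.A4).2)

end InterfaceCurve

/-! ## Sobolev spaces on open sets of the `η`-`ξ` plane -/

/-- The classical partial derivative in `η`, the first variable. -/
def dEta (f : ℝ × ℝ → ℝ) (p : ℝ × ℝ) : ℝ := deriv (fun t => f (t, p.2)) p.1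

/-- The classical partial derivative in `ξ`, the second variable. -/
def dXi (f : ℝ × ℝ → ℝ) (p : ℝ × ℝ) : ℝ := deriv (fun t => f (p.1, t)) p.2

/-- `w` is the weak derivative `∂_η^i ∂_ξ^j f` on the open set `U`. -/
def HasWeakDeriv (U : Set (ℝ × ℝ)) (i j : ℕ) (f w : ℝ × ℝ → ℝ) : Prop :=
  LocallyIntegrableOn f U ∧ LocallyIntegrableOn w U ∧
    ∀ φ : ℝ × ℝ → ℝ, ContDiff ℝ ∞ φ → HasCompactSupport φ → tsupport φ ⊆ U →
      ∫ p in U, f p * (dEta^[i] (dXi^[j] φ)) p = (-1) ^ (i + j) * ∫ p in U, w p * φ p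

open Classical in
/-- The weak derivative `∂_η^i ∂_ξ^j f` on `U` (determined almost everywhere on `U`), or `0` if
there is none. -/
def weakDeriv (U : Set (ℝ × ℝ)) (i j : ℕ) (f : ℝ × ℝ → ℝ) : ℝ × ℝ → ℝ :=
  if H : ∃ w, HasWeakDeriv U i j f w then H.choose else 0

/-- `f ∈ H^k(U)`. -/
def MemSobolev (U : Set (ℝ × ℝ)) (k : ℕ) (f : ℝ × ℝ → ℝ) : Prop :=
  ∀ i j : ℕ, i + j ≤ k → ∃ w, HasWeakDeriv U i j f w ∧ MemLp w 2 (volume.restrict U)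

/-- The seminorm `|f|_{k,U}` of `H^k(U)`: the `L²` norm of all weak derivatives of order `k`. -/
def sobolevSeminorm (U : Set (ℝ × ℝ)) (k : ℕ) (f : ℝ × ℝ → ℝ) : ℝ :=
  √(∑ ij ∈ Finset.HasAntidiagonal.antidiagonal k, ∫ p in U, (weakDeriv U ij.1 ij.2 f p) ^ 2)

/-- The broken seminorm `|f|_{k,F}`, with `|f|²_{k,F} = |f|²_{k,F⁺} + |f|²_{k,F⁻}`. -/
def brokenSeminorm (F : FrenetRect) (k : ℕ) (f : ℝ × ℝ → ℝ) : ℝ :=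
  √(sobolevSeminorm F.plus k f ^ 2 + sobolevSeminorm F.minus k f ^ 2)

/-- `t ∈ L²(a, b)` is the trace of `w ∈ H¹(U)` on the segment `{0} × (a, b)` of the boundary of
`U`. The trace operator is the continuous extension to `H¹(U)` of the restriction of functions that
are smooth up to the boundary: some smooth functions converge to `w` in `H¹(U)` while their
restrictions converge to `t` in `L²(a, b)`. -/
def HasTrace (U : Set (ℝ × ℝ)) (a b : ℝ) (w : ℝ × ℝ → ℝ) (t : ℝ → ℝ) : Prop :=
  MemSobolev U 1 w ∧ MemLp t 2 (volume.restrict (Ioo a b)) ∧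
    ∃ ψ : ℕ → ℝ × ℝ → ℝ, (∀ n, ContDiff ℝ ∞ (ψ n)) ∧
      Tendsto (fun n => eLpNorm (fun p => ψ n p - w p) 2 (volume.restrict U)) atTop (𝓝 0) ∧
      Tendsto (fun n => eLpNorm (fun p => dEta (ψ n) p - weakDeriv U 1 0 w p) 2
        (volume.restrict U)) atTop (𝓝 0) ∧
      Tendsto (fun n => eLpNorm (fun p => dXi (ψ n) p - weakDeriv U 0 1 w p) 2
        (volume.restrict U)) atTop (𝓝 0) ∧
      Tendsto (fun n => eLpNorm (fun ξ => ψ n (0, ξ) - t ξ) 2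
        (volume.restrict (Ioo a b))) atTop (𝓝 0)

/-- The jump across `η = 0` of the function equal to `wm` on `F⁻` and to `wp` on `F⁺` vanishes:
the two one-sided traces agree. -/
def JumpZero (F : FrenetRect) (wm wp : ℝ × ℝ → ℝ) : Prop :=
  ∃ t : ℝ → ℝ, HasTrace F.minus F.a F.b wm t ∧ HasTrace F.plus F.a F.b wp t

/-- The immersed Sobolev space `H^k(F, {η = 0}; β)`, for `k ≥ 2`. -/
def MemImmersedSobolev (F : FrenetRect) (k : ℕ) (βm βp : ℝ) (u : ℝ × ℝ → ℝ) : Prop :=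
  MemSobolev F.minus k u ∧ MemSobolev F.plus k u ∧
    JumpZero F u u ∧
    JumpZero F (fun p => βm * weakDeriv F.minus 1 0 u p) (fun p => βp * weakDeriv F.plus 1 0 u p)

namespace InterfaceCurve

variable {k : ℕ} (Γ : InterfaceCurve k)

/-- The transformed Laplacian `𝓛 u` on the open set `U`, with weak derivatives. -/
def weakLap (U : Set (ℝ × ℝ)) (u : ℝ × ℝ → ℝ) : ℝ × ℝ → ℝ :=
  Γ.lap (weakDeriv U 2 0 u) (weakDeriv U 0 2 u) (weakDeriv U 1 0 u) (weakDeriv U 0 1 u)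

/-- The transformed Laplacian `𝓛 f` with classical derivatives. -/
def classicalLap (f : ℝ × ℝ → ℝ) : ℝ × ℝ → ℝ :=
  Γ.lap (dEta (dEta f)) (dXi (dXi f)) (dEta f) (dXi f)

/-- The flattened jump conditions: `[u] = 0`, `[β u_η] = 0`, and `[β ∂_η^j 𝓛 u] = 0` for
`j = 0, …, m - 2`. -/
def FlattenedJumps (m : ℕ) (F : FrenetRect) (βm βp : ℝ) (u : ℝ × ℝ → ℝ) : Prop :=
  JumpZero F u u ∧
    JumpZero F (fun p => βm * weakDeriv F.minus 1 0 u p)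
      (fun p => βp * weakDeriv F.plus 1 0 u p) ∧
    ∀ j : ℕ, j + 2 ≤ m →
      JumpZero F (fun p => βm * weakDeriv F.minus j 0 (Γ.weakLap F.minus u) p)
        (fun p => βp * weakDeriv F.plus j 0 (Γ.weakLap F.plus u) p)

end InterfaceCurve

/-! ## The local immersed finite element space and the `L²` projection -/

/-- `Q^m`: the polynomial functions of degree at most `m` in each of the two variables. -/
def tensorPoly (m : ℕ) : Submodule ℝ (ℝ × ℝ → ℝ) :=
  Submodule.span ℝ {f | ∃ i ≤ m, ∃ j ≤ m, f = fun p => p.1 ^ i * p.2 ^ j}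

namespace InterfaceCurve

variable {k : ℕ} (Γ : InterfaceCurve k)

/-- The weak jump conditions for the piecewise polynomial equal to `φm` for `η < 0` and to `φp`
for `η ≥ 0`: the jumps of `φ`, of `β φ_η` and of `β ∂_η^j 𝓛 φ`, `j = 0, …, m - 2`, are orthogonal to
the polynomials of degree at most `m` on the segment `{0} × [a, b]`. -/
def WeakJumps (m : ℕ) (F : FrenetRect) (βm βp : ℝ) (φm φp : ℝ × ℝ → ℝ) : Prop :=
  ∀ v : Polynomial ℝ, v.natDegree ≤ m →
    (∫ ξ in F.a..F.b, (φp (0, ξ) - φm (0, ξ)) * v.eval ξ) = 0 ∧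
    (∫ ξ in F.a..F.b, (βp * dEta φp (0, ξ) - βm * dEta φm (0, ξ)) * v.eval ξ) = 0 ∧
    ∀ j : ℕ, j + 2 ≤ m →
      (∫ ξ in F.a..F.b, (βp * (dEta^[j] (Γ.classicalLap φp)) (0, ξ) -
        βm * (dEta^[j] (Γ.classicalLap φm)) (0, ξ)) * v.eval ξ) = 0

/-- The local Frenet immersed finite element space on `F = [-h, h] × [a, b]`. Its members are
functions on `F`; their values outside `F` are irrelevant. -/
def ifeSpace (m : ℕ) (F : FrenetRect) (βm βp : ℝ) : Set (ℝ × ℝ → ℝ) :=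
  {φ | ∃ φm ∈ tensorPoly m, ∃ φp ∈ tensorPoly m,
    (∀ p ∈ F.full, p.1 < 0 → φ p = φm p) ∧ (∀ p ∈ F.full, 0 ≤ p.1 → φ p = φp p) ∧
    Γ.WeakJumps m F βm βp φm φp}

/-- `w` is the `L²(F)`-orthogonal projection of `u` onto the local immersed finite element space. -/
def IsL2Projection (m : ℕ) (F : FrenetRect) (βm βp : ℝ) (u w : ℝ × ℝ → ℝ) : Prop :=
  w ∈ Γ.ifeSpace m F βm βp ∧
    ∀ v ∈ Γ.ifeSpace m F βm βp, ∫ p in F.full, (w p - u p) * v p = 0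

end InterfaceCurve

end FrenetIFE

end

/-!
The Frenet transformation straightens the interface, so the estimate is a Bramble–Hilbert argument
on the fictitious element, where the interface is the line `η = 0`. Two points are not routine: the
space is defined by jump conditions that involve the operator `𝓛` and the coefficients `β`, and the
constant must depend on neither `β` nor the position of the element.

*Normal data.* The jump conditions compare, on the two sides, the normal data `v`, `v_η`,
`∂_η^j 𝓛 v` at `η = 0`. Here `∂_η^j 𝓛 v = ∂_η^{j+2} v + ` terms with fewer normal derivatives
(`dEta_iterate_classicalLap`), so the `k`-th datum is `∂_η^k v(0, ξ)` up to terms of lower normal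
order, with coefficients bounded by the curve alone (`exists_normalData_bound`). This triangular
structure is kept by the affine map onto the unit square (`IsNormalData`), because the shape of the
fictitious elements is controlled (`exists_frenetElement_bounds`: their length in `ξ` is comparable
to `h`, by `n' = κ g'`, by `h |κ| ≤ 1/2` and by the bi-Lipschitz property of the curve).

*Approximation.* Let `φ₂` be a Bramble–Hilbert polynomial (`exists_polynomial_approx`) on the side
with the smaller `β`. On the side with the larger `β` such a polynomial is corrected by a polynomial
`∑ s^k / k! c_k(t)`, whose coefficients `c_k` are found successively from the weak jump conditions.
The ratio of the coefficients enters the equations for `c_k` only through a factor of modulus at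
most one, so the correction is bounded by the errors of these polynomials and by the jumps of
the data of the functions approximated, uniformly in `β` (`exists_interface_approx`,
`exists_weakJumps_approx`).

*Passage to Sobolev functions.* The two sides of `u` are approximated independently by smooth
functions (`exists_smooth_approx`). Their normal data converge in `L²` to the traces of the weak
normal data of `u` (`l2Tendsto_normalData`), so their jumps tend to zero, and the `L²` distance from
`u` to the immersed space is at most a constant times `h^{m+1} |u|_{m+1}`
(`exists_sqInt_projection_le`). The `L²` projection exists, is unique, and realizes this distance
(`exists_isL2Projection`). The seminorms of higher order follow from an inverse estimate for the
difference of the projection and a Bramble–Hilbert polynomial (`exists_sobolev_inverse_estimate`).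
-/

namespace FrenetIFE

/-! ### Classical partial derivatives of smooth functions of two variables -/

/-- The classical mixed derivative `∂_η^i ∂_ξ^j f`. -/
noncomputable def mixedDeriv (i j : ℕ) (f : ℝ × ℝ → ℝ) : ℝ × ℝ → ℝ := dEta^[i] (dXi^[j] f)

theorem hasDerivAt_fst_slice {f : ℝ × ℝ → ℝ} (hf : Differentiable ℝ f) (p : ℝ × ℝ) :
    HasDerivAt (fun t => f (t, p.2)) (fderiv ℝ f p (1, 0)) p.1 := by
  have h1 : HasFDerivAt f (fderiv ℝ f p) (p.1, p.2) := (hf p).hasFDerivAt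
  have h2 : HasDerivAt (fun t : ℝ => (t, p.2)) ((1 : ℝ), (0 : ℝ)) p.1 :=
    (hasDerivAt_id p.1).prodMk (hasDerivAt_const p.1 p.2)
  exact h1.comp_hasDerivAt p.1 h2

theorem hasDerivAt_snd_slice {f : ℝ × ℝ → ℝ} (hf : Differentiable ℝ f) (p : ℝ × ℝ) :
    HasDerivAt (fun t => f (p.1, t)) (fderiv ℝ f p (0, 1)) p.2 := by
  have h1 : HasFDerivAt f (fderiv ℝ f p) (p.1, p.2) := (hf p).hasFDerivAt
  have h2 : HasDerivAt (fun t : ℝ => (p.1, t)) ((0 : ℝ), (1 : ℝ)) p.2 :=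
    (hasDerivAt_const p.2 p.1).prodMk (hasDerivAt_id p.2)
  exact h1.comp_hasDerivAt p.2 h2

theorem dEta_eq_fderiv {f : ℝ × ℝ → ℝ} (hf : Differentiable ℝ f) :
    dEta f = fun p => fderiv ℝ f p (1, 0) :=
  funext fun p => (hasDerivAt_fst_slice hf p).deriv

theorem dXi_eq_fderiv {f : ℝ × ℝ → ℝ} (hf : Differentiable ℝ f) :
    dXi f = fun p => fderiv ℝ f p (0, 1) :=
  funext fun p => (hasDerivAt_snd_slice hf p).deriv

theorem smooth_differentiable {f : ℝ × ℝ → ℝ} (hf : ContDiff ℝ ∞ f) : Differentiable ℝ f :=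
  hf.differentiable (by simp)

theorem hasDerivAt_dEta {f : ℝ × ℝ → ℝ} (hf : ContDiff ℝ ∞ f) (s t : ℝ) :
    HasDerivAt (fun s => f (s, t)) (dEta f (s, t)) s := by
  rw [dEta_eq_fderiv (smooth_differentiable hf)]
  exact hasDerivAt_fst_slice (smooth_differentiable hf) (s, t)

theorem hasDerivAt_dXi {f : ℝ × ℝ → ℝ} (hf : ContDiff ℝ ∞ f) (s t : ℝ) :
    HasDerivAt (fun t => f (s, t)) (dXi f (s, t)) t := by
  rw [dXi_eq_fderiv (smooth_differentiable hf)]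
  exact hasDerivAt_snd_slice (smooth_differentiable hf) (s, t)

theorem smooth_dEta {f : ℝ × ℝ → ℝ} (hf : ContDiff ℝ ∞ f) : ContDiff ℝ ∞ (dEta f) := by
  rw [dEta_eq_fderiv (smooth_differentiable hf)]
  exact (hf.fderiv_right (m := ∞) (by simp)).clm_apply contDiff_const

theorem smooth_dXi {f : ℝ × ℝ → ℝ} (hf : ContDiff ℝ ∞ f) : ContDiff ℝ ∞ (dXi f) := by
  rw [dXi_eq_fderiv (smooth_differentiable hf)]
  exact (hf.fderiv_right (m := ∞) (by simp)).clm_apply contDiff_const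

theorem dXi_dEta_comm {f : ℝ × ℝ → ℝ} (hf : ContDiff ℝ ∞ f) : dXi (dEta f) = dEta (dXi f) := by
  have h1 := smooth_dEta hf
  have h2 := smooth_dXi hf
  rw [dXi_eq_fderiv (smooth_differentiable h1), dEta_eq_fderiv (smooth_differentiable h2)]
  rw [dEta_eq_fderiv (smooth_differentiable hf), dXi_eq_fderiv (smooth_differentiable hf)]
  funext p
  have hd : DifferentiableAt ℝ (fderiv ℝ f) p :=
    (hf.fderiv_right (m := ∞) (by simp)).differentiable (by simp) p
  have key : ∀ v w : ℝ × ℝ, fderiv ℝ (fun q => fderiv ℝ f q v) p w = fderiv ℝ (fderiv ℝ f) p w v := by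
    intro v w
    rw [fderiv_clm_apply hd (differentiableAt_const v)]
    simp
  rw [key, key]
  refine (hf.contDiffAt.isSymmSndFDerivAt ?_).eq _ _
  rw [minSmoothness_of_isRCLikeNormedField]
  exact WithTop.coe_le_coe.2 le_top

theorem smooth_dXi_iterate {f : ℝ × ℝ → ℝ} (hf : ContDiff ℝ ∞ f) (j : ℕ) :
    ContDiff ℝ ∞ (dXi^[j] f) := by
  induction j with
  | zero => exact hf
  | succ j ih => rw [Function.iterate_succ_apply']; exact smooth_dXi ih

theorem smooth_dEta_iterate {f : ℝ × ℝ → ℝ} (hf : ContDiff ℝ ∞ f) (j : ℕ) :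
    ContDiff ℝ ∞ (dEta^[j] f) := by
  induction j with
  | zero => exact hf
  | succ j ih => rw [Function.iterate_succ_apply']; exact smooth_dEta ih

theorem smooth_mixedDeriv {f : ℝ × ℝ → ℝ} (hf : ContDiff ℝ ∞ f) (i j : ℕ) :
    ContDiff ℝ ∞ (mixedDeriv i j f) :=
  smooth_dEta_iterate (smooth_dXi_iterate hf j) i

theorem dEta_mixedDeriv (i j : ℕ) (f : ℝ × ℝ → ℝ) :
    dEta (mixedDeriv i j f) = mixedDeriv (i + 1) j f :=
  (Function.iterate_succ_apply' dEta i (dXi^[j] f)).symm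

theorem dXi_dEta_iterate {f : ℝ × ℝ → ℝ} (hf : ContDiff ℝ ∞ f) (i : ℕ) :
    dXi (dEta^[i] f) = dEta^[i] (dXi f) := by
  induction i with
  | zero => rfl
  | succ i ih =>
    rw [Function.iterate_succ_apply', Function.iterate_succ_apply',
      dXi_dEta_comm (smooth_dEta_iterate hf i), ih]

theorem dXi_mixedDeriv {f : ℝ × ℝ → ℝ} (hf : ContDiff ℝ ∞ f) (i j : ℕ) :
    dXi (mixedDeriv i j f) = mixedDeriv i (j + 1) f := by
  unfold mixedDeriv
  rw [dXi_dEta_iterate (smooth_dXi_iterate hf j), Function.iterate_succ_apply' dXi]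

theorem mixedDeriv_dEta {f : ℝ × ℝ → ℝ} (hf : ContDiff ℝ ∞ f) (i j : ℕ) :
    mixedDeriv i j (dEta f) = mixedDeriv (i + 1) j f := by
  induction j with
  | zero => rfl
  | succ j ih => rw [← dXi_mixedDeriv (smooth_dEta hf), ih, dXi_mixedDeriv hf]

theorem dEta_add {f g : ℝ × ℝ → ℝ} (hf : ContDiff ℝ ∞ f) (hg : ContDiff ℝ ∞ g) :
    dEta (fun p => f p + g p) = fun p => dEta f p + dEta g p :=
  funext fun p => ((hasDerivAt_dEta hf p.1 p.2).add (hasDerivAt_dEta hg p.1 p.2)).deriv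

theorem dXi_add {f g : ℝ × ℝ → ℝ} (hf : ContDiff ℝ ∞ f) (hg : ContDiff ℝ ∞ g) :
    dXi (fun p => f p + g p) = fun p => dXi f p + dXi g p :=
  funext fun p => ((hasDerivAt_dXi hf p.1 p.2).add (hasDerivAt_dXi hg p.1 p.2)).deriv

theorem dEta_const_mul {f : ℝ × ℝ → ℝ} (c : ℝ) :
    dEta (fun p => c * f p) = fun p => c * dEta f p := by
  funext p; simp [dEta]

theorem dXi_const_mul {f : ℝ × ℝ → ℝ} (c : ℝ) :
    dXi (fun p => c * f p) = fun p => c * dXi f p := by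
  funext p; simp [dXi]

theorem mixedDeriv_add {f g : ℝ × ℝ → ℝ} (hf : ContDiff ℝ ∞ f) (hg : ContDiff ℝ ∞ g) (i j : ℕ) :
    mixedDeriv i j (fun p => f p + g p) = fun p => mixedDeriv i j f p + mixedDeriv i j g p := by
  induction i with
  | zero =>
    induction j with
    | zero => rfl
    | succ j ih =>
      rw [← dXi_mixedDeriv (hf.add hg), ih, dXi_add (smooth_mixedDeriv hf _ _)
        (smooth_mixedDeriv hg _ _), dXi_mixedDeriv hf, dXi_mixedDeriv hg]
  | succ i ih =>
    rw [← dEta_mixedDeriv, ih, dEta_add (smooth_mixedDeriv hf _ _)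
        (smooth_mixedDeriv hg _ _), dEta_mixedDeriv, dEta_mixedDeriv]

theorem mixedDeriv_const_mul {f : ℝ × ℝ → ℝ} (c : ℝ) (i j : ℕ) :
    mixedDeriv i j (fun p => c * f p) = fun p => c * mixedDeriv i j f p := by
  have h : dXi^[j] (fun p => c * f p) = fun p => c * dXi^[j] f p := by
    induction j with
    | zero => rfl
    | succ j ih => rw [Function.iterate_succ_apply', ih, dXi_const_mul, Function.iterate_succ_apply']
  unfold mixedDeriv
  rw [h]
  induction i with
  | zero => rfl
  | succ i ih => rw [Function.iterate_succ_apply', ih, dEta_const_mul, Function.iterate_succ_apply']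

theorem mixedDeriv_sub {f g : ℝ × ℝ → ℝ} (hf : ContDiff ℝ ∞ f) (hg : ContDiff ℝ ∞ g) (i j : ℕ) :
    mixedDeriv i j (fun p => f p - g p) = fun p => mixedDeriv i j f p - mixedDeriv i j g p := by
  have h := mixedDeriv_add hf (g := fun p => (-1) * g p) (contDiff_const.mul hg) i j
  rw [mixedDeriv_const_mul] at h
  simpa [sub_eq_add_neg] using h

theorem mixedDeriv_zero (i j : ℕ) : mixedDeriv i j (fun _ => (0 : ℝ)) = fun _ => 0 := by
  simpa using mixedDeriv_const_mul (f := fun _ => (0 : ℝ)) 0 i j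

theorem mixedDeriv_sum {ι : Type*} (s : Finset ι) {f : ι → ℝ × ℝ → ℝ}
    (hf : ∀ a ∈ s, ContDiff ℝ ∞ (f a)) (i j : ℕ) :
    mixedDeriv i j (fun p => ∑ a ∈ s, f a p) = fun p => ∑ a ∈ s, mixedDeriv i j (f a) p := by
  classical
  induction s using Finset.induction_on with
  | empty => simpa using mixedDeriv_zero i j
  | insert a s ha ih =>
    simp only [Finset.sum_insert ha]
    rw [mixedDeriv_add (hf a (by simp)) (ContDiff.sum fun b hb => hf b (by simp [hb])),
      ih fun b hb => hf b (by simp [hb])]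

/-- The mixed derivatives of a product of two functions of one variable. -/
theorem mixedDeriv_tensor (f g : ℝ → ℝ) (i j : ℕ) :
    mixedDeriv i j (fun p => f p.1 * g p.2) = fun p => deriv^[i] f p.1 * deriv^[j] g p.2 := by
  have h : dXi^[j] (fun p => f p.1 * g p.2) = fun p => f p.1 * deriv^[j] g p.2 := by
    induction j with
    | zero => rfl
    | succ j ih =>
      rw [Function.iterate_succ_apply', ih, Function.iterate_succ_apply']
      funext p; simp [dXi]
  unfold mixedDeriv
  rw [h]
  induction i with
  | zero => rfl
  | succ i ih =>
    rw [Function.iterate_succ_apply', ih, Function.iterate_succ_apply']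
    funext p; simp [dEta]

/-- The mixed derivatives of a function composed with a diagonal affine map. -/
theorem mixedDeriv_comp_affine (v : ℝ × ℝ → ℝ) (b c a d : ℝ) (i j : ℕ) :
    mixedDeriv i j (fun p => v (b + c * p.1, a + d * p.2)) =
      fun p => c ^ i * d ^ j * mixedDeriv i j v (b + c * p.1, a + d * p.2) := by
  have h : dXi^[j] (fun p => v (b + c * p.1, a + d * p.2)) =
      fun p => d ^ j * dXi^[j] v (b + c * p.1, a + d * p.2) := by
    induction j with
    | zero => simp
    | succ j ih =>
      rw [Function.iterate_succ_apply', ih, Function.iterate_succ_apply', dXi_const_mul]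
      funext p
      simp only [dXi]
      have h1 := deriv_comp_mul_left d (fun t => dXi^[j] v (b + c * p.1, a + t)) p.2
      simp only [smul_eq_mul] at h1
      rw [h1, deriv_comp_const_add (f := fun t => dXi^[j] v (b + c * p.1, t))]
      ring
  unfold mixedDeriv
  rw [h]
  induction i with
  | zero => simp
  | succ i ih =>
    rw [Function.iterate_succ_apply', ih, Function.iterate_succ_apply', dEta_const_mul]
    funext p
    simp only [dEta]
    have h1 := deriv_comp_mul_left c (fun t => dEta^[i] (dXi^[j] v) (b + t, a + d * p.2)) p.1
    simp only [smul_eq_mul] at h1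
    rw [h1, deriv_comp_const_add (f := fun t => dEta^[i] (dXi^[j] v) (t, a + d * p.2))]
    ring

/-! ### Integrals of squares -/

/-- The square of the `L²` norm. -/
noncomputable def sqInt {X : Type*} [MeasurableSpace X] (μ : Measure X) (f : X → ℝ) : ℝ :=
  ∫ x, f x ^ 2 ∂μ

section sqInt

variable {X : Type*} [MeasurableSpace X] {μ : Measure X} {f g : X → ℝ}

theorem sqInt_nonneg : 0 ≤ sqInt μ f := integral_nonneg fun _ => sq_nonneg _

theorem sqInt_congr (h : f =ᵐ[μ] g) : sqInt μ f = sqInt μ g :=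
  integral_congr_ae (h.mono fun x hx => by simp [hx])

theorem sqInt_mono (hg : MemLp g 2 μ) (h : ∀ᵐ x ∂μ, |f x| ≤ |g x|) : sqInt μ f ≤ sqInt μ g :=
  integral_mono_of_nonneg (ae_of_all _ fun _ => sq_nonneg _) hg.integrable_sq
    (h.mono fun _ hx => sq_le_sq.2 hx)

theorem sqInt_const_mul (c : ℝ) : sqInt μ (fun x => c * f x) = c ^ 2 * sqInt μ f := by
  simp only [sqInt, mul_pow, integral_const_mul]

theorem sqInt_neg : sqInt μ (fun x => -f x) = sqInt μ f := by simp [sqInt]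

theorem sqInt_add_le (hf : MemLp f 2 μ) (hg : MemLp g 2 μ) :
    sqInt μ (fun x => f x + g x) ≤ 2 * sqInt μ f + 2 * sqInt μ g := by
  unfold sqInt
  rw [← integral_const_mul, ← integral_const_mul,
    ← integral_add (hf.integrable_sq.const_mul 2) (hg.integrable_sq.const_mul 2)]
  refine integral_mono_of_nonneg (ae_of_all _ fun _ => sq_nonneg _)
    ((hf.integrable_sq.const_mul 2).add (hg.integrable_sq.const_mul 2)) (ae_of_all _ fun x => ?_)
  simp only
  nlinarith [sq_nonneg (f x - g x)]

theorem sqInt_sub_le (hf : MemLp f 2 μ) (hg : MemLp g 2 μ) :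
    sqInt μ (fun x => f x - g x) ≤ 2 * sqInt μ f + 2 * sqInt μ g := by
  have := sqInt_add_le hf (g := fun x => -g x) hg.neg
  rwa [sqInt_neg] at this

theorem sqInt_sum_le {ι : Type*} (s : Finset ι) {f : ι → X → ℝ} (hf : ∀ a ∈ s, MemLp (f a) 2 μ) :
    sqInt μ (fun x => ∑ a ∈ s, f a x) ≤ s.card * ∑ a ∈ s, sqInt μ (f a) := by
  unfold sqInt
  rw [← integral_finsetSum _ fun a ha => (hf a ha).integrable_sq, ← integral_const_mul]
  refine integral_mono_of_nonneg (ae_of_all _ fun _ => sq_nonneg _)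
    ((integrable_finsetSum _ fun a ha => (hf a ha).integrable_sq).const_mul _)
    (ae_of_all _ fun x => ?_)
  simpa using sq_sum_le_card_mul_sum_sq (s := s) (f := fun a => f a x)

theorem eLpNorm_two_sq (hf : MemLp f 2 μ) : eLpNorm f 2 μ ^ 2 = ENNReal.ofReal (sqInt μ f) := by
  rw [eLpNorm_eq_lintegral_rpow_enorm_toReal (by simp) (by simp), sqInt,
    ofReal_integral_eq_lintegral_ofReal hf.integrable_sq (ae_of_all _ fun _ => sq_nonneg _)]
  simp only [ENNReal.toReal_ofNat]
  rw [← ENNReal.rpow_natCast, ← ENNReal.rpow_mul]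
  norm_num
  refine lintegral_congr fun x => ?_
  rw [← sq_abs, ENNReal.ofReal_pow (abs_nonneg _), ← Real.norm_eq_abs, ofReal_norm]

theorem sqInt_eq_zero_iff (hf : MemLp f 2 μ) : sqInt μ f = 0 ↔ f =ᵐ[μ] 0 := by
  unfold sqInt
  rw [integral_eq_zero_iff_of_nonneg (fun _ => sq_nonneg _) hf.integrable_sq]
  constructor <;> intro h <;> filter_upwards [h] with x hx <;> simpa using hx

/-- Convergence in `L²`, stated with integrals of squares. -/
theorem tendsto_sqInt_of_tendsto_eLpNorm {F : ℕ → X → ℝ} (hF : ∀ n, MemLp (F n) 2 μ)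
    (h : Tendsto (fun n => eLpNorm (F n) 2 μ) atTop (𝓝 0)) :
    Tendsto (fun n => sqInt μ (F n)) atTop (𝓝 0) := by
  have h2 : Tendsto (fun n => eLpNorm (F n) 2 μ ^ 2) atTop (𝓝 0) := by
    simpa using ENNReal.Tendsto.pow (n := 2) h
  have h3 := (ENNReal.tendsto_toReal (ENNReal.zero_ne_top)).comp h2
  refine h3.congr fun n => ?_
  simp only [Function.comp]
  rw [eLpNorm_two_sq (hF n), ENNReal.toReal_ofReal sqInt_nonneg]

/-- The Cauchy-Schwarz inequality. -/
theorem integral_mul_sq_le (hf : MemLp f 2 μ) (hg : MemLp g 2 μ) :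
    (∫ x, f x * g x ∂μ) ^ 2 ≤ sqInt μ f * sqInt μ g := by
  have hfg : Integrable (fun x => f x * g x) μ := hf.integrable_mul hg
  have key : ∀ t : ℝ, 0 ≤ sqInt μ g * (t * t) + 2 * (∫ x, f x * g x ∂μ) * t + sqInt μ f := by
    intro t
    have : sqInt μ (fun x => f x + t * g x) =
        sqInt μ g * (t * t) + 2 * (∫ x, f x * g x ∂μ) * t + sqInt μ f := by
      have e : ∀ x, (f x + t * g x) ^ 2 = (t * t) * g x ^ 2 + (2 * t) * (f x * g x) + f x ^ 2 :=
        fun x => by ring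
      simp only [sqInt, e]
      have h1 : Integrable (fun x => t * t * g x ^ 2) μ := hg.integrable_sq.const_mul _
      have h2 : Integrable (fun x => 2 * t * (f x * g x)) μ := hfg.const_mul _
      have h3 : Integrable (fun x => t * t * g x ^ 2 + 2 * t * (f x * g x)) μ := h1.add h2
      rw [integral_add h3 hf.integrable_sq, integral_add h1 h2, integral_const_mul,
        integral_const_mul]
      ring
    rw [← this]
    exact sqInt_nonneg
  have := discrim_le_zero key
  unfold discrim at this
  nlinarith

theorem tendsto_integral_mul_of_tendsto_sqInt {F : ℕ → X → ℝ} (hF : ∀ n, MemLp (F n) 2 μ)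
    (hf : MemLp f 2 μ) (hg : MemLp g 2 μ)
    (h : Tendsto (fun n => sqInt μ (fun x => F n x - f x)) atTop (𝓝 0)) :
    Tendsto (fun n => ∫ x, F n x * g x ∂μ) atTop (𝓝 (∫ x, f x * g x ∂μ)) := by
  rw [tendsto_iff_norm_sub_tendsto_zero]
  have h1 : Tendsto (fun n => √(sqInt μ (fun x => F n x - f x) * sqInt μ g)) atTop (𝓝 0) := by
    simpa using (h.mul_const (sqInt μ g)).sqrt
  refine squeeze_zero (fun _ => norm_nonneg _) (fun n => ?_) h1
  have e : ∫ x, F n x * g x ∂μ - ∫ x, f x * g x ∂μ = ∫ x, (F n x - f x) * g x ∂μ := by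
    have h1 : Integrable (fun x => F n x * g x) μ := (hF n).integrable_mul hg
    have h2 : Integrable (fun x => f x * g x) μ := hf.integrable_mul hg
    simp only [sub_mul]
    rw [integral_sub h1 h2]
  rw [e, Real.norm_eq_abs]
  exact Real.abs_le_sqrt (integral_mul_sq_le ((hF n).sub hf) hg)

end sqInt

/-! ### Finite-dimensional spaces of square-integrable functions -/

section FiniteDimensional

variable {X Y E : Type*} [MeasurableSpace X] [MeasurableSpace Y] {μ : Measure X} {ν : Measure Y}
  [AddCommGroup E] [Module ℝ E]

/-- A linear map into functions, all of whose values are square-integrable, as a map into `L²`. -/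
noncomputable def toLpLinear (A : E →ₗ[ℝ] (X → ℝ)) (hA : ∀ e, MemLp (A e) 2 μ) :
    E →ₗ[ℝ] Lp ℝ 2 μ where
  toFun e := (hA e).toLp (A e)
  map_add' e e' := by
    rw [← MemLp.toLp_add]; exact MemLp.toLp_congr _ _ (ae_of_all _ fun x => by simp)
  map_smul' c e := by
    rw [RingHom.id_apply, ← MemLp.toLp_const_smul]
    exact MemLp.toLp_congr _ _ (ae_of_all _ fun x => by simp)

theorem norm_toLp_sq {f : X → ℝ} (hf : MemLp f 2 μ) : ‖hf.toLp f‖ ^ 2 = sqInt μ f := by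
  rw [Lp.norm_toLp, ← ENNReal.toReal_pow, eLpNorm_two_sq hf, ENNReal.toReal_ofReal sqInt_nonneg]

/-- On a finite-dimensional space every family of square-integrable functions is controlled by any
other one that depends injectively on the parameter. -/
theorem exists_sqInt_le [FiniteDimensional ℝ E] (A : E →ₗ[ℝ] (X → ℝ)) (B : E →ₗ[ℝ] (Y → ℝ))
    (hA : ∀ e, MemLp (A e) 2 μ) (hB : ∀ e, MemLp (B e) 2 ν)
    (hinj : ∀ e, sqInt μ (A e) = 0 → e = 0) :
    ∃ C : ℝ, 0 ≤ C ∧ ∀ e, sqInt ν (B e) ≤ C * sqInt μ (A e) := by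
  have hi : Function.Injective (toLpLinear A hA) := by
    rw [← LinearMap.ker_eq_bot, LinearMap.ker_eq_bot']
    intro e he
    apply hinj
    rw [← norm_toLp_sq (hA e)]
    have : (hA e).toLp (A e) = 0 := he
    simp [this]
  let Φ := LinearEquiv.ofInjective (toLpLinear A hA) hi
  have : FiniteDimensional ℝ (LinearMap.range (toLpLinear A hA)) := Φ.finiteDimensional
  let T := LinearMap.toContinuousLinearMap ((toLpLinear B hB).comp Φ.symm.toLinearMap)
  refine ⟨‖T‖ ^ 2, sq_nonneg _, fun e => ?_⟩
  rw [← norm_toLp_sq (hA e), ← norm_toLp_sq (hB e), ← mul_pow]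
  have h := T.le_opNorm (Φ e)
  have h1 : T (Φ e) = (hB e).toLp (B e) := by
    change toLpLinear B hB (Φ.symm (Φ e)) = _
    rw [LinearEquiv.symm_apply_apply]; rfl
  have h2 : ‖Φ e‖ = ‖(hA e).toLp (A e)‖ := rfl
  rw [h1, h2] at h
  exact pow_le_pow_left₀ (norm_nonneg _) h 2

/-- Existence of the `L²`-orthogonal projection onto a finite-dimensional space of functions. -/
theorem exists_l2_projection [FiniteDimensional ℝ E] (A : E →ₗ[ℝ] (X → ℝ))
    (hA : ∀ e, MemLp (A e) 2 μ) {u : X → ℝ} (hu : MemLp u 2 μ) :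
    ∃ e, ∀ e', ∫ x, (A e x - u x) * A e' x ∂μ = 0 := by
  let R := LinearMap.range (toLpLinear A hA)
  obtain ⟨e, he⟩ := (R.starProjection_apply_mem (hu.toLp u) : _ ∈ R)
  refine ⟨e, fun e' => ?_⟩
  have h := R.sub_starProjection_mem_orthogonal (hu.toLp u) (toLpLinear A hA e') ⟨e', rfl⟩
  rw [← he, L2.inner_def] at h
  have : ∫ x, (A e x - u x) * A e' x ∂μ = -∫ x, inner ℝ ((toLpLinear A hA e' : Lp ℝ 2 μ) x)
      ((hu.toLp u - toLpLinear A hA e : Lp ℝ 2 μ) x) ∂μ := by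
    rw [← integral_neg]
    refine integral_congr_ae ?_
    filter_upwards [(hA e).coeFn_toLp, (hA e').coeFn_toLp, hu.coeFn_toLp,
      Lp.coeFn_sub (hu.toLp u) ((hA e).toLp (A e))] with x h1 h2 h3 h4
    change _ = -inner ℝ ((hA e').toLp (A e') x) ((hu.toLp u - (hA e).toLp (A e) : Lp ℝ 2 μ) x)
    rw [h4, Pi.sub_apply, h1, h2, h3, real_inner_comm, real_inner_eq_re_inner]
    simp [inner]
    ring
  rw [this, h, neg_zero]

end FiniteDimensional

/-! ### Tensor-product polynomials -/

theorem monomial_mem_tensorPoly {m i j : ℕ} (hi : i ≤ m) (hj : j ≤ m) :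
    (fun p : ℝ × ℝ => p.1 ^ i * p.2 ^ j) ∈ tensorPoly m :=
  Submodule.subset_span ⟨i, hi, j, hj, rfl⟩

instance tensorPoly_finiteDimensional (m : ℕ) : FiniteDimensional ℝ (tensorPoly m) := by
  refine FiniteDimensional.span_of_finite ℝ ?_
  refine ((Set.finite_Iic m).image2 (fun i j => fun p : ℝ × ℝ => p.1 ^ i * p.2 ^ j)
    (Set.finite_Iic m)).subset ?_
  rintro f ⟨i, hi, j, hj, rfl⟩
  exact ⟨i, hi, j, hj, rfl⟩

theorem tensorPoly_mono {m n : ℕ} (h : m ≤ n) : tensorPoly m ≤ tensorPoly n :=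
  Submodule.span_mono fun _ ⟨i, hi, j, hj, e⟩ => ⟨i, hi.trans h, j, hj.trans h, e⟩

theorem tensorPoly_analytic {m : ℕ} {f : ℝ × ℝ → ℝ} (hf : f ∈ tensorPoly m) :
    AnalyticOnNhd ℝ f univ := by
  induction hf using Submodule.span_induction with
  | mem f h =>
    obtain ⟨i, _, j, _, rfl⟩ := h
    exact (analyticOnNhd_fst.pow i).mul (analyticOnNhd_snd.pow j)
  | zero => exact analyticOnNhd_const
  | add f g _ _ hf hg => exact hf.add hg
  | smul c f _ hf => exact (analyticOnNhd_const (v := c)).mul hf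

theorem tensorPoly_smooth {m : ℕ} {f : ℝ × ℝ → ℝ} (hf : f ∈ tensorPoly m) : ContDiff ℝ ∞ f :=
  contDiffOn_univ.1 ((tensorPoly_analytic hf).contDiffOn uniqueDiffOn_univ)

/-- A tensor-product polynomial that vanishes almost everywhere on a nonempty open set vanishes
identically. -/
theorem tensorPoly_eq_zero {m : ℕ} {f : ℝ × ℝ → ℝ} (hf : f ∈ tensorPoly m) {U : Set (ℝ × ℝ)}
    (hU : IsOpen U) (hne : U.Nonempty) (h : f =ᵐ[volume.restrict U] 0) : f = 0 := by
  have hcont := (tensorPoly_smooth hf).continuous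
  have h0 : EqOn f 0 U :=
    Measure.eqOn_open_of_ae_eq h hU hcont.continuousOn continuousOn_const
  obtain ⟨p, hp⟩ := hne
  have := (tensorPoly_analytic hf).eqOn_of_preconnected_of_eventuallyEq
    (analyticOnNhd_const (v := (0 : ℝ))) isPreconnected_univ (mem_univ p)
    (h0.eventuallyEq_of_mem (hU.mem_nhds hp))
  exact funext fun q => this (mem_univ q)

/-- Products of one-variable polynomials of degree at most `m` are tensor-product polynomials. -/
theorem eval_mul_eval_mem_tensorPoly {m : ℕ} {P R : Polynomial ℝ} (hP : P.natDegree ≤ m)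
    (hR : R.natDegree ≤ m) : (fun p : ℝ × ℝ => P.eval p.1 * R.eval p.2) ∈ tensorPoly m := by
  have e : (fun p : ℝ × ℝ => P.eval p.1 * R.eval p.2) =
      ∑ i ∈ Finset.range (m + 1), ∑ j ∈ Finset.range (m + 1),
        (P.coeff i * R.coeff j) • fun p : ℝ × ℝ => p.1 ^ i * p.2 ^ j := by
    funext p
    rw [Polynomial.eval_eq_sum_range' (Nat.lt_succ_of_le hP),
      Polynomial.eval_eq_sum_range' (Nat.lt_succ_of_le hR), Finset.sum_mul_sum]
    simp only [Finset.sum_apply, Pi.smul_apply, smul_eq_mul]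
    exact Finset.sum_congr rfl fun i _ => Finset.sum_congr rfl fun j _ => by ring
  rw [e]
  exact Submodule.sum_mem _ fun i hi => Submodule.sum_mem _ fun j hj =>
    Submodule.smul_mem _ _ (monomial_mem_tensorPoly (Nat.lt_succ_iff.1 (Finset.mem_range.1 hi))
      (Nat.lt_succ_iff.1 (Finset.mem_range.1 hj)))

theorem tensorPoly_comp_affine {m : ℕ} {f : ℝ × ℝ → ℝ} (hf : f ∈ tensorPoly m) (c a d : ℝ) :
    (fun p : ℝ × ℝ => f (c * p.1, a + d * p.2)) ∈ tensorPoly m := by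
  induction hf using Submodule.span_induction with
  | mem f h =>
    obtain ⟨i, hi, j, hj, rfl⟩ := h
    have h1 := eval_mul_eval_mem_tensorPoly (m := m) (P := (Polynomial.C c * Polynomial.X) ^ i)
      (R := (Polynomial.C a + Polynomial.C d * Polynomial.X) ^ j) ?_ ?_
    · simpa using h1
    · refine (Polynomial.natDegree_pow_le_of_le i (m := 1) ?_).trans (by simpa using hi)
      compute_degree
    · refine (Polynomial.natDegree_pow_le_of_le j (m := 1) ?_).trans (by simpa using hj)
      compute_degree
  | zero => exact Submodule.zero_mem _
  | add f g _ _ hf hg => exact Submodule.add_mem _ hf hg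
  | smul r f _ hf => exact Submodule.smul_mem _ r hf

/-- The normalized monomial `η^i ξ^j / (i! j!)`. -/
noncomputable def taylorMonomial (i j : ℕ) (p : ℝ × ℝ) : ℝ :=
  (p.1 ^ i / i.factorial) * (p.2 ^ j / j.factorial)

theorem taylorMonomial_mem {m i j : ℕ} (hi : i ≤ m) (hj : j ≤ m) :
    taylorMonomial i j ∈ tensorPoly m := by
  have e : taylorMonomial i j = ((i.factorial : ℝ)⁻¹ * (j.factorial : ℝ)⁻¹) •
      fun p : ℝ × ℝ => p.1 ^ i * p.2 ^ j := by
    funext p; simp only [taylorMonomial, Pi.smul_apply, smul_eq_mul]; ring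
  rw [e]
  exact Submodule.smul_mem _ _ (monomial_mem_tensorPoly hi hj)

theorem iterate_deriv_pow_div_factorial (i k : ℕ) :
    deriv^[k] (fun x : ℝ => x ^ i / i.factorial) =
      fun x => if k ≤ i then x ^ (i - k) / ((i - k).factorial : ℝ) else 0 := by
  induction k with
  | zero => simp
  | succ k ih =>
    rw [Function.iterate_succ_apply', ih]
    funext x
    rcases lt_trichotomy k i with h | h | h
    · rw [if_pos (Nat.succ_le_of_lt h)]
      simp only [if_pos h.le]
      obtain ⟨d, rfl⟩ := Nat.exists_eq_add_of_lt h
      rw [show k + d + 1 - k = d + 1 by omega, show k + d + 1 - (k + 1) = d by omega]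
      rw [deriv_div_const, deriv_pow_field, Nat.factorial_succ]
      have := Nat.factorial_ne_zero d
      push_cast
      field_simp
    · subst h; simp
    · rw [if_neg (by omega)]
      simp [if_neg (not_le.2 h)]

theorem mixedDeriv_taylorMonomial (i j k l : ℕ) :
    mixedDeriv k l (taylorMonomial i j) =
      if k ≤ i ∧ l ≤ j then taylorMonomial (i - k) (j - l) else fun _ => 0 := by
  unfold taylorMonomial
  rw [mixedDeriv_tensor (fun x => x ^ i / i.factorial) (fun x => x ^ j / j.factorial),
    iterate_deriv_pow_div_factorial, iterate_deriv_pow_div_factorial]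
  funext p
  by_cases h1 : k ≤ i <;> by_cases h2 : l ≤ j <;> simp [h1, h2]

/-! ### Poincaré, trace and Bramble–Hilbert estimates on the unit square -/

/-- Lebesgue measure on the unit interval. -/
noncomputable abbrev unitMeasure : Measure ℝ := volume.restrict (Ioo 0 1)

/-- Lebesgue measure on the unit square. -/
noncomputable abbrev squareMeasure : Measure (ℝ × ℝ) := volume.restrict (Ioo 0 1 ×ˢ Ioo 0 1)

theorem squareMeasure_eq_prod : squareMeasure = unitMeasure.prod unitMeasure := by
  rw [squareMeasure, Measure.volume_eq_prod, Measure.prod_restrict]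

instance : IsProbabilityMeasure unitMeasure := ⟨by simp⟩

theorem memLp_of_continuousOn {X : Type*} [MeasurableSpace X] [TopologicalSpace X]
    [OpensMeasurableSpace X] [T2Space X] {μ : Measure X} [IsFiniteMeasureOnCompacts μ]
    {f : X → ℝ} {s K : Set X} (hK : IsCompact K) (hs : MeasurableSet s) (hsK : s ⊆ K)
    (hf : ContinuousOn f K) (p : ENNReal) : MemLp f p (μ.restrict s) := by
  obtain ⟨C, hC⟩ := hK.exists_bound_of_continuousOn hf
  have : IsFiniteMeasure (μ.restrict s) :=
    ⟨by rw [Measure.restrict_apply_univ]; exact (measure_mono hsK).trans_lt hK.measure_lt_top⟩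
  have hm : AEStronglyMeasurable f (μ.restrict K) :=
    hf.aestronglyMeasurable_of_isCompact hK hK.measurableSet
  exact MemLp.of_bound (hm.mono_measure (Measure.restrict_mono hsK le_rfl)) C
    ((ae_restrict_iff' hs).2 (ae_of_all _ fun x hx => hC x (hsK hx)))

theorem memLp_unit {f : ℝ → ℝ} (hf : ContinuousOn f (Icc 0 1)) : MemLp f 2 unitMeasure :=
  memLp_of_continuousOn isCompact_Icc measurableSet_Ioo Ioo_subset_Icc_self hf 2

theorem memLp_square {f : ℝ × ℝ → ℝ} (hf : ContinuousOn f (Icc 0 1 ×ˢ Icc 0 1)) :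
    MemLp f 2 squareMeasure :=
  memLp_of_continuousOn (isCompact_Icc.prod isCompact_Icc) (measurableSet_Ioo.prod measurableSet_Ioo)
    (prod_mono Ioo_subset_Icc_self Ioo_subset_Icc_self) hf 2

theorem memLp_square_of_smooth {f : ℝ × ℝ → ℝ} (hf : ContDiff ℝ ∞ f) : MemLp f 2 squareMeasure :=
  memLp_square hf.continuous.continuousOn

theorem sqInt_square {f : ℝ × ℝ → ℝ} (hf : MemLp f 2 squareMeasure) :
    sqInt squareMeasure f = ∫ s, sqInt unitMeasure (fun t => f (s, t)) ∂unitMeasure := by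
  have h := hf.integrable_sq
  unfold sqInt
  rw [squareMeasure_eq_prod] at h ⊢
  exact integral_prod _ h

theorem sqInt_square_symm {f : ℝ × ℝ → ℝ} (hf : MemLp f 2 squareMeasure) :
    sqInt squareMeasure f = ∫ t, sqInt unitMeasure (fun s => f (s, t)) ∂unitMeasure := by
  have h := hf.integrable_sq
  unfold sqInt
  rw [squareMeasure_eq_prod] at h ⊢
  exact integral_prod_symm _ h

theorem integrable_sqInt_fst {f : ℝ × ℝ → ℝ} (hf : MemLp f 2 squareMeasure) :
    Integrable (fun s => sqInt unitMeasure (fun t => f (s, t))) unitMeasure := by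
  have h := hf.integrable_sq
  rw [squareMeasure_eq_prod] at h
  exact h.integral_prod_left

theorem integrable_sqInt_snd {f : ℝ × ℝ → ℝ} (hf : MemLp f 2 squareMeasure) :
    Integrable (fun t => sqInt unitMeasure (fun s => f (s, t))) unitMeasure := by
  have h := hf.integrable_sq
  rw [squareMeasure_eq_prod] at h
  exact h.integral_prod_right

/-- The one-dimensional oscillation bound: `|f(x) - f(y)|² ≤ ∫₀¹ f'²`. -/
theorem sq_sub_le_sqInt_deriv {f f' : ℝ → ℝ} (hf : ∀ x ∈ Icc (0 : ℝ) 1, HasDerivAt f (f' x) x)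
    (hc : ContinuousOn f' (Icc 0 1)) {x y : ℝ} (hx : x ∈ Icc (0 : ℝ) 1) (hy : y ∈ Icc (0 : ℝ) 1) :
    (f x - f y) ^ 2 ≤ sqInt unitMeasure f' := by
  wlog h : y ≤ x generalizing x y
  · have := this hy hx (le_of_not_ge h)
    nlinarith
  have hsub : uIcc y x ⊆ Icc 0 1 := by rw [uIcc_of_le h]; exact Icc_subset_Icc hy.1 hx.2
  have hftc : ∫ z in y..x, f' z = f x - f y :=
    intervalIntegral.integral_eq_sub_of_hasDerivAt (fun z hz => hf z (hsub hz))
      (hc.mono hsub).intervalIntegrable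
  have hM := memLp_unit hc
  have hMa : MemLp (fun z => |f' z|) 2 unitMeasure := hM.abs
  have hcs := integral_mul_sq_le hMa (memLp_const (1 : ℝ))
  have h1 : |f x - f y| ≤ ∫ z, |f' z| * 1 ∂unitMeasure := by
    rw [← hftc, intervalIntegral.integral_of_le h, integral_Ioc_eq_integral_Ioo]
    refine (abs_integral_le_integral_abs).trans ?_
    simp only [mul_one]
    exact setIntegral_mono_set (hMa.integrable (by norm_num))
      (ae_of_all _ fun _ => abs_nonneg _) (Ioo_subset_Ioo hy.1 hx.2).eventuallyLE
  have h2 : sqInt unitMeasure (fun z => |f' z|) = sqInt unitMeasure f' := by simp [sqInt]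
  have h3 : sqInt unitMeasure (fun _ => (1 : ℝ)) = 1 := by simp [sqInt]
  rw [h2, h3, mul_one] at hcs
  rw [← sq_abs]
  exact (pow_le_pow_left₀ (abs_nonneg _) h1 2).trans hcs

/-- The trace inequality on the side `s = 0` of the unit square. -/
theorem sqInt_trace_le {f f' : ℝ × ℝ → ℝ} (hf : ContinuousOn f (Icc 0 1 ×ˢ Icc 0 1))
    (hf' : ContinuousOn f' (Icc 0 1 ×ˢ Icc 0 1))
    (hd : ∀ p ∈ Icc (0 : ℝ) 1 ×ˢ Icc (0 : ℝ) 1, HasDerivAt (fun s => f (s, p.2)) (f' p) p.1) :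
    sqInt unitMeasure (fun t => f (0, t)) ≤
      2 * sqInt squareMeasure f + 2 * sqInt squareMeasure f' := by
  have hM := memLp_square hf
  have hM' := memLp_square hf'
  rw [sqInt_square_symm hM, sqInt_square_symm hM', ← integral_const_mul, ← integral_const_mul,
    ← integral_add ((integrable_sqInt_snd hM).const_mul 2) ((integrable_sqInt_snd hM').const_mul 2)]
  refine integral_mono_of_nonneg (ae_of_all _ fun _ => sq_nonneg _)
    (((integrable_sqInt_snd hM).const_mul 2).add ((integrable_sqInt_snd hM').const_mul 2)) ?_
  refine (ae_restrict_iff' measurableSet_Ioo).2 (ae_of_all _ fun t ht => ?_)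
  have htI := Ioo_subset_Icc_self ht
  have hsl : ContinuousOn (fun s => f (s, t)) (Icc 0 1) :=
    hf.comp (by fun_prop) fun s hs => ⟨hs, htI⟩
  have hsl' : ContinuousOn (fun s => f' (s, t)) (Icc 0 1) :=
    hf'.comp (by fun_prop) fun s hs => ⟨hs, htI⟩
  have hint := (memLp_unit hsl).integrable_sq
  have key : ∀ s ∈ Ioo (0 : ℝ) 1,
      f (0, t) ^ 2 ≤ 2 * f (s, t) ^ 2 + 2 * sqInt unitMeasure (fun s => f' (s, t)) := by
    intro s hs
    have := sq_sub_le_sqInt_deriv (f := fun s => f (s, t)) (fun x hx => hd (x, t) ⟨hx, htI⟩) hsl'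
      (left_mem_Icc.2 zero_le_one) (Ioo_subset_Icc_self hs)
    nlinarith [sq_nonneg (f (0, t) - 2 * f (s, t))]
  have h1 : ∫ _, f (0, t) ^ 2 ∂unitMeasure ≤
      ∫ s, (2 * f (s, t) ^ 2 + 2 * sqInt unitMeasure (fun s => f' (s, t))) ∂unitMeasure := by
    refine integral_mono_ae (integrable_const _) ((hint.const_mul 2).add (integrable_const _)) ?_
    exact (ae_restrict_iff' measurableSet_Ioo).2 (ae_of_all _ key)
  rw [integral_add (hint.const_mul 2) (integrable_const _), integral_const_mul] at h1
  simpa [sqInt] using h1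

theorem sqInt_trace_le_of_smooth {f : ℝ × ℝ → ℝ} (hf : ContDiff ℝ ∞ f) :
    sqInt unitMeasure (fun t => f (0, t)) ≤
      2 * sqInt squareMeasure f + 2 * sqInt squareMeasure (dEta f) :=
  sqInt_trace_le hf.continuous.continuousOn (smooth_dEta hf).continuous.continuousOn
    fun p _ => hasDerivAt_dEta hf p.1 p.2

/-- The Poincaré inequality on the unit square; the constant is the value of the function at a
suitable point. -/
theorem exists_sqInt_sub_const_le {f : ℝ × ℝ → ℝ} (hf : ContDiff ℝ ∞ f) :
    ∃ c : ℝ, sqInt squareMeasure (fun p => f p - c) ≤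
      2 * sqInt squareMeasure (dEta f) + 2 * sqInt squareMeasure (dXi f) := by
  have h1 := memLp_square_of_smooth (smooth_dEta hf)
  have h2 := memLp_square_of_smooth (smooth_dXi hf)
  -- On the segment `η = x` the integral of `|f_ξ|²` is at most its average over all segments.
  obtain ⟨x, hx, hxle⟩ := exists_le_setAverage (μ := volume) (s := Ioo (0 : ℝ) 1) (by simp)
    (by simp) (integrable_sqInt_fst h2)
  have hav : ⨍ s in Ioo (0 : ℝ) 1, sqInt unitMeasure (fun t => dXi f (s, t)) =
      sqInt squareMeasure (dXi f) := by
    rw [sqInt_square h2, setAverage_eq]; simp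
  rw [hav] at hxle
  have h0 : (0 : ℝ) ∈ Icc (0 : ℝ) 1 := left_mem_Icc.2 zero_le_one
  refine ⟨f (x, 0), ?_⟩
  have hg : MemLp (fun p => f p - f (x, 0)) 2 squareMeasure :=
    memLp_square_of_smooth (hf.sub contDiff_const)
  set A := sqInt unitMeasure (fun t => dXi f (x, t))
  have key : ∀ t ∈ Ioo (0 : ℝ) 1, sqInt unitMeasure (fun s => f (s, t) - f (x, 0)) ≤
      2 * sqInt unitMeasure (fun s => dEta f (s, t)) + 2 * A := by
    intro t ht
    have hle : ∀ s ∈ Ioo (0 : ℝ) 1, (f (s, t) - f (x, 0)) ^ 2 ≤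
        2 * sqInt unitMeasure (fun s => dEta f (s, t)) + 2 * A := by
      intro s hs
      have a1 := sq_sub_le_sqInt_deriv (f := fun s => f (s, t)) (f' := fun s => dEta f (s, t))
        (fun y _ => hasDerivAt_dEta hf y t)
        ((smooth_dEta hf).continuous.comp (by fun_prop)).continuousOn
        (Ioo_subset_Icc_self hs) (Ioo_subset_Icc_self hx)
      have a2 := sq_sub_le_sqInt_deriv (f := fun t => f (x, t)) (f' := fun t => dXi f (x, t))
        (fun y _ => hasDerivAt_dXi hf x y)
        ((smooth_dXi hf).continuous.comp (by fun_prop)).continuousOn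
        (Ioo_subset_Icc_self ht) h0
      change _ ≤ A at a2
      nlinarith [sq_nonneg ((f (s, t) - f (x, t)) - (f (x, t) - f (x, 0)))]
    have hint : ∫ s, (f (s, t) - f (x, 0)) ^ 2 ∂unitMeasure ≤ ∫ _,
        (2 * sqInt unitMeasure (fun s => dEta f (s, t)) + 2 * A) ∂unitMeasure :=
      integral_mono_of_nonneg (ae_of_all _ fun _ => sq_nonneg _) (integrable_const _)
        ((ae_restrict_iff' measurableSet_Ioo).2 (ae_of_all _ hle))
    simpa [sqInt] using hint
  rw [sqInt_square_symm hg, sqInt_square_symm h1]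
  have hint2 : ∫ t, sqInt unitMeasure (fun s => f (s, t) - f (x, 0)) ∂unitMeasure ≤
      ∫ t, (2 * sqInt unitMeasure (fun s => dEta f (s, t)) + 2 * A) ∂unitMeasure :=
    integral_mono_of_nonneg (ae_of_all _ fun _ => sqInt_nonneg)
      (((integrable_sqInt_snd h1).const_mul 2).add (integrable_const _))
      ((ae_restrict_iff' measurableSet_Ioo).2 (ae_of_all _ key))
  rw [integral_add ((integrable_sqInt_snd h1).const_mul 2) (integrable_const _),
    integral_const_mul] at hint2
  rw [integral_const, probReal_univ, one_smul] at hint2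
  linarith

/-- The square of the `H^k` seminorm of a smooth function on the unit square. -/
noncomputable def squareSeminormSq (k : ℕ) (v : ℝ × ℝ → ℝ) : ℝ :=
  ∑ ij ∈ Finset.HasAntidiagonal.antidiagonal k, sqInt squareMeasure (mixedDeriv ij.1 ij.2 v)

theorem squareSeminormSq_nonneg (k : ℕ) (v : ℝ × ℝ → ℝ) : 0 ≤ squareSeminormSq k v :=
  Finset.sum_nonneg fun _ _ => sqInt_nonneg

theorem sqInt_le_squareSeminormSq {i j k : ℕ} (h : i + j = k) (v : ℝ × ℝ → ℝ) :
    sqInt squareMeasure (mixedDeriv i j v) ≤ squareSeminormSq k v :=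
  Finset.single_le_sum (f := fun ij : ℕ × ℕ => sqInt squareMeasure (mixedDeriv ij.1 ij.2 v))
    (fun _ _ => sqInt_nonneg) (Finset.HasAntidiagonal.mem_antidiagonal.2 (show (i, j).1 + (i, j).2 = k from h))

/-- For every smooth function there is a homogeneous polynomial of degree `n` whose derivatives of
order `n` are close to those of the function. -/
theorem exists_homogeneous_approx (n : ℕ) {v : ℝ × ℝ → ℝ} (hv : ContDiff ℝ ∞ v) :
    ∃ q ∈ tensorPoly n, (∀ i j, n < i + j → mixedDeriv i j q = fun _ => 0) ∧
      ∀ i j, i + j = n → sqInt squareMeasure (mixedDeriv i j (fun p => v p - q p)) ≤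
        4 * squareSeminormSq (n + 1) v := by
  have hP : ∀ ij : ℕ × ℕ, ∃ c : ℝ, ij.1 + ij.2 = n →
      sqInt squareMeasure (fun p => mixedDeriv ij.1 ij.2 v p - c) ≤
        4 * squareSeminormSq (n + 1) v := by
    rintro ⟨i, j⟩
    obtain ⟨c, hc⟩ := exists_sqInt_sub_const_le (smooth_mixedDeriv hv i j)
    refine ⟨c, fun (h : i + j = n) => hc.trans ?_⟩
    rw [dEta_mixedDeriv, dXi_mixedDeriv hv]
    have h1 := sqInt_le_squareSeminormSq (i := i + 1) (j := j) (k := n + 1) (by omega) v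
    have h2 := sqInt_le_squareSeminormSq (i := i) (j := j + 1) (k := n + 1) (by omega) v
    linarith
  choose c hc using hP
  let q : ℝ × ℝ → ℝ := fun p => ∑ ij ∈ Finset.HasAntidiagonal.antidiagonal n,
    c ij * taylorMonomial ij.1 ij.2 p
  have hqm : q ∈ tensorPoly n := by
    have : q = ∑ ij ∈ Finset.HasAntidiagonal.antidiagonal n, c ij • taylorMonomial ij.1 ij.2 := by
      funext p; simp [q]
    rw [this]
    refine Submodule.sum_mem _ fun ij hij => Submodule.smul_mem _ _ (taylorMonomial_mem ?_ ?_)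
    · have := Finset.HasAntidiagonal.mem_antidiagonal.1 hij; omega
    · have := Finset.HasAntidiagonal.mem_antidiagonal.1 hij; omega
  have hqd : ∀ i j, mixedDeriv i j q = fun p => ∑ kl ∈ Finset.HasAntidiagonal.antidiagonal n,
      c kl * (if i ≤ kl.1 ∧ j ≤ kl.2 then taylorMonomial (kl.1 - i) (kl.2 - j) else fun _ => 0) p := by
    intro i j
    have hs : ∀ kl ∈ Finset.HasAntidiagonal.antidiagonal n,
        ContDiff ℝ ∞ (fun p => c kl * taylorMonomial kl.1 kl.2 p) := fun kl _ =>
      contDiff_const.mul (tensorPoly_smooth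
        (taylorMonomial_mem (le_max_left kl.1 kl.2) (le_max_right kl.1 kl.2)))
    rw [mixedDeriv_sum _ hs]
    simp only [mixedDeriv_const_mul, mixedDeriv_taylorMonomial]
  refine ⟨q, hqm, fun i j hij => ?_, fun i j hij => ?_⟩
  · rw [hqd]
    funext p
    refine Finset.sum_eq_zero fun kl hkl => ?_
    rw [if_neg, mul_zero]
    have := Finset.HasAntidiagonal.mem_antidiagonal.1 hkl
    omega
  · have e : mixedDeriv i j q = fun _ => c (i, j) := by
      rw [hqd]
      funext p
      rw [Finset.sum_eq_single (i, j)]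
      · simp [taylorMonomial]
      · rintro ⟨k, l⟩ hkl hne
        have := Finset.HasAntidiagonal.mem_antidiagonal.1 hkl
        rw [if_neg, mul_zero]
        rintro ⟨h1, h2⟩
        simp only at this h1 h2
        exact hne (Prod.ext (by simp only; omega) (by simp only; omega))
      · intro h; exact absurd (Finset.HasAntidiagonal.mem_antidiagonal.2 hij) h
    rw [mixedDeriv_sub hv (tensorPoly_smooth hqm), e]
    exact hc (i, j) hij

/-- The Bramble–Hilbert lemma on the unit square. -/
theorem exists_polynomial_approx (n : ℕ) :
    ∃ C : ℝ, 0 ≤ C ∧ ∀ v : ℝ × ℝ → ℝ, ContDiff ℝ ∞ v → ∃ q ∈ tensorPoly n,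
      ∀ i j, i + j ≤ n + 1 → sqInt squareMeasure (mixedDeriv i j (fun p => v p - q p)) ≤
        C * squareSeminormSq (n + 1) v := by
  suffices H : ∃ C : ℝ, 1 ≤ C ∧ ∀ v : ℝ × ℝ → ℝ, ContDiff ℝ ∞ v → ∃ q ∈ tensorPoly n,
      (∀ i j, n < i + j → mixedDeriv i j q = fun _ => 0) ∧
      ∀ i j, i + j ≤ n + 1 → sqInt squareMeasure (mixedDeriv i j (fun p => v p - q p)) ≤
        C * squareSeminormSq (n + 1) v by
    obtain ⟨C, hC, H⟩ := H
    refine ⟨C, by linarith, fun v hv => ?_⟩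
    obtain ⟨q, hq, -, h⟩ := H v hv
    exact ⟨q, hq, h⟩
  -- For the derivatives of top order the polynomial does not matter.
  have top : ∀ (n : ℕ) (C : ℝ), 1 ≤ C → ∀ v : ℝ × ℝ → ℝ, ContDiff ℝ ∞ v → ∀ q ∈ tensorPoly n,
      (∀ i j, n < i + j → mixedDeriv i j q = fun _ => 0) → ∀ i j, i + j = n + 1 →
      sqInt squareMeasure (mixedDeriv i j (fun p => v p - q p)) ≤
        C * squareSeminormSq (n + 1) v := by
    intro n C hC v hv q hq h0 i j hij
    rw [mixedDeriv_sub hv (tensorPoly_smooth hq), h0 i j (by omega)]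
    simp only [sub_zero]
    have h1 := sqInt_le_squareSeminormSq hij v
    nlinarith [squareSeminormSq_nonneg (n + 1) v]
  induction n with
  | zero =>
    refine ⟨4, by norm_num, fun v hv => ?_⟩
    obtain ⟨q, hq, h0, h⟩ := exists_homogeneous_approx 0 hv
    refine ⟨q, hq, h0, fun i j hij => ?_⟩
    rcases Nat.eq_zero_or_pos (i + j) with hz | hpos
    · exact h i j hz
    · exact top 0 4 (by norm_num) v hv q hq h0 i j (by omega)
  | succ n ih =>
    obtain ⟨C, hC, ih⟩ := ih
    have hcard : (1 : ℝ) ≤ (n + 2 : ℝ) := by linarith [n.cast_nonneg (α := ℝ)]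
    have hC' : 1 ≤ C * ((n + 2) * 4) := by nlinarith
    refine ⟨C * ((n + 2) * 4), hC', fun v hv => ?_⟩
    -- After subtraction of the homogeneous part `p` of top degree, the derivatives of order `n + 1`
    -- are bounded by those of order `n + 2`, and the induction hypothesis applies to `v - p`.
    obtain ⟨p, hp, hp0, hpv⟩ := exists_homogeneous_approx (n + 1) hv
    have hvp : ContDiff ℝ ∞ (fun x => v x - p x) := hv.sub (tensorPoly_smooth hp)
    obtain ⟨q, hq, hq0, hqv⟩ := ih _ hvp
    have hpq : (fun x => p x + q x) ∈ tensorPoly (n + 1) :=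
      Submodule.add_mem _ hp (tensorPoly_mono n.le_succ hq)
    have hpq0 : ∀ i j, n + 1 < i + j → mixedDeriv i j (fun x => p x + q x) = fun _ => 0 := by
      intro i j hij
      rw [mixedDeriv_add (tensorPoly_smooth hp) (tensorPoly_smooth hq), hp0 i j hij,
        hq0 i j (by omega)]
      simp
    refine ⟨fun x => p x + q x, hpq, hpq0, fun i j hij => ?_⟩
    rcases Nat.lt_or_ge (n + 1) (i + j) with hlt | hle
    · exact top (n + 1) _ hC' v hv _ hpq hpq0 i j (by omega)
    · have h1 := hqv i j hle
      have h2 : squareSeminormSq (n + 1) (fun x => v x - p x) ≤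
          (n + 2) * (4 * squareSeminormSq (n + 1 + 1) v) := by
        unfold squareSeminormSq
        refine (Finset.sum_le_card_nsmul _ _ _ fun ij hij' =>
          hpv ij.1 ij.2 (Finset.HasAntidiagonal.mem_antidiagonal.1 hij')).trans (le_of_eq ?_)
        rw [Finset.Nat.card_antidiagonal, nsmul_eq_mul]
        push_cast
        unfold squareSeminormSq
        ring
      have e : (fun x => v x - (p x + q x)) = fun x => v x - p x - q x := by
        funext x; ring
      rw [e]
      calc _ ≤ C * squareSeminormSq (n + 1) (fun x => v x - p x) := h1
        _ ≤ C * ((n + 2) * (4 * squareSeminormSq (n + 1 + 1) v)) := by gcongr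
        _ = _ := by ring

/-! ### One-variable polynomials in `L²(0, 1)` -/

theorem memLp_polynomial (P : Polynomial ℝ) : MemLp (fun t => P.eval t) 2 unitMeasure :=
  memLp_unit P.continuous.continuousOn

theorem polynomial_eq_zero_of_sqInt {P : Polynomial ℝ}
    (h : sqInt unitMeasure (fun t => P.eval t) = 0) : P = 0 := by
  have h1 := (sqInt_eq_zero_iff (memLp_polynomial P)).1 h
  have h2 : EqOn (fun t => P.eval t) 0 (Ioo 0 1) :=
    Measure.eqOn_open_of_ae_eq h1 isOpen_Ioo P.continuous.continuousOn continuousOn_const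
  exact P.eq_zero_of_infinite_isRoot ((Ioo_infinite zero_lt_one).mono fun t ht => h2 ht)

theorem iterate_deriv_polynomial (P : Polynomial ℝ) (l : ℕ) :
    deriv^[l] (fun t => P.eval t) = fun t => (Polynomial.derivative^[l] P).eval t := by
  induction l with
  | zero => rfl
  | succ l ih =>
    rw [Function.iterate_succ_apply', ih, Function.iterate_succ_apply']
    funext t
    exact Polynomial.deriv _

instance degreeLT_finiteDimensional (n : ℕ) : FiniteDimensional ℝ (Polynomial.degreeLT ℝ n) :=
  (Polynomial.degreeLTEquiv ℝ n).symm.finiteDimensional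

theorem mem_degreeLT_succ {m : ℕ} {P : Polynomial ℝ} :
    P ∈ Polynomial.degreeLT ℝ (m + 1) ↔ P.natDegree ≤ m := by
  rw [Polynomial.mem_degreeLT]
  by_cases h : P = 0
  · simp [h]
  · rw [Polynomial.degree_eq_natDegree h, Nat.cast_lt, Nat.lt_succ_iff]

/-- The inverse estimate for polynomials of one variable. -/
theorem exists_sqInt_derivative_le (m l : ℕ) : ∃ C : ℝ, 0 ≤ C ∧ ∀ P : Polynomial ℝ,
    P.natDegree ≤ m → sqInt unitMeasure (fun t => (Polynomial.derivative^[l] P).eval t) ≤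
      C * sqInt unitMeasure (fun t => P.eval t) := by
  let A : Polynomial ℝ →ₗ[ℝ] (ℝ → ℝ) :=
    { toFun := fun P t => P.eval t
      map_add' := fun P R => by funext t; simp
      map_smul' := fun c P => by funext t; simp }
  obtain ⟨C, hC, h⟩ := exists_sqInt_le (μ := unitMeasure) (ν := unitMeasure)
    (A.comp (Polynomial.degreeLT ℝ (m + 1)).subtype)
    ((A.comp (Polynomial.derivative ^ l)).comp (Polynomial.degreeLT ℝ (m + 1)).subtype)
    (fun e => memLp_polynomial _) (fun e => memLp_polynomial _)
    (fun e he => Subtype.ext (polynomial_eq_zero_of_sqInt he))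
  refine ⟨C, hC, fun P hP => ?_⟩
  have := h ⟨P, mem_degreeLT_succ.2 hP⟩
  simpa [A, Module.End.pow_apply] using this

/-- The `L²(0, 1)`-orthogonal projection onto the polynomials of degree at most `m`. -/
theorem exists_polynomial_projection (m : ℕ) {f : ℝ → ℝ} (hf : MemLp f 2 unitMeasure) :
    ∃ P : Polynomial ℝ, P.natDegree ≤ m ∧
      (∀ R : Polynomial ℝ, R.natDegree ≤ m → ∫ t, (P.eval t - f t) * R.eval t ∂unitMeasure = 0) ∧
      sqInt unitMeasure (fun t => P.eval t) ≤ sqInt unitMeasure f := by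
  let A : Polynomial.degreeLT ℝ (m + 1) →ₗ[ℝ] (ℝ → ℝ) :=
    { toFun := fun P t => P.1.eval t
      map_add' := fun P R => by funext t; simp
      map_smul' := fun c P => by funext t; simp }
  obtain ⟨⟨P, hP⟩, h⟩ := exists_l2_projection A (fun e => memLp_polynomial _) hf
  rw [mem_degreeLT_succ] at hP
  have hort : ∀ R : Polynomial ℝ, R.natDegree ≤ m →
      ∫ t, (P.eval t - f t) * R.eval t ∂unitMeasure = 0 :=
    fun R hR => h ⟨R, mem_degreeLT_succ.2 hR⟩
  refine ⟨P, hP, hort, ?_⟩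
  have hPm := memLp_polynomial P
  have h1 : Integrable (fun t => (P.eval t - f t) * P.eval t) unitMeasure :=
    (hPm.sub hf).integrable_mul hPm
  have e : sqInt unitMeasure f = sqInt unitMeasure (fun t => P.eval t - f t) +
      sqInt unitMeasure (fun t => P.eval t) := by
    have e1 : ∀ t, f t ^ 2 = (P.eval t - f t) ^ 2 + P.eval t ^ 2 +
        (-2) * ((P.eval t - f t) * P.eval t) := fun t => by ring
    have h2 : Integrable (fun t => (P.eval t - f t) ^ 2) unitMeasure := (hPm.sub hf).integrable_sq
    have h3 : Integrable (fun t => (P.eval t - f t) ^ 2 + P.eval t ^ 2) unitMeasure :=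
      h2.add hPm.integrable_sq
    simp only [sqInt, e1]
    rw [integral_add h3 (h1.const_mul _), integral_add h2 hPm.integrable_sq, integral_const_mul,
      hort P hP]
    ring
  rw [e]
  linarith [sqInt_nonneg (μ := unitMeasure) (f := fun t => P.eval t - f t)]

/-! ### The interface problem on the reference square -/

/-- The multi-indices `(i, l)` of order at most `k` with `i < k`. -/
def lowerOrder (k : ℕ) : Finset (ℕ × ℕ) :=
  (Finset.range k ×ˢ Finset.range (k + 1)).filter fun x => x.1 + x.2 ≤ k

theorem mem_lowerOrder {k : ℕ} {x : ℕ × ℕ} : x ∈ lowerOrder k ↔ x.1 < k ∧ x.1 + x.2 ≤ k := by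
  simp only [lowerOrder, Finset.mem_filter, Finset.mem_product, Finset.mem_range]
  omega

/-- A family of linear operators `D_k`, `k ≤ m`, sending a smooth function on the unit square to
functions on its side `s = 0`, whose principal part is the normal derivative `∂_s^k`: the other
terms are bounded by `M` times the derivatives of order at most `k` with fewer than `k` derivatives
in the normal direction. -/
structure IsNormalData (m : ℕ) (M : ℝ) (D : ℕ → (ℝ × ℝ → ℝ) → ℝ → ℝ) : Prop where
  add : ∀ k ≤ m, ∀ v w : ℝ × ℝ → ℝ, ContDiff ℝ ∞ v → ContDiff ℝ ∞ w → ∀ t ∈ Icc (0 : ℝ) 1,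
    D k (fun p => v p + w p) t = D k v t + D k w t
  cont : ∀ k ≤ m, ∀ v : ℝ × ℝ → ℝ, ContDiff ℝ ∞ v → ContinuousOn (D k v) (Icc 0 1)
  bound : ∀ k ≤ m, ∀ v : ℝ × ℝ → ℝ, ContDiff ℝ ∞ v → ∀ t ∈ Icc (0 : ℝ) 1,
    |D k v t - mixedDeriv k 0 v (0, t)| ≤ M * ∑ x ∈ lowerOrder k, |mixedDeriv x.1 x.2 v (0, t)|

theorem IsNormalData.sub {m : ℕ} {M : ℝ} {D : ℕ → (ℝ × ℝ → ℝ) → ℝ → ℝ} (hD : IsNormalData m M D)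
    {k : ℕ} (hk : k ≤ m) {v w : ℝ × ℝ → ℝ} (hv : ContDiff ℝ ∞ v) (hw : ContDiff ℝ ∞ w) {t : ℝ}
    (ht : t ∈ Icc (0 : ℝ) 1) : D k (fun p => v p - w p) t = D k v t - D k w t := by
  have := hD.add k hk (fun p => v p - w p) w (hv.sub hw) hw t ht
  simp only [sub_add_cancel] at this
  linarith

theorem memLp_slice {v : ℝ × ℝ → ℝ} (hv : ContDiff ℝ ∞ v) (i l : ℕ) :
    MemLp (fun t => mixedDeriv i l v (0, t)) 2 unitMeasure :=
  memLp_unit ((smooth_mixedDeriv hv i l).continuous.comp (by fun_prop)).continuousOn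

theorem ae_unit {P : ℝ → Prop} (h : ∀ t ∈ Icc (0 : ℝ) 1, P t) : ∀ᵐ t ∂unitMeasure, P t :=
  (ae_restrict_iff' measurableSet_Ioo).2 (ae_of_all _ fun t ht => h t (Ioo_subset_Icc_self ht))

/-- The lower-order part of the normal data is controlled in `L²`. -/
theorem IsNormalData.sqInt_lower_le {m : ℕ} {M : ℝ}
    {D : ℕ → (ℝ × ℝ → ℝ) → ℝ → ℝ} (hD : IsNormalData m M D) {k : ℕ} (hk : k ≤ m)
    {v : ℝ × ℝ → ℝ} (hv : ContDiff ℝ ∞ v) :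
    sqInt unitMeasure (fun t => D k v t - mixedDeriv k 0 v (0, t)) ≤
      M ^ 2 * ((lowerOrder k).card *
        ∑ x ∈ lowerOrder k, sqInt unitMeasure (fun t => mixedDeriv x.1 x.2 v (0, t))) := by
  have habs : ∀ x : ℕ × ℕ, MemLp (fun t => |mixedDeriv x.1 x.2 v (0, t)|) 2 unitMeasure :=
    fun x => (memLp_slice hv x.1 x.2).abs
  have hsum : MemLp (fun t => M * ∑ x ∈ lowerOrder k, |mixedDeriv x.1 x.2 v (0, t)|) 2
      unitMeasure := (memLp_finsetSum _ fun x _ => habs x).const_mul M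
  refine (sqInt_mono hsum (ae_unit fun t ht => (hD.bound k hk v hv t ht).trans
    (le_abs_self _))).trans ?_
  rw [sqInt_const_mul]
  refine mul_le_mul_of_nonneg_left ((sqInt_sum_le _ fun x _ => habs x).trans (le_of_eq ?_))
    (sq_nonneg _)
  simp [sqInt]

theorem IsNormalData.sqInt_le {m : ℕ} {M : ℝ} {D : ℕ → (ℝ × ℝ → ℝ) → ℝ → ℝ}
    (hD : IsNormalData m M D) {k : ℕ} (hk : k ≤ m) {v : ℝ × ℝ → ℝ} (hv : ContDiff ℝ ∞ v) {B : ℝ}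
    (hB : ∀ i j, i + j ≤ m + 1 → sqInt squareMeasure (mixedDeriv i j v) ≤ B) :
    sqInt unitMeasure (D k v) ≤ 8 * (1 + M ^ 2 * (lowerOrder k).card ^ 2) * B := by
  have htr : ∀ i l, i + l ≤ m → sqInt unitMeasure (fun t => mixedDeriv i l v (0, t)) ≤ 4 * B := by
    intro i l hil
    have h := sqInt_trace_le_of_smooth (smooth_mixedDeriv hv i l)
    rw [dEta_mixedDeriv] at h
    have h1 := hB i l (by omega)
    have h2 := hB (i + 1) l (by omega)
    linarith
  have h1 : sqInt unitMeasure (fun t => D k v t - mixedDeriv k 0 v (0, t)) ≤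
      M ^ 2 * ((lowerOrder k).card * ((lowerOrder k).card * (4 * B))) := by
    refine (hD.sqInt_lower_le hk hv).trans ?_
    gcongr
    rw [← nsmul_eq_mul]
    refine Finset.sum_le_card_nsmul _ _ _ fun x hx => htr x.1 x.2 ?_
    have := (mem_lowerOrder.1 hx).2
    omega
  have hDm : MemLp (D k v) 2 unitMeasure := memLp_unit (hD.cont k hk v hv)
  have h2 := sqInt_add_le (f := fun t => D k v t - mixedDeriv k 0 v (0, t))
    (g := fun t => mixedDeriv k 0 v (0, t)) (hDm.sub (memLp_slice hv k 0)) (memLp_slice hv k 0)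
  simp only [sub_add_cancel] at h2
  have h3 := htr k 0 (by omega)
  calc _ ≤ _ := h2
    _ ≤ 2 * (M ^ 2 * ((lowerOrder k).card * ((lowerOrder k).card * (4 * B)))) + 2 * (4 * B) := by
      linarith
    _ = _ := by ring

/-- The polynomial `∑_{i < n} s^i / i! · c_i(t)`. -/
noncomputable def normalExpansion (n : ℕ) (c : ℕ → Polynomial ℝ) (p : ℝ × ℝ) : ℝ :=
  ∑ i ∈ Finset.range n, p.1 ^ i / i.factorial * (c i).eval p.2

theorem normalTerm_mem {m i : ℕ} (hi : i ≤ m) {P : Polynomial ℝ} (hP : P.natDegree ≤ m) :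
    (fun p : ℝ × ℝ => p.1 ^ i / i.factorial * P.eval p.2) ∈ tensorPoly m := by
  have h := eval_mul_eval_mem_tensorPoly (m := m)
    (P := Polynomial.C (i.factorial : ℝ)⁻¹ * Polynomial.X ^ i) (R := P)
    ((Polynomial.natDegree_C_mul_X_pow_le _ _).trans hi) hP
  convert h using 2 with p
  simp [div_eq_inv_mul]

theorem normalExpansion_mem {m n : ℕ} (hn : n ≤ m + 1) {c : ℕ → Polynomial ℝ}
    (hc : ∀ i, (c i).natDegree ≤ m) : normalExpansion n c ∈ tensorPoly m := by
  have : normalExpansion n c = ∑ i ∈ Finset.range n,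
      fun p : ℝ × ℝ => p.1 ^ i / i.factorial * (c i).eval p.2 := by
    funext p; simp [normalExpansion]
  rw [this]
  refine Submodule.sum_mem _ fun i hi => normalTerm_mem ?_ (hc i)
  have := Finset.mem_range.1 hi
  omega

theorem mixedDeriv_normalTerm (i : ℕ) (P : Polynomial ℝ) (k l : ℕ) (t : ℝ) :
    mixedDeriv k l (fun p : ℝ × ℝ => p.1 ^ i / i.factorial * P.eval p.2) (0, t) =
      if k = i then (Polynomial.derivative^[l] P).eval t else 0 := by
  rw [mixedDeriv_tensor (fun s => s ^ i / i.factorial) (fun t => P.eval t),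
    iterate_deriv_pow_div_factorial, iterate_deriv_polynomial]
  rcases lt_trichotomy k i with h | h | h
  · simp [h.le, h.ne, Nat.sub_ne_zero_of_lt h]
  · simp [h]
  · simp [h.ne', not_le.2 h]

theorem mixedDeriv_normalExpansion {m n : ℕ} (hn : n ≤ m + 1) {c : ℕ → Polynomial ℝ}
    (hc : ∀ i, (c i).natDegree ≤ m) (k l : ℕ) (t : ℝ) :
    mixedDeriv k l (normalExpansion n c) (0, t) =
      if k < n then (Polynomial.derivative^[l] (c k)).eval t else 0 := by
  unfold normalExpansion
  rw [mixedDeriv_sum]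
  · simp only [mixedDeriv_normalTerm]
    rw [Finset.sum_ite_eq]
    simp
  · intro i hi
    have := Finset.mem_range.1 hi
    exact tensorPoly_smooth (normalTerm_mem (m := m) (by omega) (hc i))

/-- The triangular structure of the normal data: polynomials with prescribed projections of their
normal data can be found successively in powers of the normal variable, with control of the
coefficients. -/
theorem exists_normalExpansion (m : ℕ) (M : ℝ) (n : ℕ) (hn : n ≤ m + 1) :
    ∃ C : ℝ, 0 ≤ C ∧ ∀ D, IsNormalData m M D → ∀ d : ℕ → ℝ → ℝ,
      (∀ k ≤ m, MemLp (d k) 2 unitMeasure) →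
      ∃ c : ℕ → Polynomial ℝ, (∀ i, (c i).natDegree ≤ m) ∧
        (∀ k < n, ∀ R : Polynomial ℝ, R.natDegree ≤ m →
          ∫ t, (D k (normalExpansion n c) t - d k t) * R.eval t ∂unitMeasure = 0) ∧
        ∑ i ∈ Finset.range n, sqInt unitMeasure (fun t => (c i).eval t) ≤
          C * ∑ i ∈ Finset.range n, sqInt unitMeasure (d i) := by
  induction n with
  | zero => exact ⟨0, le_rfl, fun D _ d _ => ⟨fun _ => 0, by simp, by simp, by simp⟩⟩
  | succ n ih =>
    obtain ⟨C, hC, ih⟩ := ih (by omega)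
    choose Cd hCd0 hCd using exists_sqInt_derivative_le m
    set Cs := ∑ l ∈ Finset.range (n + 1), Cd l with hCs
    have hCs0 : 0 ≤ Cs := Finset.sum_nonneg fun l _ => hCd0 l
    set N := ((lowerOrder n).card : ℝ)
    have hK0 : 0 ≤ 2 * (M ^ 2 * (N * (N * (Cs * C)))) := by positivity
    refine ⟨C + 2 + 2 * (M ^ 2 * (N * (N * (Cs * C)))), by linarith, fun D hD d hd => ?_⟩
    obtain ⟨c, hcm, hceq, hcle⟩ := ih D hD d hd
    set w := normalExpansion n c with hw
    have hwm : w ∈ tensorPoly m := normalExpansion_mem (by omega) hcm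
    have hws := tensorPoly_smooth hwm
    have hnm : n ≤ m := by omega
    have hDw : MemLp (D n w) 2 unitMeasure := memLp_unit (hD.cont n hnm w hws)
    set S := ∑ i ∈ Finset.range n, sqInt unitMeasure (d i) with hS
    have hS0 : 0 ≤ S := Finset.sum_nonneg fun _ _ => sqInt_nonneg
    -- `∂_η^n w` vanishes at `η = 0`, so `D n w` consists of terms of lower normal order.
    have hDwle : sqInt unitMeasure (D n w) ≤ M ^ 2 * (N * (N * (Cs * (C * S)))) := by
      have h := hD.sqInt_lower_le hnm hws
      have h0 : ∀ t, mixedDeriv n 0 w (0, t) = 0 := fun t => by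
        rw [hw, mixedDeriv_normalExpansion (by omega) hcm]; simp
      simp only [h0, sub_zero] at h
      refine h.trans ?_
      change M ^ 2 * (N * _) ≤ _
      gcongr
      rw [← nsmul_eq_mul]
      refine Finset.sum_le_card_nsmul _ _ _ fun x hx => ?_
      obtain ⟨hx1, hx2⟩ := mem_lowerOrder.1 hx
      have e : ∀ t, mixedDeriv x.1 x.2 w (0, t) = (Polynomial.derivative^[x.2] (c x.1)).eval t :=
        fun t => by rw [hw, mixedDeriv_normalExpansion (by omega) hcm, if_pos hx1]
      simp only [e]
      refine (hCd x.2 (c x.1) (hcm _)).trans ?_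
      have hl : Cd x.2 ≤ Cs := Finset.single_le_sum (fun l _ => hCd0 l)
        (Finset.mem_range.2 (by omega))
      have hi : sqInt unitMeasure (fun t => (c x.1).eval t) ≤ C * S :=
        (Finset.single_le_sum (f := fun i => sqInt unitMeasure (fun t => (c i).eval t))
          (fun _ _ => sqInt_nonneg) (Finset.mem_range.2 hx1)).trans hcle
      exact mul_le_mul hl hi sqInt_nonneg hCs0
    obtain ⟨P, hPm, hPort, hPle⟩ := exists_polynomial_projection m ((hd n hnm).sub hDw)
    let c' := Function.update c n P
    have hc'm : ∀ i, (c' i).natDegree ≤ m := by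
      intro i
      by_cases h : i = n
      · subst h; simpa [c'] using hPm
      · simpa [c', Function.update_of_ne h] using hcm i
    let y : ℝ × ℝ → ℝ := fun p => p.1 ^ n / n.factorial * P.eval p.2
    have hys : ContDiff ℝ ∞ y := tensorPoly_smooth (normalTerm_mem hnm hPm)
    have hsplit : normalExpansion (n + 1) c' = fun p => w p + y p := by
      funext p
      rw [hw, normalExpansion, normalExpansion, Finset.sum_range_succ]
      congr 1
      · refine Finset.sum_congr rfl fun i hi => ?_
        have := (Finset.mem_range.1 hi).ne
        simp [c', Function.update_of_ne this]
      · simp [c', y]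
    -- The new term changes the `n`-th datum by exactly `P` and none of the earlier ones.
    have hDy : ∀ k ≤ n, ∀ t ∈ Icc (0 : ℝ) 1, D k y t = if k = n then P.eval t else 0 := by
      intro k hk t ht
      have h := hD.bound k (hk.trans hnm) y hys t ht
      have hz : ∑ x ∈ lowerOrder k, |mixedDeriv x.1 x.2 y (0, t)| = 0 := by
        refine Finset.sum_eq_zero fun x hx => ?_
        have := (mem_lowerOrder.1 hx).1
        rw [mixedDeriv_normalTerm, if_neg (by omega), abs_zero]
      rw [hz, mul_zero, mixedDeriv_normalTerm] at h
      have := abs_eq_zero.1 (le_antisymm h (abs_nonneg _))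
      simpa using sub_eq_zero.1 this
    refine ⟨c', hc'm, fun k hk R hR => ?_, ?_⟩
    · rw [hsplit]
      rcases Nat.lt_succ_iff_lt_or_eq.1 hk with hlt | heq
      · rw [← hceq k hlt R hR]
        refine integral_congr_ae (ae_unit fun t ht => ?_)
        simp only
        rw [hD.add k (by omega) w y hws hys t ht, hDy k hlt.le t ht, if_neg hlt.ne, add_zero]
      · subst heq
        rw [← hPort R hR]
        refine integral_congr_ae (ae_unit fun t ht => ?_)
        simp only
        rw [hD.add k hnm w y hws hys t ht, hDy k le_rfl t ht, if_pos rfl]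
        simp only [Pi.sub_apply]
        ring
    · rw [Finset.sum_range_succ, Finset.sum_range_succ, ← hS]
      have e1 : ∑ i ∈ Finset.range n, sqInt unitMeasure (fun t => (c' i).eval t) =
          ∑ i ∈ Finset.range n, sqInt unitMeasure (fun t => (c i).eval t) := by
        refine Finset.sum_congr rfl fun i hi => ?_
        have := (Finset.mem_range.1 hi).ne
        simp [c', Function.update_of_ne this]
      have e2 : c' n = P := by simp [c']
      have h3 := sqInt_sub_le (hd n hnm) hDw
      have h4 : sqInt unitMeasure (fun t => P.eval t) ≤
          sqInt unitMeasure (fun t => d n t - D n w t) := hPle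
      rw [e1, e2]
      have hdn : 0 ≤ sqInt unitMeasure (d n) := sqInt_nonneg
      calc _ ≤ C * S + (2 * sqInt unitMeasure (d n) +
            2 * (M ^ 2 * (N * (N * (Cs * (C * S)))))) := by linarith
        _ = (C + 2 * (M ^ 2 * (N * (N * (Cs * C))))) * S + 2 * sqInt unitMeasure (d n) := by ring
        _ ≤ (C + 2 + 2 * (M ^ 2 * (N * (N * (Cs * C))))) * S +
            (C + 2 + 2 * (M ^ 2 * (N * (N * (Cs * C))))) * sqInt unitMeasure (d n) := by
          gcongr <;> linarith
        _ = _ := by ring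

theorem sqInt_normalExpansion_le (n : ℕ) (c : ℕ → Polynomial ℝ) :
    sqInt squareMeasure (normalExpansion n c) ≤
      n * ∑ i ∈ Finset.range n, sqInt unitMeasure (fun t => (c i).eval t) := by
  have hm : ∀ i, MemLp (fun p : ℝ × ℝ => p.1 ^ i / i.factorial * (c i).eval p.2) 2
      squareMeasure := fun i => memLp_square (by fun_prop)
  refine (sqInt_sum_le _ fun i _ => hm i).trans ?_
  rw [Finset.card_range]
  gcongr with i
  have h2 : MemLp (fun p : ℝ × ℝ => (c i).eval p.2) 2 squareMeasure :=
    memLp_square (by fun_prop)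
  refine (sqInt_mono h2 ((ae_restrict_iff' (measurableSet_Ioo.prod measurableSet_Ioo)).2
    (ae_of_all _ fun p hp => ?_))).trans (le_of_eq ?_)
  · rw [abs_mul]
    refine mul_le_of_le_one_left (abs_nonneg _) ?_
    rw [abs_of_nonneg (div_nonneg (pow_nonneg hp.1.1.le _) (Nat.cast_nonneg _))]
    refine div_le_one_of_le₀ ((pow_le_one₀ hp.1.1.le hp.1.2.le).trans ?_) (Nat.cast_nonneg _)
    exact_mod_cast Nat.one_le_iff_ne_zero.2 i.factorial_ne_zero
  · rw [sqInt_square h2]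
    simp

/-- Approximation by pairs of polynomials satisfying weak interface conditions: the error is
controlled by the seminorms of order `m + 1` and by the defects in the interface conditions, with
a constant that does not depend on the factors `r_k ∈ [-1, 1]`. -/
theorem exists_interface_approx (m : ℕ) (M : ℝ) :
    ∃ C : ℝ, 0 ≤ C ∧ ∀ D₁ D₂, IsNormalData m M D₁ → IsNormalData m M D₂ →
      ∀ r : ℕ → ℝ, (∀ k, |r k| ≤ 1) →
      ∀ v₁ v₂ : ℝ × ℝ → ℝ, ContDiff ℝ ∞ v₁ → ContDiff ℝ ∞ v₂ →
      ∃ φ₁ ∈ tensorPoly m, ∃ φ₂ ∈ tensorPoly m,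
        (∀ k ≤ m, ∀ R : Polynomial ℝ, R.natDegree ≤ m →
          ∫ t, (D₁ k φ₁ t - r k * D₂ k φ₂ t) * R.eval t ∂unitMeasure = 0) ∧
        sqInt squareMeasure (fun p => φ₁ p - v₁ p) + sqInt squareMeasure (fun p => φ₂ p - v₂ p) ≤
          C * (squareSeminormSq (m + 1) v₁ + squareSeminormSq (m + 1) v₂ +
            ∑ k ∈ Finset.range (m + 1),
              sqInt unitMeasure (fun t => D₁ k v₁ t - r k * D₂ k v₂ t)) := by
  obtain ⟨C₁, hC₁, hBH⟩ := exists_polynomial_approx m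
  obtain ⟨C₂, hC₂, hNE⟩ := exists_normalExpansion m M (m + 1) le_rfl
  set T := ∑ k ∈ Finset.range (m + 1), 8 * (1 + M ^ 2 * ((lowerOrder k).card : ℝ) ^ 2) * C₁
  have hT : 0 ≤ T := Finset.sum_nonneg fun k _ => by positivity
  set N : ℝ := ((m + 1 : ℕ) : ℝ)
  have hN : 0 ≤ N := Nat.cast_nonneg _
  refine ⟨3 * C₁ + 2 * (N * (C₂ * (4 + 4 * T))), by positivity, ?_⟩
  intro D₁ D₂ hD₁ hD₂ r hr v₁ v₂ hv₁ hv₂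
  obtain ⟨q₁, hq₁, h₁⟩ := hBH v₁ hv₁
  obtain ⟨q₂, hq₂, h₂⟩ := hBH v₂ hv₂
  have hs₁ := tensorPoly_smooth hq₁
  have hs₂ := tensorPoly_smooth hq₂
  set B₁ := squareSeminormSq (m + 1) v₁
  set B₂ := squareSeminormSq (m + 1) v₂
  have hB₁ : 0 ≤ B₁ := squareSeminormSq_nonneg _ _
  have hB₂ : 0 ≤ B₂ := squareSeminormSq_nonneg _ _
  set J := ∑ k ∈ Finset.range (m + 1), sqInt unitMeasure (fun t => D₁ k v₁ t - r k * D₂ k v₂ t)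
  have hJ : 0 ≤ J := Finset.sum_nonneg fun _ _ => sqInt_nonneg
  let d : ℕ → ℝ → ℝ := fun k t => D₁ k q₁ t - r k * D₂ k q₂ t
  have hm₁ : ∀ k ≤ m, ∀ v : ℝ × ℝ → ℝ, ContDiff ℝ ∞ v → MemLp (D₁ k v) 2 unitMeasure :=
    fun k hk v hv => memLp_unit (hD₁.cont k hk v hv)
  have hm₂ : ∀ k ≤ m, ∀ v : ℝ × ℝ → ℝ, ContDiff ℝ ∞ v → MemLp (D₂ k v) 2 unitMeasure :=
    fun k hk v hv => memLp_unit (hD₂.cont k hk v hv)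
  have hd : ∀ k ≤ m, MemLp (d k) 2 unitMeasure := fun k hk =>
    (hm₁ k hk q₁ hs₁).sub ((hm₂ k hk q₂ hs₂).const_mul _)
  obtain ⟨c, hcm, hceq, hcle⟩ := hNE D₁ hD₁ d hd
  -- `w` carries the defects of the pair `q₁, q₂`, so the pair `q₁ - w, q₂` satisfies the conditions.
  set w := normalExpansion (m + 1) c
  have hw : w ∈ tensorPoly m := normalExpansion_mem le_rfl hcm
  have hws := tensorPoly_smooth hw
  -- The defects of the polynomial approximations are controlled by those of the functions.
  have hdle : ∑ k ∈ Finset.range (m + 1), sqInt unitMeasure (d k) ≤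
      2 * J + 4 * T * (B₁ + B₂) := by
    have hk : ∀ k ∈ Finset.range (m + 1), sqInt unitMeasure (d k) ≤
        2 * sqInt unitMeasure (fun t => D₁ k v₁ t - r k * D₂ k v₂ t) +
          4 * (8 * (1 + M ^ 2 * ((lowerOrder k).card : ℝ) ^ 2) * C₁) * (B₁ + B₂) := by
      intro k hk
      have hkm : k ≤ m := Nat.lt_succ_iff.1 (Finset.mem_range.1 hk)
      have e : sqInt unitMeasure (d k) = sqInt unitMeasure (fun t =>
          (D₁ k v₁ t - r k * D₂ k v₂ t) - (D₁ k (fun p => v₁ p - q₁ p) t -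
            r k * D₂ k (fun p => v₂ p - q₂ p) t)) := by
        refine sqInt_congr (ae_unit fun t ht => ?_)
        beta_reduce
        rw [hD₁.sub hkm hv₁ hs₁ ht, hD₂.sub hkm hv₂ hs₂ ht]
        simp only [d]
        ring
      have a1 := hm₁ k hkm _ (hv₁.sub hs₁)
      have a2 := (hm₂ k hkm _ (hv₂.sub hs₂)).const_mul (r k)
      have i1 := sqInt_sub_le ((hm₁ k hkm _ hv₁).sub ((hm₂ k hkm _ hv₂).const_mul (r k)))
        (a1.sub a2)
      have i2 := sqInt_sub_le a1 a2
      rw [sqInt_const_mul] at i2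
      have i3 := hD₁.sqInt_le hkm (hv₁.sub hs₁) h₁
      have i4 := hD₂.sqInt_le hkm (hv₂.sub hs₂) h₂
      have i5 : r k ^ 2 * sqInt unitMeasure (D₂ k (fun p => v₂ p - q₂ p)) ≤
          sqInt unitMeasure (D₂ k (fun p => v₂ p - q₂ p)) :=
        mul_le_of_le_one_left sqInt_nonneg ((sq_le_one_iff_abs_le_one _).2 (hr k))
      change _ ≤ 2 * sqInt unitMeasure (fun t => D₁ k v₁ t - r k * D₂ k v₂ t) +
        2 * sqInt unitMeasure (fun t => D₁ k (fun p => v₁ p - q₁ p) t -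
          r k * D₂ k (fun p => v₂ p - q₂ p) t) at i1
      rw [e]
      refine i1.trans ?_
      have i6 : sqInt unitMeasure (fun t => D₁ k (fun p => v₁ p - q₁ p) t -
          r k * D₂ k (fun p => v₂ p - q₂ p) t) ≤
          2 * (8 * (1 + M ^ 2 * ((lowerOrder k).card : ℝ) ^ 2) * (C₁ * B₁)) +
          2 * (8 * (1 + M ^ 2 * ((lowerOrder k).card : ℝ) ^ 2) * (C₁ * B₂)) := by
        linarith
      linarith
    refine (Finset.sum_le_sum hk).trans (le_of_eq ?_)
    rw [Finset.sum_add_distrib, ← Finset.mul_sum, ← Finset.sum_mul, ← Finset.mul_sum]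
  have hwle : sqInt squareMeasure w ≤ N * (C₂ * (2 * J + 4 * T * (B₁ + B₂))) := by
    refine (sqInt_normalExpansion_le (m + 1) c).trans ?_
    gcongr
    exact hcle.trans (by gcongr)
  refine ⟨fun p => q₁ p - w p, Submodule.sub_mem _ hq₁ hw, q₂, hq₂, fun k hk R hR => ?_, ?_⟩
  · rw [← neg_eq_zero, ← integral_neg, ← hceq k (Nat.lt_succ_of_le hk) R hR]
    refine integral_congr_ae (ae_unit fun t ht => ?_)
    simp only
    rw [hD₁.sub hk hs₁ hws ht]
    simp only [d]
    ring
  · have j1 := h₁ 0 0 (by omega)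
    have j2 := h₂ 0 0 (by omega)
    change sqInt squareMeasure (fun p => v₁ p - q₁ p) ≤ _ at j1
    change sqInt squareMeasure (fun p => v₂ p - q₂ p) ≤ _ at j2
    have e1 : sqInt squareMeasure (fun p => q₁ p - w p - v₁ p) =
        sqInt squareMeasure (fun p => (v₁ p - q₁ p) + w p) := by
      simp only [sqInt]; congr 1; funext p; ring
    have e2 : sqInt squareMeasure (fun p => q₂ p - v₂ p) =
        sqInt squareMeasure (fun p => v₂ p - q₂ p) := by
      simp only [sqInt]; congr 1; funext p; ring
    have j3 := sqInt_add_le (memLp_square_of_smooth (hv₁.sub hs₁)) (memLp_square_of_smooth hws)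
    rw [e1, e2]
    calc _ ≤ 2 * (C₁ * B₁) + 2 * (N * (C₂ * (2 * J + 4 * T * (B₁ + B₂)))) + C₁ * B₂ := by
          linarith
      _ = (2 * C₁ + 2 * (N * (C₂ * (4 * T)))) * B₁ + (C₁ + 2 * (N * (C₂ * (4 * T)))) * B₂ +
          2 * (N * (C₂ * 2)) * J := by ring
      _ ≤ (3 * C₁ + 2 * (N * (C₂ * (4 + 4 * T)))) * B₁ +
          (3 * C₁ + 2 * (N * (C₂ * (4 + 4 * T)))) * B₂ +
          (3 * C₁ + 2 * (N * (C₂ * (4 + 4 * T)))) * J := by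
        have k1 : 0 ≤ N * C₂ := mul_nonneg hN hC₂
        have k2 : 0 ≤ N * C₂ * T := mul_nonneg k1 hT
        gcongr <;> nlinarith
      _ = _ := by ring

/-- The inverse estimate for tensor-product polynomials on the unit square. -/
theorem exists_sqInt_mixedDeriv_le (m i j : ℕ) : ∃ C : ℝ, 0 ≤ C ∧ ∀ q ∈ tensorPoly m,
    sqInt squareMeasure (mixedDeriv i j q) ≤ C * sqInt squareMeasure q := by
  let A : tensorPoly m →ₗ[ℝ] (ℝ × ℝ → ℝ) := (tensorPoly m).subtype
  let B : tensorPoly m →ₗ[ℝ] (ℝ × ℝ → ℝ) :=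
    { toFun := fun q => mixedDeriv i j q.1
      map_add' := fun q q' => mixedDeriv_add (tensorPoly_smooth q.2) (tensorPoly_smooth q'.2) i j
      map_smul' := fun c q => mixedDeriv_const_mul c i j }
  obtain ⟨C, hC, h⟩ := exists_sqInt_le (μ := squareMeasure) (ν := squareMeasure) A B
    (fun q => memLp_square_of_smooth (tensorPoly_smooth q.2))
    (fun q => memLp_square_of_smooth (smooth_mixedDeriv (tensorPoly_smooth q.2) i j))
    (fun q hq => Subtype.ext (tensorPoly_eq_zero q.2 (isOpen_Ioo.prod isOpen_Ioo)
      ⟨(1 / 2, 1 / 2), by norm_num⟩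
      ((sqInt_eq_zero_iff (memLp_square_of_smooth (tensorPoly_smooth q.2))).1 hq)))
  exact ⟨C, hC, fun q hq => h ⟨q, hq⟩⟩

/-! ### Weak derivatives -/

theorem locallyIntegrableOn_of_memLp {U : Set (ℝ × ℝ)} {f : ℝ × ℝ → ℝ}
    (hf : MemLp f 2 (volume.restrict U)) : LocallyIntegrableOn f U :=
  locallyIntegrableOn_of_locallyIntegrable_restrict (hf.locallyIntegrable (by norm_num))

theorem hasCompactSupport_dEta {φ : ℝ × ℝ → ℝ} (hφ : ContDiff ℝ ∞ φ) (hc : HasCompactSupport φ) :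
    HasCompactSupport (dEta φ) := by
  rw [dEta_eq_fderiv (smooth_differentiable hφ)]; exact hc.fderiv_apply ℝ _

theorem hasCompactSupport_dXi {φ : ℝ × ℝ → ℝ} (hφ : ContDiff ℝ ∞ φ) (hc : HasCompactSupport φ) :
    HasCompactSupport (dXi φ) := by
  rw [dXi_eq_fderiv (smooth_differentiable hφ)]; exact hc.fderiv_apply ℝ _

theorem tsupport_dEta_subset {φ : ℝ × ℝ → ℝ} (hφ : ContDiff ℝ ∞ φ) :
    tsupport (dEta φ) ⊆ tsupport φ := by
  rw [dEta_eq_fderiv (smooth_differentiable hφ)]; exact tsupport_fderiv_apply_subset ℝ _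

theorem tsupport_dXi_subset {φ : ℝ × ℝ → ℝ} (hφ : ContDiff ℝ ∞ φ) :
    tsupport (dXi φ) ⊆ tsupport φ := by
  rw [dXi_eq_fderiv (smooth_differentiable hφ)]; exact tsupport_fderiv_apply_subset ℝ _

theorem support_mixedDeriv {φ : ℝ × ℝ → ℝ} (hφ : ContDiff ℝ ∞ φ) (hc : HasCompactSupport φ)
    (i j : ℕ) : HasCompactSupport (mixedDeriv i j φ) ∧ tsupport (mixedDeriv i j φ) ⊆ tsupport φ := by
  induction i with
  | zero =>
    induction j with
    | zero => exact ⟨hc, subset_rfl⟩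
    | succ j ih =>
      rw [← dXi_mixedDeriv hφ]
      exact ⟨hasCompactSupport_dXi (smooth_mixedDeriv hφ _ _) ih.1,
        (tsupport_dXi_subset (smooth_mixedDeriv hφ _ _)).trans ih.2⟩
  | succ i ih =>
    rw [← dEta_mixedDeriv]
    exact ⟨hasCompactSupport_dEta (smooth_mixedDeriv hφ _ _) ih.1,
      (tsupport_dEta_subset (smooth_mixedDeriv hφ _ _)).trans ih.2⟩

theorem eq_zero_of_tsupport_subset {φ : ℝ × ℝ → ℝ} {U : Set (ℝ × ℝ)} (h : tsupport φ ⊆ U)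
    {p : ℝ × ℝ} (hp : p ∉ U) : φ p = 0 :=
  image_eq_zero_of_notMem_tsupport fun hp' => hp (h hp')

/-- Weak derivatives are unique almost everywhere. -/
theorem HasWeakDeriv.ae_eq {U : Set (ℝ × ℝ)} (hU : IsOpen U) {i j : ℕ} {f w w' : ℝ × ℝ → ℝ}
    (h : HasWeakDeriv U i j f w) (h' : HasWeakDeriv U i j f w') : w =ᵐ[volume.restrict U] w' := by
  have key : ∀ᵐ p, p ∈ U → w p - w' p = 0 := by
    refine hU.ae_eq_zero_of_integral_contDiff_smul_eq_zero (h.2.1.sub h'.2.1) fun φ hφ hc hs => ?_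
    have h1 := (h.2.2 φ hφ hc hs).symm.trans (h'.2.2 φ hφ hc hs)
    have h2 := mul_left_cancel₀ (pow_ne_zero _ (by norm_num : (-1 : ℝ) ≠ 0)) h1
    have hint : ∀ v : ℝ × ℝ → ℝ, LocallyIntegrableOn v U →
        Integrable (fun p => v p * φ p) (volume.restrict U) := by
      intro v hv
      have hK : IntegrableOn v (tsupport φ) := hv.integrableOn_compact_subset hs hc
      obtain ⟨C, hC⟩ := hφ.continuous.bounded_above_of_compact_support hc
      have h3 : IntegrableOn (fun p => v p * φ p) (tsupport φ) :=
        Integrable.mul_bdd (c := C) hK hφ.continuous.aestronglyMeasurable (ae_of_all _ hC)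
      exact (h3.integrable_of_forall_notMem_eq_zero fun p hp => by
        rw [image_eq_zero_of_notMem_tsupport hp, mul_zero]).integrableOn
    rw [← setIntegral_eq_integral_of_forall_compl_eq_zero (s := U)]
    · have e : ∀ p, φ p • (w p - w' p) = w p * φ p - w' p * φ p := fun p => by
        simp only [smul_eq_mul]; ring
      change ∫ p in U, φ p • (w p - w' p) = 0
      simp only [e]
      rw [integral_sub (hint w h.2.1) (hint w' h'.2.1), h2, sub_self]
    · intro p hp
      rw [eq_zero_of_tsupport_subset hs hp, zero_smul]
  refine (ae_restrict_iff' hU.measurableSet).2 (key.mono fun p hp hpU => sub_eq_zero.1 (hp hpU))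

theorem HasWeakDeriv.weakDeriv_ae_eq {U : Set (ℝ × ℝ)} (hU : IsOpen U) {i j : ℕ}
    {f w : ℝ × ℝ → ℝ} (h : HasWeakDeriv U i j f w) : weakDeriv U i j f =ᵐ[volume.restrict U] w := by
  have H : ∃ w, HasWeakDeriv U i j f w := ⟨w, h⟩
  rw [weakDeriv, dif_pos H]
  exact HasWeakDeriv.ae_eq hU H.choose_spec h

theorem MemSobolev.weakDeriv_spec {U : Set (ℝ × ℝ)} (hU : IsOpen U) {k : ℕ} {f : ℝ × ℝ → ℝ}
    (h : MemSobolev U k f) {i j : ℕ} (hij : i + j ≤ k) :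
    HasWeakDeriv U i j f (weakDeriv U i j f) ∧ MemLp (weakDeriv U i j f) 2 (volume.restrict U) := by
  obtain ⟨w, hw, hwm⟩ := h i j hij
  refine ⟨?_, hwm.ae_eq (hw.weakDeriv_ae_eq hU).symm⟩
  have H : ∃ w, HasWeakDeriv U i j f w := ⟨w, hw⟩
  rw [weakDeriv, dif_pos H]
  exact H.choose_spec

theorem hasWeakDeriv_zero {U : Set (ℝ × ℝ)} {f : ℝ × ℝ → ℝ} (hf : LocallyIntegrableOn f U) :
    HasWeakDeriv U 0 0 f f := ⟨hf, hf, fun φ _ _ _ => by simp⟩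

theorem MemSobolev.memLp {U : Set (ℝ × ℝ)} (hU : IsOpen U) {k : ℕ} {f : ℝ × ℝ → ℝ}
    (h : MemSobolev U k f) : MemLp f 2 (volume.restrict U) := by
  obtain ⟨w, hw, hwm⟩ := h 0 0 (Nat.zero_le k)
  exact hwm.ae_eq (hw.ae_eq hU (hasWeakDeriv_zero hw.1))

theorem memLp_of_continuous_compactSupport {U : Set (ℝ × ℝ)} {φ : ℝ × ℝ → ℝ} (hφ : Continuous φ)
    (hc : HasCompactSupport φ) : MemLp φ 2 (volume.restrict U) :=
  (hφ.memLp_of_hasCompactSupport hc).restrict U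

/-- Weak derivatives are closed under convergence in `L²`. -/
theorem HasWeakDeriv.of_tendsto {U : Set (ℝ × ℝ)} {i j : ℕ} {f w : ℝ × ℝ → ℝ}
    {F W : ℕ → ℝ × ℝ → ℝ} (h : ∀ n, HasWeakDeriv U i j (F n) (W n))
    (hF : ∀ n, MemLp (F n) 2 (volume.restrict U)) (hW : ∀ n, MemLp (W n) 2 (volume.restrict U))
    (hf : MemLp f 2 (volume.restrict U)) (hw : MemLp w 2 (volume.restrict U))
    (hFf : Tendsto (fun n => sqInt (volume.restrict U) (fun p => F n p - f p)) atTop (𝓝 0))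
    (hWw : Tendsto (fun n => sqInt (volume.restrict U) (fun p => W n p - w p)) atTop (𝓝 0)) :
    HasWeakDeriv U i j f w := by
  refine ⟨locallyIntegrableOn_of_memLp hf, locallyIntegrableOn_of_memLp hw, fun φ hφ hc hs => ?_⟩
  have h1 := tendsto_integral_mul_of_tendsto_sqInt hF hf (memLp_of_continuous_compactSupport
    (smooth_mixedDeriv hφ i j).continuous (support_mixedDeriv hφ hc i j).1) hFf
  have h2 := (tendsto_integral_mul_of_tendsto_sqInt hW hw
    (memLp_of_continuous_compactSupport hφ.continuous hc) hWw).const_mul ((-1 : ℝ) ^ (i + j))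
  exact tendsto_nhds_unique (h1.congr fun n => (h n).2.2 φ hφ hc hs) h2

theorem HasWeakDeriv.dEta_comp {U : Set (ℝ × ℝ)} {i j : ℕ} {f g w : ℝ × ℝ → ℝ}
    (h : HasWeakDeriv U i j f g) (h' : HasWeakDeriv U 1 0 g w) : HasWeakDeriv U (i + 1) j f w := by
  refine ⟨h.1, h'.2.1, fun φ hφ hc hs => ?_⟩
  have h1 := h.2.2 (dEta φ) (smooth_dEta hφ) (hasCompactSupport_dEta hφ hc)
    ((tsupport_dEta_subset hφ).trans hs)
  have h2 := h'.2.2 φ hφ hc hs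
  have e : dEta^[i] (dXi^[j] (dEta φ)) = dEta^[i + 1] (dXi^[j] φ) := mixedDeriv_dEta hφ i j
  change ∫ p in U, g p * dEta φ p = _ at h2
  rw [e] at h1
  rw [h1, h2]
  ring

theorem HasWeakDeriv.dXi_comp {U : Set (ℝ × ℝ)} {i j : ℕ} {f g w : ℝ × ℝ → ℝ}
    (h : HasWeakDeriv U i j f g) (h' : HasWeakDeriv U 0 1 g w) : HasWeakDeriv U i (j + 1) f w := by
  refine ⟨h.1, h'.2.1, fun φ hφ hc hs => ?_⟩
  have h1 := h.2.2 (dXi φ) (smooth_dXi hφ) (hasCompactSupport_dXi hφ hc)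
    ((tsupport_dXi_subset hφ).trans hs)
  have h2 := h'.2.2 φ hφ hc hs
  change ∫ p in U, g p * dXi φ p = _ at h2
  change ∫ p in U, f p * (dEta^[i] (dXi^[j + 1] φ)) p = _ at h1
  rw [h1, h2]
  ring

theorem HasWeakDeriv.const_mul {U : Set (ℝ × ℝ)} {i j : ℕ} {f w : ℝ × ℝ → ℝ}
    (h : HasWeakDeriv U i j f w) (c : ℝ) :
    HasWeakDeriv U i j (fun p => c * f p) (fun p => c * w p) := by
  refine ⟨h.1.smul c, h.2.1.smul c, fun φ hφ hc hs => ?_⟩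
  simp only [mul_assoc, integral_const_mul]
  rw [h.2.2 φ hφ hc hs]
  ring

/-- A function that is continuously differentiable in `η` on an open set has its classical
derivative as weak derivative, whatever its regularity in `ξ`: on each slice in the direction of `η`
the derivative of the product with a test function integrates to zero. -/
theorem hasWeakDeriv_of_hasDerivAt_fst {U : Set (ℝ × ℝ)} (hU : IsOpen U) {f f' : ℝ × ℝ → ℝ}
    (hf : ContinuousOn f U) (hf' : ContinuousOn f' U)
    (hd : ∀ p ∈ U, HasDerivAt (fun s => f (s, p.2)) (f' p) p.1) : HasWeakDeriv U 1 0 f f' := by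
  refine ⟨hf.locallyIntegrableOn hU.measurableSet, hf'.locallyIntegrableOn hU.measurableSet,
    fun φ hφ hc hs => ?_⟩
  have hsub : ∀ {g ψ : ℝ × ℝ → ℝ}, tsupport (fun p => g p * ψ p) ⊆ tsupport ψ :=
    fun {g ψ} => tsupport_mul_subset_right
  have hφ' := smooth_dEta hφ
  have hc' := hasCompactSupport_dEta hφ hc
  have hs' := (tsupport_dEta_subset hφ).trans hs
  have c1 : Continuous fun p => f p * dEta φ p :=
    (hf.mul hφ'.continuous.continuousOn).continuous_of_tsupport_subset hU (hsub.trans hs')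
  have c2 : Continuous fun p => f' p * φ p :=
    (hf'.mul hφ.continuous.continuousOn).continuous_of_tsupport_subset hU (hsub.trans hs)
  have c3 : Continuous fun p => f p * φ p :=
    (hf.mul hφ.continuous.continuousOn).continuous_of_tsupport_subset hU (hsub.trans hs)
  have i1 := c1.integrable_of_hasCompactSupport (μ := volume) hc'.mul_left
  have i2 := c2.integrable_of_hasCompactSupport (μ := volume) hc.mul_left
  have slice : ∀ p : ℝ × ℝ, HasDerivAt (fun s => f (s, p.2) * φ (s, p.2))
      (f' p * φ p + f p * dEta φ p) p.1 := by
    intro p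
    by_cases hp : p ∈ U
    · exact (hd p hp).mul (hasDerivAt_dEta hφ p.1 p.2)
    · rw [eq_zero_of_tsupport_subset hs hp, eq_zero_of_tsupport_subset hs' hp, mul_zero, mul_zero,
        add_zero]
      have hpt : p ∉ tsupport φ := fun h => hp (hs h)
      have h0 : φ =ᶠ[𝓝 (p.1, p.2)] 0 := notMem_tsupport_iff_eventuallyEq.1 hpt
      have h1 : ∀ᶠ s in 𝓝 p.1, φ (s, p.2) = 0 :=
        (Continuous.tendsto (by fun_prop : Continuous fun s : ℝ => (s, p.2)) p.1).eventually h0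
      exact (hasDerivAt_const p.1 (0 : ℝ)).congr_of_eventuallyEq
        (h1.mono fun s hs => by simp [hs])
  have scs : ∀ {g : ℝ × ℝ → ℝ}, Continuous g → HasCompactSupport g → ∀ y : ℝ,
      Integrable fun s => g (s, y) := by
    intro g hg hgc y
    refine (hg.comp (by fun_prop : Continuous fun s : ℝ => (s, y))).integrable_of_hasCompactSupport
      (HasCompactSupport.intro (hgc.isCompact.image continuous_fst) fun s hs => ?_)
    by_contra hne
    exact hs ⟨(s, y), subset_tsupport g hne, rfl⟩
  have hz : ∫ p, (f' p * φ p + f p * dEta φ p) = 0 := by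
    have i3 : Integrable (fun p => f' p * φ p + f p * dEta φ p)
        ((volume : Measure ℝ).prod volume) := i2.add i1
    rw [Measure.volume_eq_prod, integral_prod_symm _ i3]
    refine (integral_congr_ae (ae_of_all _ fun y => ?_)).trans (integral_zero ℝ ℝ)
    exact integral_eq_zero_of_hasDerivAt_of_integrable (fun s => slice (s, y))
      ((scs c2 hc.mul_left y).add (scs c1 hc'.mul_left y)) (scs c3 hc.mul_left y)
  rw [integral_add i2 i1] at hz
  change ∫ p in U, f p * dEta φ p = _
  rw [setIntegral_eq_integral_of_forall_compl_eq_zero fun p hp => by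
      rw [eq_zero_of_tsupport_subset hs' hp, mul_zero],
    setIntegral_eq_integral_of_forall_compl_eq_zero fun p hp => by
      rw [eq_zero_of_tsupport_subset hs hp, mul_zero], add_zero, pow_one]
  linarith

theorem hasWeakDeriv_dXi {U : Set (ℝ × ℝ)} (hU : IsOpen U) {f : ℝ × ℝ → ℝ}
    (hf : ContDiff ℝ ∞ f) : HasWeakDeriv U 0 1 f (dXi f) := by
  refine ⟨hf.continuous.continuousOn.locallyIntegrableOn hU.measurableSet,
    (smooth_dXi hf).continuous.continuousOn.locallyIntegrableOn hU.measurableSet,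
    fun φ hφ hc hs => ?_⟩
  have hc' := hasCompactSupport_dXi hφ hc
  have hs' := (tsupport_dXi_subset hφ).trans hs
  have e : dXi φ = fun p => fderiv ℝ φ p (0, 1) := dXi_eq_fderiv (smooth_differentiable hφ)
  have e' : dXi f = fun p => fderiv ℝ f p (0, 1) := dXi_eq_fderiv (smooth_differentiable hf)
  have h := integral_mul_fderiv_eq_neg_fderiv_mul_of_integrable (μ := volume) (f := f) (g := φ)
    (v := ((0 : ℝ), (1 : ℝ))) ?_ ?_ ?_ (fun p _ => smooth_differentiable hf p)
    (fun p _ => smooth_differentiable hφ p)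
  · change ∫ p in U, f p * dXi φ p = _
    rw [setIntegral_eq_integral_of_forall_compl_eq_zero fun p hp => by
        rw [eq_zero_of_tsupport_subset hs' hp, mul_zero],
      setIntegral_eq_integral_of_forall_compl_eq_zero fun p hp => by
        rw [eq_zero_of_tsupport_subset hs hp, mul_zero], e, e', h]
    simp
  · simp only [← congrFun e' _]
    exact ((smooth_dXi hf).continuous.mul hφ.continuous).integrable_of_hasCompactSupport hc.mul_left
  · simp only [← congrFun e _]
    exact (hf.continuous.mul (smooth_dXi hφ).continuous).integrable_of_hasCompactSupport
      hc'.mul_left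
  · exact (hf.continuous.mul hφ.continuous).integrable_of_hasCompactSupport hc.mul_left

/-- The classical derivatives of a smooth function are weak derivatives. -/
theorem hasWeakDeriv_of_smooth {U : Set (ℝ × ℝ)} (hU : IsOpen U) {f : ℝ × ℝ → ℝ}
    (hf : ContDiff ℝ ∞ f) (i j : ℕ) : HasWeakDeriv U i j f (mixedDeriv i j f) := by
  induction i with
  | zero =>
    induction j with
    | zero => exact hasWeakDeriv_zero (hf.continuous.continuousOn.locallyIntegrableOn
        hU.measurableSet)
    | succ j ih =>
      rw [← dXi_mixedDeriv hf]
      exact ih.dXi_comp (hasWeakDeriv_dXi hU (smooth_mixedDeriv hf 0 j))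
  | succ i ih =>
    rw [← dEta_mixedDeriv]
    exact ih.dEta_comp (hasWeakDeriv_of_hasDerivAt_fst hU
      (smooth_mixedDeriv hf i j).continuous.continuousOn
      (smooth_dEta (smooth_mixedDeriv hf i j)).continuous.continuousOn
      fun p _ => hasDerivAt_dEta (smooth_mixedDeriv hf i j) p.1 p.2)

theorem HasWeakDeriv.sub {U : Set (ℝ × ℝ)} {i j : ℕ} {f w f' w' : ℝ × ℝ → ℝ}
    (h : HasWeakDeriv U i j f w) (h' : HasWeakDeriv U i j f' w')
    (hf : MemLp f 2 (volume.restrict U)) (hf' : MemLp f' 2 (volume.restrict U))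
    (hw : MemLp w 2 (volume.restrict U)) (hw' : MemLp w' 2 (volume.restrict U)) :
    HasWeakDeriv U i j (fun p => f p - f' p) (fun p => w p - w' p) := by
  refine ⟨h.1.sub h'.1, h.2.1.sub h'.2.1, fun φ hφ hc hs => ?_⟩
  have m1 : MemLp (dEta^[i] (dXi^[j] φ)) 2 (volume.restrict U) := memLp_of_continuous_compactSupport
    (smooth_mixedDeriv hφ i j).continuous (support_mixedDeriv hφ hc i j).1
  have m2 : MemLp φ 2 (volume.restrict U) := memLp_of_continuous_compactSupport hφ.continuous hc
  have a1 := integral_sub (hf.integrable_mul m1) (hf'.integrable_mul m1)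
  have a2 := integral_sub (hw.integrable_mul m2) (hw'.integrable_mul m2)
  simp only [Pi.mul_apply, ← sub_mul] at a1 a2
  rw [a1, a2, h.2.2 φ hφ hc hs, h'.2.2 φ hφ hc hs]
  ring

/-! ### Density of smooth functions in Sobolev spaces of bounded convex sets -/

/-- The average of the values of `f` at the points `l p + (1 - l) z` with weight `ρ(z)`. If `ρ`
is supported in a convex set `U` and `p ∈ U`, then only values of `f` in `U` enter, so that no
extension of `f` beyond `U` is needed to approximate it by smooth functions up to the boundary. -/
noncomputable def dilationAverage (ρ : ℝ × ℝ → ℝ) (l : ℝ) (f : ℝ × ℝ → ℝ) (p : ℝ × ℝ) : ℝ :=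
  ∫ z, f (l • p + (1 - l) • z) * ρ z

/-- The convolution kernel that represents `dilationAverage`. -/
noncomputable def dilationKernel (ρ : ℝ × ℝ → ℝ) (l : ℝ) (y : ℝ × ℝ) : ℝ :=
  ((1 - l) ^ 2)⁻¹ * ρ (-((1 - l)⁻¹ • y))

theorem dilationAverage_eq_kernel {ρ : ℝ × ℝ → ℝ} {l : ℝ} (hl : l < 1) (f : ℝ × ℝ → ℝ)
    (p : ℝ × ℝ) : dilationAverage ρ l f p = ∫ x, f x * dilationKernel ρ l (l • p - x) := by
  have hμ : 0 < 1 - l := by linarith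
  have h1 := Measure.integral_comp_smul (volume : Measure (ℝ × ℝ))
    (fun y => f (l • p + y) * ρ ((1 - l)⁻¹ • y)) (1 - l)
  have h2 : ∀ z : ℝ × ℝ, (1 - l)⁻¹ • (1 - l) • z = z := fun z => by
    rw [smul_smul, inv_mul_cancel₀ hμ.ne', one_smul]
  simp only [h2] at h1
  have h3 := integral_add_left_eq_self (μ := (volume : Measure (ℝ × ℝ)))
    (fun x => f x * ρ ((1 - l)⁻¹ • (x - l • p))) (l • p)
  simp only [add_sub_cancel_left] at h3
  rw [dilationAverage, h1, h3, smul_eq_mul, ← integral_const_mul]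
  refine integral_congr_ae (ae_of_all _ fun x => ?_)
  have h4 : Module.finrank ℝ (ℝ × ℝ) = 2 := by simp
  simp only [dilationKernel, h4]
  rw [abs_of_pos (by positivity), ← smul_neg, neg_sub]
  ring

theorem smooth_dilationKernel {ρ : ℝ × ℝ → ℝ} (hρ : ContDiff ℝ ∞ ρ) (l : ℝ) :
    ContDiff ℝ ∞ (dilationKernel ρ l) :=
  contDiff_const.mul (hρ.comp (contDiff_id.const_smul _).neg)

theorem hasCompactSupport_dilationKernel {ρ : ℝ × ℝ → ℝ} (hρ : HasCompactSupport ρ) {l : ℝ}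
    (hl : l < 1) : HasCompactSupport (dilationKernel ρ l) := by
  have hμ : (1 - l)⁻¹ ≠ 0 := inv_ne_zero (by linarith)
  have h : HasCompactSupport (fun y : ℝ × ℝ => ρ (-((1 - l)⁻¹ • y))) :=
    hρ.comp_homeomorph ((Homeomorph.smulOfNeZero _ hμ).trans (Homeomorph.neg (ℝ × ℝ)))
  exact h.mul_left

theorem integrable_mul_kernel {f k : ℝ × ℝ → ℝ} (hf : MemLp f 2 volume) (hk : Continuous k)
    (hkc : HasCompactSupport k) (y : ℝ × ℝ) : Integrable (fun x => f x * k (y - x)) := by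
  have h1 : HasCompactSupport (fun x => k (y - x)) :=
    hkc.comp_homeomorph (Homeomorph.subLeft y)
  have h2 : MemLp (fun x => k (y - x)) 2 volume :=
    (hk.comp (by fun_prop)).memLp_of_hasCompactSupport h1
  exact hf.integrable_mul h2

theorem dilationAverage_sub {ρ : ℝ × ℝ → ℝ} (hρ : ContDiff ℝ ∞ ρ) (hρc : HasCompactSupport ρ)
    {l : ℝ} (hl : l < 1) {f g : ℝ × ℝ → ℝ} (hf : MemLp f 2 volume) (hg : MemLp g 2 volume)
    (p : ℝ × ℝ) : dilationAverage ρ l (fun x => f x - g x) p =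
      dilationAverage ρ l f p - dilationAverage ρ l g p := by
  simp only [dilationAverage_eq_kernel hl, sub_mul]
  have hk := (smooth_dilationKernel hρ l).continuous
  have hkc := hasCompactSupport_dilationKernel hρc hl
  exact integral_sub (integrable_mul_kernel hf hk hkc _) (integrable_mul_kernel hg hk hkc _)

open scoped Convolution in
theorem mixedDeriv_convolution {f k : ℝ × ℝ → ℝ} (hf : LocallyIntegrable f) (hk : ContDiff ℝ ∞ k)
    (hkc : HasCompactSupport k) :
    ContDiff ℝ ∞ (fun y => ∫ x, f x * k (y - x)) ∧ ∀ i j : ℕ,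
      mixedDeriv i j (fun y => ∫ x, f x * k (y - x)) = fun y => ∫ x, f x * mixedDeriv i j k (y - x) := by
  have smooth : ∀ k : ℝ × ℝ → ℝ, ContDiff ℝ ∞ k → HasCompactSupport k →
      ContDiff ℝ ∞ (fun y => ∫ x, f x * k (y - x)) := fun k hk hkc =>
    hkc.contDiff_convolution_right (ContinuousLinearMap.mul ℝ ℝ) hf hk
  have hder : ∀ (k : ℝ × ℝ → ℝ), ContDiff ℝ ∞ k → HasCompactSupport k → ∀ y v : ℝ × ℝ,
      fderiv ℝ (fun y => ∫ x, f x * k (y - x)) y v = ∫ x, f x * fderiv ℝ k (y - x) v := by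
    intro k hk hkc y v
    have h := hkc.hasFDerivAt_convolution_right (ContinuousLinearMap.mul ℝ ℝ) hf
      (hk.of_le (by simp)) y
    have h2 := convolution_precompR_apply (ContinuousLinearMap.mul ℝ ℝ) hf (hkc.fderiv ℝ)
      (hk.continuous_fderiv (by simp)) y v
    have h3 : HasFDerivAt (fun y => ∫ x, f x * k (y - x)) _ y := h
    rw [h3.fderiv, h2]
    rfl
  refine ⟨smooth k hk hkc, fun i j => ?_⟩
  induction i with
  | zero =>
    induction j with
    | zero => rfl
    | succ j ih =>
      have hkj := smooth_mixedDeriv hk 0 j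
      have hcj := (support_mixedDeriv hk hkc 0 j).1
      rw [← dXi_mixedDeriv (smooth k hk hkc), ih,
        dXi_eq_fderiv (smooth_differentiable (smooth _ hkj hcj))]
      funext y
      rw [hder _ hkj hcj, ← dXi_mixedDeriv hk, dXi_eq_fderiv (smooth_differentiable hkj)]
  | succ i ih =>
    have hkj := smooth_mixedDeriv hk i j
    have hcj := (support_mixedDeriv hk hkc i j).1
    rw [← dEta_mixedDeriv, ih, dEta_eq_fderiv (smooth_differentiable (smooth _ hkj hcj))]
    funext y
    rw [hder _ hkj hcj, ← dEta_mixedDeriv, dEta_eq_fderiv (smooth_differentiable hkj)]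

theorem smooth_dilationAverage {ρ : ℝ × ℝ → ℝ} (hρ : ContDiff ℝ ∞ ρ) (hρc : HasCompactSupport ρ)
    {l : ℝ} (hl : l < 1) {f : ℝ × ℝ → ℝ} (hf : MemLp f 2 volume) :
    ContDiff ℝ ∞ (dilationAverage ρ l f) := by
  have h := (mixedDeriv_convolution (hf.locallyIntegrable (by norm_num))
    (smooth_dilationKernel hρ l) (hasCompactSupport_dilationKernel hρc hl)).1
  have e : dilationAverage ρ l f =
      fun p => (fun y => ∫ x, f x * dilationKernel ρ l (y - x)) (l • p) :=
    funext fun p => dilationAverage_eq_kernel hl f p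
  rw [e]
  exact h.comp (contDiff_id.const_smul l)

/-- Inside a convex set that contains the support of the weight, the derivatives of the average
are averages of the weak derivatives. -/
theorem mixedDeriv_dilationAverage {U : Set (ℝ × ℝ)} (hUc : Convex ℝ U)
    {ρ : ℝ × ℝ → ℝ} (hρ : ContDiff ℝ ∞ ρ) (hρc : HasCompactSupport ρ) (hρU : tsupport ρ ⊆ U)
    {l : ℝ} (hl0 : 0 < l) (hl : l < 1) {f w : ℝ × ℝ → ℝ} {i j : ℕ} (hw : HasWeakDeriv U i j f w)
    {F W : ℝ × ℝ → ℝ} (hF : MemLp F 2 volume) (hFf : F =ᵐ[volume.restrict U] f)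
    (hWw : W =ᵐ[volume.restrict U] w) {p : ℝ × ℝ} (hp : p ∈ U) :
    mixedDeriv i j (dilationAverage ρ l F) p = l ^ (i + j) * dilationAverage ρ l W p := by
  set k := dilationKernel ρ l with hk
  have hks : ContDiff ℝ ∞ k := smooth_dilationKernel hρ l
  have hkc : HasCompactSupport k := hasCompactSupport_dilationKernel hρc hl
  have hμ : 0 < 1 - l := by linarith
  let φ : ℝ × ℝ → ℝ := fun x => k (l • p - x)
  have hφs : ContDiff ℝ ∞ φ := hks.comp (contDiff_const.sub contDiff_id)
  have hφc : HasCompactSupport φ := hkc.comp_homeomorph (Homeomorph.subLeft (l • p))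
  have hsub : tsupport φ ⊆ U := by
    have hK : IsCompact ((fun z => l • p + (1 - l) • z) '' tsupport ρ) :=
      hρc.isCompact.image (by fun_prop)
    have h1 : Function.support φ ⊆ (fun z => l • p + (1 - l) • z) '' tsupport ρ := by
      intro x hx
      have hx' : ρ (-((1 - l)⁻¹ • (l • p - x))) ≠ 0 := by
        intro h0
        apply hx
        simp only [φ, hk, dilationKernel]
        rw [h0, mul_zero]
      refine ⟨_, subset_tsupport ρ hx', ?_⟩
      simp only
      rw [← smul_neg, smul_smul, mul_inv_cancel₀ hμ.ne', one_smul]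
      abel
    refine (closure_minimal h1 hK.isClosed).trans ?_
    rintro _ ⟨z, hz, rfl⟩
    exact hUc hp (hρU hz) hl0.le hμ.le (by ring)
  have hzero : ∀ (i j : ℕ) (x : ℝ × ℝ), x ∉ U → mixedDeriv i j φ x = 0 := fun i j x hx =>
    eq_zero_of_tsupport_subset ((support_mixedDeriv hφs hφc i j).2.trans hsub) hx
  -- The derivatives of the test function `x ↦ k (l p - x)` and of the kernel differ by a sign.
  have hφd : ∀ x, mixedDeriv i j φ x = (-1) ^ (i + j) * mixedDeriv i j k (l • p - x) := by
    intro x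
    have h := congrFun (mixedDeriv_comp_affine k (l * p.1) (-1) (l * p.2) (-1) i j) x
    have e : ∀ x : ℝ × ℝ, (l * p.1 + -1 * x.1, l * p.2 + -1 * x.2) = l • p - x := fun x => by
      ext <;> simp <;> ring
    simp only [e] at h
    rw [pow_add]
    exact h
  have hloc := hF.locallyIntegrable (by norm_num)
  obtain ⟨-, hconv⟩ := mixedDeriv_convolution hloc hks hkc
  have e : dilationAverage ρ l F =
      fun p => (fun y => ∫ x, F x * k (y - x)) (0 + l * p.1, 0 + l * p.2) := by
    funext q
    rw [dilationAverage_eq_kernel hl, zero_add, zero_add]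
    rfl
  have e2 : (0 + l * p.1, 0 + l * p.2) = l • p := by
    rw [zero_add, zero_add]; rfl
  rw [e, mixedDeriv_comp_affine (fun y => ∫ x, F x * k (y - x)) 0 l 0 l i j]
  simp only
  rw [hconv, e2, ← pow_add, dilationAverage_eq_kernel hl]
  congr 1
  have h1 : ∫ x, F x * mixedDeriv i j φ x = (-1) ^ (i + j) * ∫ x, W x * φ x := by
    rw [← setIntegral_eq_integral_of_forall_compl_eq_zero (s := U) fun x hx => by
        rw [hzero i j x hx, mul_zero],
      ← setIntegral_eq_integral_of_forall_compl_eq_zero (s := U) (f := fun x => W x * φ x)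
        fun x hx => by rw [eq_zero_of_tsupport_subset hsub hx, mul_zero]]
    have h2 := hw.2.2 φ hφs hφc hsub
    have h3 : ∫ x in U, F x * mixedDeriv i j φ x = ∫ x in U, f x * mixedDeriv i j φ x :=
      integral_congr_ae (hFf.mono fun x hx => by simp only [hx])
    have h4 : ∫ x in U, W x * φ x = ∫ x in U, w x * φ x :=
      integral_congr_ae (hWw.mono fun x hx => by simp only [hx])
    rw [h3, h4]
    exact h2
  simp only [hφd, mul_left_comm _ ((-1 : ℝ) ^ (i + j)), integral_const_mul] at h1
  exact mul_left_cancel₀ (pow_ne_zero _ (by norm_num)) h1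

/-- The averages are bounded in `L²`, by Jensen's inequality. The square of the constant bounds the
Jacobian `l⁻²` of the substitution `p ↦ l p + (1 - l) z`. -/
theorem eLpNorm_dilationAverage_le {ρ : ℝ × ℝ → ℝ} (hρ : Continuous ρ) (hρ0 : ∀ z, 0 ≤ ρ z)
    (hρi : Integrable ρ) (hρ1 : ∫ z, ρ z = 1) {l : ℝ} (hl0 : 1 / 2 ≤ l) {f : ℝ × ℝ → ℝ}
    (hf : Measurable f) :
    eLpNorm (dilationAverage ρ l f) 2 volume ≤ 2 * eLpNorm f 2 volume := by
  have hlpos : 0 < l := by linarith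
  let d : ℝ × ℝ → ENNReal := fun z => ‖ρ z‖ₑ
  have hd : Measurable d := hρ.measurable.enorm
  let ν : Measure (ℝ × ℝ) := volume.withDensity d
  have hν : ν univ = 1 := by
    simp only [ν, withDensity_apply _ MeasurableSet.univ, Measure.restrict_univ, d]
    rw [← ofReal_integral_norm_eq_lintegral_enorm hρi]
    simp only [Real.norm_eq_abs, abs_of_nonneg (hρ0 _), hρ1, ENNReal.ofReal_one]
  have hν' : IsProbabilityMeasure ν := ⟨hν⟩
  have hmeas : Measurable fun x : (ℝ × ℝ) × (ℝ × ℝ) => ‖f (l • x.1 + (1 - l) • x.2)‖ₑ :=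
    (hf.comp (by fun_prop)).enorm
  have hpt : ∀ p, ‖dilationAverage ρ l f p‖ₑ ^ (2 : ℝ) ≤
      ∫⁻ z, ‖f (l • p + (1 - l) • z)‖ₑ ^ (2 : ℝ) ∂ν := by
    intro p
    have hmp : Measurable fun z : ℝ × ℝ => ‖f (l • p + (1 - l) • z)‖ₑ :=
      hmeas.comp measurable_prodMk_left
    have h1 : ‖dilationAverage ρ l f p‖ₑ ≤ ∫⁻ z, ‖f (l • p + (1 - l) • z)‖ₑ ∂ν := by
      refine (enorm_integral_le_lintegral_enorm _).trans (le_of_eq ?_)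
      rw [lintegral_withDensity_eq_lintegral_mul _ hd hmp]
      refine lintegral_congr fun z => ?_
      rw [enorm_mul, mul_comm]
      rfl
    have h2 := ENNReal.lintegral_mul_le_Lp_mul_Lq ν Real.HolderConjugate.two_two
      hmp.aemeasurable (aemeasurable_const (b := (1 : ENNReal)))
    simp only [Pi.mul_apply, mul_one, ENNReal.one_rpow, lintegral_const, hν] at h2
    calc _ ≤ ((∫⁻ z, ‖f (l • p + (1 - l) • z)‖ₑ ^ (2 : ℝ) ∂ν) ^ (1 / 2 : ℝ)) ^ (2 : ℝ) :=
          ENNReal.rpow_le_rpow (h1.trans h2) (by norm_num)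
      _ = _ := by rw [← ENNReal.rpow_mul]; norm_num
  have hshift : ∀ z : ℝ × ℝ, ∫⁻ p, ‖f (l • p + (1 - l) • z)‖ₑ ^ (2 : ℝ) ≤
      4 * ∫⁻ p, ‖f p‖ₑ ^ (2 : ℝ) := by
    intro z
    have hm : Measurable fun y : ℝ × ℝ => ‖f (y + (1 - l) • z)‖ₑ ^ (2 : ℝ) :=
      (hf.comp (by fun_prop)).enorm.pow_const _
    have h1 := lintegral_map (μ := (volume : Measure (ℝ × ℝ))) hm
      (measurable_const_smul l : Measurable fun y : ℝ × ℝ => l • y)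
    rw [← h1, Measure.map_addHaar_smul _ hlpos.ne', lintegral_smul_measure]
    have h2 := lintegral_add_right_eq_self (μ := (volume : Measure (ℝ × ℝ)))
      (fun y => ‖f y‖ₑ ^ (2 : ℝ)) ((1 - l) • z)
    rw [h2, smul_eq_mul]
    refine mul_le_mul_left ?_ _
    have h4 : Module.finrank ℝ (ℝ × ℝ) = 2 := by simp
    rw [h4, abs_of_pos (by positivity)]
    refine ENNReal.ofReal_le_of_le_toReal ?_
    simp only [ENNReal.toReal_ofNat]
    rw [inv_le_comm₀ (by positivity) (by norm_num)]
    nlinarith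
  have key : ∫⁻ p, ‖dilationAverage ρ l f p‖ₑ ^ (2 : ℝ) ≤ 4 * ∫⁻ p, ‖f p‖ₑ ^ (2 : ℝ) := by
    calc _ ≤ ∫⁻ p, ∫⁻ z, ‖f (l • p + (1 - l) • z)‖ₑ ^ (2 : ℝ) ∂ν := lintegral_mono hpt
      _ = ∫⁻ z, (∫⁻ p, ‖f (l • p + (1 - l) • z)‖ₑ ^ (2 : ℝ)) ∂ν :=
          lintegral_lintegral_swap (hmeas.pow_const _).aemeasurable
      _ ≤ ∫⁻ _, (4 * ∫⁻ p, ‖f p‖ₑ ^ (2 : ℝ)) ∂ν := lintegral_mono hshift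
      _ = _ := by rw [lintegral_const, hν, mul_one]
  rw [eLpNorm_eq_lintegral_rpow_enorm_toReal (by simp) (by simp),
    eLpNorm_eq_lintegral_rpow_enorm_toReal (by simp) (by simp)]
  simp only [ENNReal.toReal_ofNat]
  refine (ENNReal.rpow_le_rpow key (by norm_num)).trans (le_of_eq ?_)
  rw [ENNReal.mul_rpow_of_nonneg _ _ (by norm_num)]
  congr 1
  rw [show (4 : ENNReal) = 2 ^ (2 : ℝ) by norm_num, ← ENNReal.rpow_mul]
  norm_num

/-- The averages of a continuous function with compact support converge uniformly on bounded
sets. -/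
theorem exists_abs_dilationAverage_sub_le {U : Set (ℝ × ℝ)} (hUb : Bornology.IsBounded U)
    {ρ : ℝ × ℝ → ℝ} (hρ : Continuous ρ) (hρ0 : ∀ z, 0 ≤ ρ z) (hρc : HasCompactSupport ρ)
    (hρU : tsupport ρ ⊆ U) (hρ1 : ∫ z, ρ z = 1) {g : ℝ × ℝ → ℝ} (hg : Continuous g)
    (hgc : HasCompactSupport g) {ε : ℝ} (hε : 0 < ε) :
    ∃ δ > 0, ∀ l : ℝ, 1 - δ < l → l < 1 → ∀ p ∈ U, |dilationAverage ρ l g p - g p| ≤ ε := by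
  obtain ⟨δ, hδ, hgδ⟩ := Metric.uniformContinuous_iff.1
    (hgc.uniformContinuous_of_continuous hg) ε hε
  obtain ⟨R, hR0, hR⟩ := hUb.exists_pos_norm_le
  refine ⟨δ / (2 * R + 1), by positivity, fun l hl hl1 p hp => ?_⟩
  have hρi : Integrable ρ := hρ.integrable_of_hasCompactSupport hρc
  have hi1 : Integrable fun z => g (l • p + (1 - l) • z) * ρ z :=
    ((hg.comp (by fun_prop)).mul hρ).integrable_of_hasCompactSupport hρc.mul_left
  have e : dilationAverage ρ l g p - g p = ∫ z, (g (l • p + (1 - l) • z) - g p) * ρ z := by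
    simp only [sub_mul]
    rw [integral_sub hi1 (hρi.const_mul _), integral_const_mul, hρ1, mul_one]
    rfl
  rw [e]
  have hb : ∀ z, ‖(g (l • p + (1 - l) • z) - g p) * ρ z‖ ≤ ε * ρ z := by
    intro z
    by_cases hz : z ∈ tsupport ρ
    · rw [norm_mul, Real.norm_eq_abs (ρ z), abs_of_nonneg (hρ0 z)]
      refine mul_le_mul_of_nonneg_right ?_ (hρ0 z)
      rw [← dist_eq_norm]
      refine (hgδ ?_).le
      rw [dist_eq_norm, show l • p + (1 - l) • z - p = (1 - l) • (z - p) by module, norm_smul,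
        Real.norm_eq_abs, abs_of_pos (by linarith)]
      have h1 : ‖z - p‖ ≤ 2 * R := (norm_sub_le _ _).trans (by linarith [hR z (hρU hz), hR p hp])
      have h2 : (1 - l) * (2 * R + 1) < δ := by
        rw [← lt_div_iff₀ (by positivity)]; linarith
      nlinarith
    · rw [image_eq_zero_of_notMem_tsupport hz]; simp
  refine (norm_integral_le_of_norm_le (hρi.const_mul ε) (ae_of_all _ hb)).trans ?_
  rw [integral_const_mul, hρ1, mul_one]

/-- The dilation factors `1 - 1 / (n + 2)`. -/
noncomputable def dilationFactor (n : ℕ) : ℝ := 1 - 1 / ((n : ℝ) + 2)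

theorem dilationFactor_spec (n : ℕ) : 1 / 2 ≤ dilationFactor n ∧ dilationFactor n < 1 := by
  unfold dilationFactor
  have hn : (0 : ℝ) ≤ n := n.cast_nonneg
  constructor
  · have : 1 / ((n : ℝ) + 2) ≤ 1 / 2 := one_div_le_one_div_of_le (by norm_num) (by linarith)
    linarith
  · have : 0 < 1 / ((n : ℝ) + 2) := by positivity
    linarith

theorem tendsto_dilationFactor : Tendsto dilationFactor atTop (𝓝 1) := by
  have h : Tendsto (fun n : ℕ => 1 / (((n + 1 : ℕ) : ℝ) + 1)) atTop (𝓝 0) :=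
    tendsto_one_div_add_atTop_nhds_zero_nat.comp (tendsto_add_atTop_nat 1)
  have h2 := h.const_sub 1
  rw [sub_zero] at h2
  refine h2.congr fun n => ?_
  unfold dilationFactor
  push_cast
  ring

/-- The averages converge in `L²`: `f` is approximated by a continuous function with compact support,
whose averages converge uniformly. -/
theorem tendsto_eLpNorm_dilationAverage {U : Set (ℝ × ℝ)} (hUm : MeasurableSet U)
    (hUb : Bornology.IsBounded U)
    {ρ : ℝ × ℝ → ℝ} (hρ : ContDiff ℝ ∞ ρ) (hρ0 : ∀ z, 0 ≤ ρ z) (hρc : HasCompactSupport ρ)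
    (hρU : tsupport ρ ⊆ U) (hρ1 : ∫ z, ρ z = 1) {f : ℝ × ℝ → ℝ} (hf : Measurable f)
    (hf2 : MemLp f 2 volume) :
    Tendsto (fun n => eLpNorm (fun p => dilationAverage ρ (dilationFactor n) f p - f p) 2
      (volume.restrict U)) atTop (𝓝 0) := by
  rw [ENNReal.tendsto_nhds_zero]
  intro ε hε
  wlog hεt : ε ≠ ⊤ generalizing ε
  · rw [not_not.1 hεt]; exact Eventually.of_forall fun _ => le_top
  have hε4 : ε / 4 ≠ 0 := (ENNReal.div_pos hε.ne' (by norm_num)).ne'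
  obtain ⟨g, hgc, hfg, hg, hg2⟩ := hf2.exists_hasCompactSupport_eLpNorm_sub_le (by norm_num) hε4
  have hρi : Integrable ρ := hρ.continuous.integrable_of_hasCompactSupport hρc
  -- The uniform error on `U` that makes the middle term small.
  have hvol : volume U ≠ ⊤ := hUb.measure_lt_top.ne
  set V := (volume U) ^ (2⁻¹ : ℝ)
  have hV : V ≠ ⊤ := ENNReal.rpow_ne_top_of_nonneg (by norm_num) hvol
  obtain ⟨η, hη, hVη⟩ : ∃ η : ℝ, 0 < η ∧ V * ENNReal.ofReal η ≤ ε / 4 := by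
    refine ⟨(ε / 4).toReal / (V.toReal + 1), ?_, ?_⟩
    · exact div_pos (ENNReal.toReal_pos hε4 (ENNReal.div_ne_top hεt (by norm_num))) (by positivity)
    · rw [← ENNReal.ofReal_toReal hV, ← ENNReal.ofReal_mul ENNReal.toReal_nonneg]
      refine ENNReal.ofReal_le_of_le_toReal ?_
      rw [ENNReal.toReal_ofReal ENNReal.toReal_nonneg, mul_div_assoc', div_le_iff₀ (by positivity)]
      nlinarith [ENNReal.toReal_nonneg (a := ε / 4), ENNReal.toReal_nonneg (a := V)]
  obtain ⟨δ, hδ, hgδ⟩ := exists_abs_dilationAverage_sub_le hUb hρ.continuous hρ0 hρc hρU hρ1 hg hgc hη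
  have hev : ∀ᶠ n in atTop, 1 - δ < dilationFactor n :=
    tendsto_dilationFactor.eventually (lt_mem_nhds (by linarith))
  filter_upwards [hev] with n hn
  obtain ⟨hl0, hl1⟩ := dilationFactor_spec n
  set l := dilationFactor n
  have hsm : Continuous (dilationAverage ρ l (fun x => f x - g x)) :=
    (smooth_dilationAverage hρ hρc hl1 (hf2.sub hg2)).continuous
  have hsg : Continuous (dilationAverage ρ l g) := (smooth_dilationAverage hρ hρc hl1 hg2).continuous
  have e : (fun p => dilationAverage ρ l f p - f p) =
      (dilationAverage ρ l (fun x => f x - g x) + fun p => dilationAverage ρ l g p - g p) -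
        (f - g) := by
    funext p
    simp only [Pi.sub_apply, Pi.add_apply]
    rw [dilationAverage_sub hρ hρc hl1 hf2 hg2]
    ring
  rw [e]
  have t1 : eLpNorm (dilationAverage ρ l (fun x => f x - g x)) 2 (volume.restrict U) ≤
      2 * (ε / 4) :=
    (eLpNorm_mono_measure _ Measure.restrict_le_self).trans
      ((eLpNorm_dilationAverage_le hρ.continuous hρ0 hρi hρ1 hl0 (hf.sub hg.measurable)).trans
        (mul_le_mul_right hfg _))
  have t2 : eLpNorm (fun p => dilationAverage ρ l g p - g p) 2 (volume.restrict U) ≤ ε / 4 := by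
    refine (eLpNorm_le_of_ae_bound (C := η) ?_).trans ?_
    · exact (ae_restrict_iff' hUm).2 (ae_of_all _ fun p hp => hgδ l hn hl1 p hp)
    · rw [Measure.restrict_apply_univ, ENNReal.toReal_ofNat]
      exact hVη
  have t3 : eLpNorm (f - g) 2 (volume.restrict U) ≤ ε / 4 :=
    (eLpNorm_mono_measure _ Measure.restrict_le_self).trans hfg
  refine (eLpNorm_sub_le ((hsm.aestronglyMeasurable).add
    (hsg.sub hg).aestronglyMeasurable) (hf2.sub hg2).1.restrict (by norm_num)).trans ?_
  refine (add_le_add ((eLpNorm_add_le hsm.aestronglyMeasurable (hsg.sub hg).aestronglyMeasurable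
    (by norm_num)).trans (add_le_add t1 t2)) t3).trans (le_of_eq ?_)
  have h4 : (4 : ENNReal) * (ε / 4) = ε := ENNReal.mul_div_cancel (by norm_num) (by norm_num)
  calc _ = 4 * (ε / 4) := by ring
    _ = ε := h4

/-- Smooth functions are dense in the Sobolev spaces of a bounded convex open set. -/
theorem exists_smooth_approx {U : Set (ℝ × ℝ)} (hU : IsOpen U) (hUc : Convex ℝ U)
    (hUb : Bornology.IsBounded U) (hne : U.Nonempty) {k : ℕ} {f : ℝ × ℝ → ℝ}
    (hf : MemSobolev U k f) :
    ∃ v : ℕ → ℝ × ℝ → ℝ, (∀ n, ContDiff ℝ ∞ (v n)) ∧ ∀ i j, i + j ≤ k →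
      Tendsto (fun n => sqInt (volume.restrict U)
        (fun p => mixedDeriv i j (v n) p - weakDeriv U i j f p)) atTop (𝓝 0) := by
  obtain ⟨c, hc⟩ := hne
  obtain ⟨r, hr, hball⟩ := Metric.isOpen_iff.1 hU c hc
  let b : ContDiffBump c := ⟨r / 4, r / 2, by positivity, by linarith⟩
  let ρ : ℝ × ℝ → ℝ := b.normed volume
  have hρ : ContDiff ℝ ∞ ρ := b.contDiff_normed
  have hρ0 : ∀ z, 0 ≤ ρ z := fun z => b.nonneg_normed z
  have hρc : HasCompactSupport ρ := b.hasCompactSupport_normed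
  have hρ1 : ∫ z, ρ z = 1 := b.integral_normed
  have hρU : tsupport ρ ⊆ U := by
    rw [b.tsupport_normed_eq]
    exact (Metric.closedBall_subset_ball (by change r / 2 < r; linarith)).trans hball
  have hspec : ∀ {i j : ℕ}, i + j ≤ k → HasWeakDeriv U i j f (weakDeriv U i j f) ∧
      MemLp (weakDeriv U i j f) 2 (volume.restrict U) := fun h => hf.weakDeriv_spec hU h
  -- Globally defined measurable representatives of the weak derivatives.
  have hrep : ∀ w : ℝ × ℝ → ℝ, ∃ W : ℝ × ℝ → ℝ, MemLp w 2 (volume.restrict U) →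
      Measurable W ∧ MemLp W 2 volume ∧ W =ᵐ[volume.restrict U] w := by
    intro w
    by_cases h : MemLp w 2 (volume.restrict U)
    · refine ⟨U.indicator (h.1.mk w), fun _ =>
        ⟨h.1.stronglyMeasurable_mk.measurable.indicator hU.measurableSet, ?_, ?_⟩⟩
      · exact (memLp_indicator_iff_restrict hU.measurableSet).2 (h.ae_eq h.1.ae_eq_mk)
      · exact (indicator_ae_eq_restrict hU.measurableSet).trans h.1.ae_eq_mk.symm
    · exact ⟨0, fun h' => absurd h' h⟩
  choose rep hrep using hrep
  have hfm := hf.memLp hU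
  obtain ⟨-, hF2, hFf⟩ := hrep f hfm
  refine ⟨fun n => dilationAverage ρ (dilationFactor n) (rep f), fun n =>
    smooth_dilationAverage hρ hρc (dilationFactor_spec n).2 hF2, fun i j hij => ?_⟩
  obtain ⟨hwd, hwm⟩ := hspec hij
  set w := weakDeriv U i j f
  obtain ⟨hWm, hW2, hWw⟩ := hrep w hwm
  have hA : ∀ n, MemLp (dilationAverage ρ (dilationFactor n) (rep w)) 2 volume := by
    intro n
    refine ⟨(smooth_dilationAverage hρ hρc (dilationFactor_spec n).2
      hW2).continuous.aestronglyMeasurable, ?_⟩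
    refine (eLpNorm_dilationAverage_le hρ.continuous hρ0
      (hρ.continuous.integrable_of_hasCompactSupport hρc) hρ1 (dilationFactor_spec n).1 hWm).trans_lt
      (ENNReal.mul_lt_top (by norm_num) hW2.2)
  have hconv := tendsto_sqInt_of_tendsto_eLpNorm
    (fun n => ((hA n).sub hW2).restrict U)
    (tendsto_eLpNorm_dilationAverage hU.measurableSet hUb hρ hρ0 hρc hρU hρ1 hWm hW2)
  -- The factor `l ^ (i + j)` tends to one.
  have hfac : Tendsto (fun n => 2 * ((dilationFactor n ^ (i + j)) ^ 2 * sqInt (volume.restrict U)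
      (fun p => dilationAverage ρ (dilationFactor n) (rep w) p - rep w p)) +
      2 * ((dilationFactor n ^ (i + j) - 1) ^ 2 * sqInt (volume.restrict U) (rep w)))
      atTop (𝓝 0) := by
    have h1 : Tendsto (fun n => dilationFactor n ^ (i + j)) atTop (𝓝 1) := by
      simpa using tendsto_dilationFactor.pow (i + j)
    have h2 := (((h1.pow 2).mul hconv).const_mul 2).add
      (((((h1.sub_const 1).pow 2).mul_const (sqInt (volume.restrict U) (rep w)))).const_mul 2)
    simp only [one_pow, mul_zero, sub_self, zero_mul, add_zero, ne_eq, OfNat.ofNat_ne_zero,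
      not_false_eq_true, zero_pow] at h2
    exact h2
  refine squeeze_zero (fun n => sqInt_nonneg) (fun n => ?_) hfac
  set l := dilationFactor n
  have e : sqInt (volume.restrict U) (fun p => mixedDeriv i j (dilationAverage ρ l (rep f)) p - w p) =
      sqInt (volume.restrict U) (fun p => l ^ (i + j) * (dilationAverage ρ l (rep w) p - rep w p) +
        (l ^ (i + j) - 1) * rep w p) := by
    refine sqInt_congr ?_
    filter_upwards [hWw, ae_restrict_mem hU.measurableSet] with p hp hpU
    rw [mixedDeriv_dilationAverage hUc hρ hρc hρU (by linarith [(dilationFactor_spec n).1])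
      (dilationFactor_spec n).2 hwd hF2 hFf hWw hpU, ← hp]
    ring
  rw [e]
  refine (sqInt_add_le ((((hA n).sub hW2).restrict U).const_mul _)
    ((hW2.restrict U).const_mul _)).trans (le_of_eq ?_)
  rw [sqInt_const_mul (f := rep w)]
  congr 2
  exact sqInt_const_mul _

/-! ### Functions that are smooth in the normal variable -/

theorem dEta_iterate_eq (j : ℕ) (f : ℝ × ℝ → ℝ) (p : ℝ × ℝ) :
    dEta^[j] f p = iteratedDeriv j (fun t => f (t, p.2)) p.1 := by
  induction j generalizing p with
  | zero => simp
  | succ j ih =>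
    rw [Function.iterate_succ_apply', iteratedDeriv_succ]
    simp only [dEta]
    congr 1
    funext t
    exact ih (t, p.2)

theorem contDiffAt_iteratedDeriv {f : ℝ → ℝ} {x : ℝ} (hf : ContDiffAt ℝ ∞ f x) (j : ℕ) :
    ContDiffAt ℝ ∞ (iteratedDeriv j f) x := by
  induction j with
  | zero => simpa using hf
  | succ j ih =>
    rw [iteratedDeriv_succ]
    have h : ContDiffAt ℝ ∞ (fderiv ℝ (iteratedDeriv j f)) x := ih.fderiv_right (by simp)
    have e : deriv (iteratedDeriv j f) = fun y => fderiv ℝ (iteratedDeriv j f) y 1 := by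
      funext y; exact (fderiv_apply_one_eq_deriv).symm
    rw [e]
    exact h.clm_apply contDiffAt_const

/-- Functions on a set `D` of the plane that are smooth in the first variable and whose derivatives
in the first variable are all continuous on `D`; no regularity is asked in the second variable
beyond that. -/
structure EtaSmooth (D : Set (ℝ × ℝ)) (f : ℝ × ℝ → ℝ) : Prop where
  contDiffAt : ∀ p ∈ D, ContDiffAt ℝ ∞ (fun t => f (t, p.2)) p.1
  continuousOn : ∀ j, ContinuousOn (dEta^[j] f) D

section EtaSmooth

variable {D : Set (ℝ × ℝ)} {f g : ℝ × ℝ → ℝ}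

theorem dEta_iterate_add (hf : EtaSmooth D f) (hg : EtaSmooth D g) (j : ℕ) {p : ℝ × ℝ}
    (hp : p ∈ D) : dEta^[j] (fun p => f p + g p) p = dEta^[j] f p + dEta^[j] g p := by
  simp only [dEta_iterate_eq]
  exact iteratedDeriv_add ((hf.contDiffAt p hp).of_le (by exact_mod_cast le_top))
    ((hg.contDiffAt p hp).of_le (by exact_mod_cast le_top))

theorem dEta_iterate_mul (hf : EtaSmooth D f) (hg : EtaSmooth D g) (j : ℕ) {p : ℝ × ℝ}
    (hp : p ∈ D) : dEta^[j] (fun p => f p * g p) p =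
      ∑ i ∈ Finset.range (j + 1), (j.choose i : ℝ) * dEta^[i] f p * dEta^[j - i] g p := by
  simp only [dEta_iterate_eq]
  exact iteratedDeriv_fun_mul ((hf.contDiffAt p hp).of_le (by exact_mod_cast le_top))
    ((hg.contDiffAt p hp).of_le (by exact_mod_cast le_top))

theorem EtaSmooth.add (hf : EtaSmooth D f) (hg : EtaSmooth D g) :
    EtaSmooth D (fun p => f p + g p) where
  contDiffAt p hp := (hf.contDiffAt p hp).add (hg.contDiffAt p hp)
  continuousOn j := ((hf.continuousOn j).add (hg.continuousOn j)).congr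
    fun _ hp => dEta_iterate_add hf hg j hp

theorem EtaSmooth.mul (hf : EtaSmooth D f) (hg : EtaSmooth D g) :
    EtaSmooth D (fun p => f p * g p) where
  contDiffAt p hp := (hf.contDiffAt p hp).mul (hg.contDiffAt p hp)
  continuousOn j := ContinuousOn.congr
    (continuousOn_finsetSum _ fun i _ =>
      (continuousOn_const.mul (hf.continuousOn i)).mul (hg.continuousOn (j - i)))
    fun _ hp => dEta_iterate_mul hf hg j hp

theorem etaSmooth_of_smooth (hf : ContDiff ℝ ∞ f) : EtaSmooth D f where
  contDiffAt p _ := (hf.comp (by fun_prop : ContDiff ℝ ∞ fun t : ℝ => (t, p.2))).contDiffAt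
  continuousOn j := (smooth_dEta_iterate hf j).continuous.continuousOn

theorem etaSmooth_snd {c : ℝ → ℝ} (hc : ContinuousOn (fun p : ℝ × ℝ => c p.2) D) :
    EtaSmooth D (fun p => c p.2) where
  contDiffAt p _ := contDiffAt_const (c := c p.2)
  continuousOn j := by
    have e : dEta^[j] (fun p : ℝ × ℝ => c p.2) = fun p => if j = 0 then c p.2 else 0 := by
      funext p; rw [dEta_iterate_eq]; exact iteratedDeriv_const (c := c p.2) (x := p.1)
    rw [e]
    split_ifs
    · exact hc
    · exact continuousOn_const

theorem EtaSmooth.hasDerivAt (hf : EtaSmooth D f) (j : ℕ) {p : ℝ × ℝ} (hp : p ∈ D) :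
    HasDerivAt (fun t => dEta^[j] f (t, p.2)) (dEta^[j + 1] f p) p.1 := by
  have h := (contDiffAt_iteratedDeriv (hf.contDiffAt p hp) j).differentiableAt (by simp)
  have e : (fun t => dEta^[j] f (t, p.2)) = iteratedDeriv j (fun t => f (t, p.2)) := by
    funext t; exact dEta_iterate_eq j f (t, p.2)
  rw [dEta_iterate_eq, iteratedDeriv_succ, e]
  exact h.hasDerivAt

end EtaSmooth

/-! ### The coefficients of the transformed Laplacian -/

namespace InterfaceCurve

variable {m : ℕ} (Γ : InterfaceCurve (m + 2))

theorem uniqueDiffOn_I : UniqueDiffOn ℝ Γ.I := uniqueDiffOn_Icc Γ.lt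

theorem g1_contDiffOn : ContDiffOn ℝ (m + 1 : ℕ) Γ.g1 Γ.I :=
  Γ.contDiffOn.derivWithin Γ.uniqueDiffOn_I (by norm_cast)

theorem g2_contDiffOn : ContDiffOn ℝ m Γ.g2 Γ.I :=
  Γ.g1_contDiffOn.derivWithin Γ.uniqueDiffOn_I (by norm_cast)

theorem g1_ne_zero {ξ : ℝ} (hξ : ξ ∈ Γ.I) : Γ.g1 ξ ≠ 0 := Γ.regular ξ hξ

theorem curvature_contDiffOn : ContDiffOn ℝ m Γ.curvature Γ.I := by
  have h1 : ContDiffOn ℝ m Γ.g1 Γ.I := Γ.g1_contDiffOn.of_le (by norm_cast; omega)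
  have h2 := Γ.g2_contDiffOn
  have c1 := contDiffOn_euclidean.1 h1
  have c2 := contDiffOn_euclidean.1 h2
  exact (((c1 0).mul (c2 1)).sub ((c1 1).mul (c2 0))).div
    ((h1.norm ℝ fun ξ hξ => Γ.g1_ne_zero hξ).pow 3)
    fun ξ hξ => pow_ne_zero _ (norm_ne_zero_iff.2 (Γ.g1_ne_zero hξ))

theorem curvature_continuousOn : ContinuousOn Γ.curvature Γ.I := Γ.curvature_contDiffOn.continuousOn

theorem curvature1_continuousOn (hm : 1 ≤ m) : ContinuousOn Γ.curvature1 Γ.I :=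
  (Γ.curvature_contDiffOn.derivWithin (m := 0) Γ.uniqueDiffOn_I
    (by simpa using (by exact_mod_cast hm : (1 : WithTop ℕ∞) ≤ m))).continuousOn

/-- The part of the `η`-`ξ` plane, above the parameter interval, where `|η κ| < 1`. -/
def regularRegion : Set (ℝ × ℝ) := {p | p.2 ∈ Γ.I ∧ |p.1 * Γ.curvature p.2| < 1}

theorem zero_mem_regularRegion {ξ : ℝ} (hξ : ξ ∈ Γ.I) : ((0 : ℝ), ξ) ∈ Γ.regularRegion :=
  ⟨hξ, by simp⟩

theorem continuousOn_snd_regularRegion {c : ℝ → ℝ} (hc : ContinuousOn c Γ.I) :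
    ContinuousOn (fun p : ℝ × ℝ => c p.2) Γ.regularRegion :=
  hc.comp continuousOn_snd fun _ hp => hp.1

theorem etaSmooth_psi : EtaSmooth Γ.regularRegion Γ.psi := by
  have hne : ∀ p ∈ Γ.regularRegion, Γ.curvature p.2 * p.1 + 1 ≠ 0 := by
    intro p hp h
    have := hp.2
    rw [show p.1 * Γ.curvature p.2 = -1 by linarith] at this
    norm_num at this
  have e : Γ.psi = fun p => (Γ.curvature p.2 * p.1 + 1)⁻¹ := by
    funext p; simp only [psi]; congr 1; ring
  have hκ := Γ.continuousOn_snd_regularRegion Γ.curvature_continuousOn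
  constructor
  · intro p hp
    rw [e]
    exact ((contDiffAt_const.mul contDiffAt_id).add contDiffAt_const).inv (hne p hp)
  · intro j
    have e2 : dEta^[j] Γ.psi = fun p => (-1) ^ j * (j.factorial : ℝ) * Γ.curvature p.2 ^ j *
        (Γ.curvature p.2 * p.1 + 1) ^ (-1 - j : ℤ) := by
      funext p
      rw [dEta_iterate_eq, iteratedDeriv_eq_iterate, e]
      exact congrFun (iter_deriv_inv_linear j (Γ.curvature p.2) 1) p.1
    rw [e2]
    refine (continuousOn_const.mul (hκ.pow j)).mul ?_
    exact ((hκ.mul continuousOn_fst).add continuousOn_const).zpow₀ _ fun p hp => Or.inl (hne p hp)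

theorem inv_norm_g1_continuousOn : ContinuousOn (fun ξ => ‖Γ.g1 ξ‖⁻¹) Γ.I :=
  Γ.g1_contDiffOn.continuousOn.norm.inv₀ fun _ hξ => norm_ne_zero_iff.2 (Γ.g1_ne_zero hξ)

theorem etaSmooth_J0 : EtaSmooth Γ.regularRegion Γ.J0 := by
  have h1 := Γ.etaSmooth_psi.mul
    (etaSmooth_snd (Γ.continuousOn_snd_regularRegion Γ.inv_norm_g1_continuousOn))
  have e : Γ.J0 = fun p => (Γ.psi p * ‖Γ.g1 p.2‖⁻¹) * (Γ.psi p * ‖Γ.g1 p.2‖⁻¹) := by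
    funext p; simp only [J0, div_eq_mul_inv, sq]
  rw [e]
  exact h1.mul h1

theorem etaSmooth_J1 : EtaSmooth Γ.regularRegion Γ.J1 :=
  (etaSmooth_snd (Γ.continuousOn_snd_regularRegion Γ.curvature_continuousOn)).mul Γ.etaSmooth_psi

theorem etaSmooth_J2 (hm : 1 ≤ m) : EtaSmooth Γ.regularRegion Γ.J2 := by
  have hg1 := Γ.g1_contDiffOn.continuousOn
  have hc : ContinuousOn (fun ξ => inner ℝ (Γ.g1 ξ) (Γ.g2 ξ) / ‖Γ.g1 ξ‖ ^ 2) Γ.I :=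
    (hg1.inner (𝕜 := ℝ) Γ.g2_contDiffOn.continuousOn).div (hg1.norm.pow 2)
      fun ξ hξ => pow_ne_zero _ (norm_ne_zero_iff.2 (Γ.g1_ne_zero hξ))
  have h1 : EtaSmooth Γ.regularRegion fun p => p.1 * Γ.curvature1 p.2 * Γ.psi p :=
    ((etaSmooth_of_smooth contDiff_fst).mul (etaSmooth_snd
      (Γ.continuousOn_snd_regularRegion (Γ.curvature1_continuousOn hm)))).mul Γ.etaSmooth_psi
  have h2 := h1.add (etaSmooth_snd (Γ.continuousOn_snd_regularRegion hc))
  have h3 := (etaSmooth_of_smooth (D := Γ.regularRegion)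
    (contDiff_const (c := (-1 : ℝ)))).mul (Γ.etaSmooth_J0.mul h2)
  have e : Γ.J2 = fun p => -1 * (Γ.J0 p * (p.1 * Γ.curvature1 p.2 * Γ.psi p +
      inner ℝ (Γ.g1 p.2) (Γ.g2 p.2) / ‖Γ.g1 p.2‖ ^ 2)) := by
    funext p; simp only [J2, J0]; ring
  rw [e]
  exact h3

theorem etaSmooth_classicalLap (hm : 1 ≤ m) {v : ℝ × ℝ → ℝ} (hv : ContDiff ℝ ∞ v) :
    EtaSmooth Γ.regularRegion (Γ.classicalLap v) := by
  have h1 := smooth_dEta hv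
  have h2 := smooth_dXi hv
  exact (((etaSmooth_of_smooth (smooth_dEta h1)).add (Γ.etaSmooth_J0.mul
    (etaSmooth_of_smooth (smooth_dXi h2)))).add (Γ.etaSmooth_J1.mul (etaSmooth_of_smooth h1))).add
    ((Γ.etaSmooth_J2 hm).mul (etaSmooth_of_smooth h2))

/-- The expansion of `∂_η^j 𝓛 u` by the Leibniz rule; `W i l` stands for `∂_η^i ∂_ξ^l u`, which may
be a classical or a weak derivative. -/
noncomputable def lapDeriv (j : ℕ) (W : ℕ → ℕ → ℝ × ℝ → ℝ) (p : ℝ × ℝ) : ℝ :=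
  W (j + 2) 0 p + ∑ i ∈ Finset.range (j + 1), (j.choose i : ℝ) *
    (dEta^[i] Γ.J0 p * W (j - i) 2 p + dEta^[i] Γ.J1 p * W (j - i + 1) 0 p +
      dEta^[i] Γ.J2 p * W (j - i) 1 p)

theorem dEta_iterate_classicalLap (hm : 1 ≤ m) {v : ℝ × ℝ → ℝ} (hv : ContDiff ℝ ∞ v) (j : ℕ)
    {p : ℝ × ℝ} (hp : p ∈ Γ.regularRegion) :
    dEta^[j] (Γ.classicalLap v) p = Γ.lapDeriv j (fun i l => mixedDeriv i l v) p := by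
  have h1 := smooth_dEta hv
  have h2 := smooth_dXi hv
  have t0 : EtaSmooth Γ.regularRegion (dEta (dEta v)) := etaSmooth_of_smooth (smooth_dEta h1)
  have s0 : EtaSmooth Γ.regularRegion (dXi (dXi v)) := etaSmooth_of_smooth (smooth_dXi h2)
  have s1 : EtaSmooth Γ.regularRegion (dEta v) := etaSmooth_of_smooth h1
  have s2 : EtaSmooth Γ.regularRegion (dXi v) := etaSmooth_of_smooth h2
  have a0 := Γ.etaSmooth_J0.mul s0
  have a1 := Γ.etaSmooth_J1.mul s1
  have a2 := (Γ.etaSmooth_J2 hm).mul s2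
  have e : Γ.classicalLap v = fun p => dEta (dEta v) p + Γ.J0 p * dXi (dXi v) p +
      Γ.J1 p * dEta v p + Γ.J2 p * dXi v p := rfl
  rw [e, dEta_iterate_add ((t0.add a0).add a1) a2 j hp, dEta_iterate_add (t0.add a0) a1 j hp,
    dEta_iterate_add t0 a0 j hp, dEta_iterate_mul Γ.etaSmooth_J0 s0 j hp,
    dEta_iterate_mul Γ.etaSmooth_J1 s1 j hp, dEta_iterate_mul (Γ.etaSmooth_J2 hm) s2 j hp,
    lapDeriv, add_assoc, add_assoc, ← Finset.sum_add_distrib, ← Finset.sum_add_distrib]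
  congr 1
  refine Finset.sum_congr rfl fun i _ => ?_
  have e1 : dEta^[j - i] (dEta v) p = mixedDeriv (j - i + 1) 0 v p := rfl
  have e2 : dEta^[j - i] (dXi (dXi v)) p = mixedDeriv (j - i) 2 v p := rfl
  have e3 : dEta^[j - i] (dXi v) p = mixedDeriv (j - i) 1 v p := rfl
  rw [e1, e2, e3]
  ring

/-- The normal data of a function on the interface: `v`, `v_η`, and `∂_η^j 𝓛 v`, for `j ≥ 0`. -/
noncomputable def normalData : ℕ → (ℝ × ℝ → ℝ) → ℝ → ℝ
  | 0, v, ξ => v (0, ξ)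
  | 1, v, ξ => dEta v (0, ξ)
  | j + 2, v, ξ => dEta^[j] (Γ.classicalLap v) (0, ξ)

theorem normalData_add_two (hm : 1 ≤ m) {v : ℝ × ℝ → ℝ} (hv : ContDiff ℝ ∞ v) (j : ℕ) {ξ : ℝ}
    (hξ : ξ ∈ Γ.I) :
    Γ.normalData (j + 2) v ξ = Γ.lapDeriv j (fun i l => mixedDeriv i l v) (0, ξ) :=
  Γ.dEta_iterate_classicalLap hm hv j (Γ.zero_mem_regularRegion hξ)

theorem normalData_continuousOn (hm : 1 ≤ m) {v : ℝ × ℝ → ℝ} (hv : ContDiff ℝ ∞ v) (k : ℕ) :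
    ContinuousOn (Γ.normalData k v) Γ.I := by
  have hc : Continuous fun ξ : ℝ => ((0 : ℝ), ξ) := by fun_prop
  match k with
  | 0 => exact (hv.continuous.comp hc).continuousOn
  | 1 => exact ((smooth_dEta hv).continuous.comp hc).continuousOn
  | j + 2 =>
    exact ((Γ.etaSmooth_classicalLap hm hv).continuousOn j).comp hc.continuousOn
      fun ξ hξ => Γ.zero_mem_regularRegion hξ

theorem normalData_add (hm : 1 ≤ m) {v w : ℝ × ℝ → ℝ} (hv : ContDiff ℝ ∞ v)
    (hw : ContDiff ℝ ∞ w) (k : ℕ) {ξ : ℝ} (hξ : ξ ∈ Γ.I) :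
    Γ.normalData k (fun p => v p + w p) ξ = Γ.normalData k v ξ + Γ.normalData k w ξ := by
  match k with
  | 0 => rfl
  | 1 => simp only [normalData, dEta_add hv hw]
  | j + 2 =>
    rw [Γ.normalData_add_two hm (hv.add hw) j hξ, Γ.normalData_add_two hm hv j hξ,
      Γ.normalData_add_two hm hw j hξ]
    simp only [lapDeriv, mixedDeriv_add hv hw]
    rw [add_add_add_comm, ← Finset.sum_add_distrib]
    congr 1
    exact Finset.sum_congr rfl fun i _ => by ring

theorem normalData_const_mul (hm : 1 ≤ m) {v : ℝ × ℝ → ℝ} (hv : ContDiff ℝ ∞ v) (c : ℝ)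
    (k : ℕ) {ξ : ℝ} (hξ : ξ ∈ Γ.I) :
    Γ.normalData k (fun p => c * v p) ξ = c * Γ.normalData k v ξ := by
  match k with
  | 0 => rfl
  | 1 => simp only [normalData, dEta_const_mul]
  | j + 2 =>
    rw [Γ.normalData_add_two hm (contDiff_const.mul hv) j hξ, Γ.normalData_add_two hm hv j hξ]
    simp only [lapDeriv, mixedDeriv_const_mul]
    rw [mul_add, Finset.mul_sum]
    congr 1
    exact Finset.sum_congr rfl fun i _ => by ring

/-- The principal part of the `k`-th normal datum is `∂_η^k`; the remainder is of lower order in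
the normal direction. -/
theorem exists_normalData_bound (hm : 1 ≤ m) : ∃ M : ℝ, 0 ≤ M ∧ ∀ k ≤ m, ∀ v : ℝ × ℝ → ℝ,
    ContDiff ℝ ∞ v → ∀ ξ ∈ Γ.I, |Γ.normalData k v ξ - mixedDeriv k 0 v (0, ξ)| ≤
      M * ∑ x ∈ lowerOrder k, |mixedDeriv x.1 x.2 v (0, ξ)| := by
  have hc : ContinuousOn (fun ξ : ℝ => ((0 : ℝ), ξ)) Γ.I := by fun_prop
  have hb : ∀ f, EtaSmooth Γ.regularRegion f → ∃ B : ℝ, 0 ≤ B ∧ ∀ i ≤ m, ∀ ξ ∈ Γ.I,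
      |dEta^[i] f (0, ξ)| ≤ B := by
    intro f hf
    have h1 : ∀ i, ∃ B : ℝ, ∀ ξ ∈ Γ.I, |dEta^[i] f (0, ξ)| ≤ B := fun i =>
      isCompact_Icc.exists_bound_of_continuousOn ((hf.continuousOn i).comp hc
        fun ξ hξ => Γ.zero_mem_regularRegion hξ)
    choose B hB using h1
    refine ⟨∑ i ∈ Finset.range (m + 1), |B i|, Finset.sum_nonneg fun _ _ => abs_nonneg _,
      fun i hi ξ hξ => (hB i ξ hξ).trans ((le_abs_self _).trans ?_)⟩
    exact Finset.single_le_sum (f := fun i => |B i|) (fun _ _ => abs_nonneg _)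
      (Finset.mem_range.2 (Nat.lt_succ_of_le hi))
  obtain ⟨B0, hB0, h0⟩ := hb _ Γ.etaSmooth_J0
  obtain ⟨B1, hB1, h1⟩ := hb _ Γ.etaSmooth_J1
  obtain ⟨B2, hB2, h2⟩ := hb _ (Γ.etaSmooth_J2 hm)
  refine ⟨(m + 1) * (2 ^ m * (B0 + B1 + B2)), by positivity, fun k hk v hv ξ hξ => ?_⟩
  match k, hk with
  | 0, _ =>
    simp only [normalData, mixedDeriv, Function.iterate_zero, id, sub_self, abs_zero]
    positivity
  | 1, _ =>
    simp only [normalData, mixedDeriv, Function.iterate_zero, Function.iterate_one, id, sub_self,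
      abs_zero]
    positivity
  | j + 2, hk =>
    set S := ∑ x ∈ lowerOrder (j + 2), |mixedDeriv x.1 x.2 v (0, ξ)| with hS
    have hS0 : 0 ≤ S := Finset.sum_nonneg fun _ _ => abs_nonneg _
    rw [Γ.normalData_add_two hm hv j hξ, lapDeriv, add_sub_cancel_left]
    have hle : ∀ i l, i < j + 2 → i + l ≤ j + 2 → |mixedDeriv i l v (0, ξ)| ≤ S := fun i l a b =>
      Finset.single_le_sum (f := fun x : ℕ × ℕ => |mixedDeriv x.1 x.2 v (0, ξ)|)
        (fun _ _ => abs_nonneg _) (show (i, l) ∈ lowerOrder (j + 2) from mem_lowerOrder.2 ⟨a, b⟩)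
    have hterm : ∀ i ∈ Finset.range (j + 1), |(j.choose i : ℝ) *
        (dEta^[i] Γ.J0 (0, ξ) * mixedDeriv (j - i) 2 v (0, ξ) +
          dEta^[i] Γ.J1 (0, ξ) * mixedDeriv (j - i + 1) 0 v (0, ξ) +
          dEta^[i] Γ.J2 (0, ξ) * mixedDeriv (j - i) 1 v (0, ξ))| ≤
        2 ^ m * ((B0 + B1 + B2) * S) := by
      intro i hi
      have hij : i ≤ j := Nat.lt_succ_iff.1 (Finset.mem_range.1 hi)
      rw [abs_mul, Nat.abs_cast]
      have hch : (j.choose i : ℝ) ≤ 2 ^ m := by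
        have a1 : j.choose i ≤ 2 ^ j := Nat.choose_le_two_pow j i
        have a2 : 2 ^ j ≤ 2 ^ m := Nat.pow_le_pow_right (by norm_num) (by omega)
        exact_mod_cast a1.trans a2
      refine mul_le_mul hch ?_ (abs_nonneg _) (by positivity)
      refine (abs_add_three _ _ _).trans ?_
      simp only [abs_mul]
      have b0 := mul_le_mul (h0 i (by omega) ξ hξ) (hle (j - i) 2 (by omega) (by omega))
        (abs_nonneg _) hB0
      have b1 := mul_le_mul (h1 i (by omega) ξ hξ) (hle (j - i + 1) 0 (by omega) (by omega))
        (abs_nonneg _) hB1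
      have b2 := mul_le_mul (h2 i (by omega) ξ hξ) (hle (j - i) 1 (by omega) (by omega))
        (abs_nonneg _) hB2
      linarith
    refine (Finset.abs_sum_le_sum_abs _ _).trans ((Finset.sum_le_card_nsmul _ _ _ hterm).trans ?_)
    rw [Finset.card_range, nsmul_eq_mul]
    have hj : ((j + 1 : ℕ) : ℝ) ≤ m + 1 := by exact_mod_cast (by omega : j + 1 ≤ m + 1)
    calc ((j + 1 : ℕ) : ℝ) * (2 ^ m * ((B0 + B1 + B2) * S))
        ≤ (m + 1) * (2 ^ m * ((B0 + B1 + B2) * S)) :=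
          mul_le_mul_of_nonneg_right hj (by positivity)
      _ = _ := by ring

end InterfaceCurve

/-! ### Convergence in `L²` -/

/-- Convergence in `L²(μ)` of a sequence of square-integrable functions. -/
structure L2Tendsto {X : Type*} [MeasurableSpace X] (μ : Measure X) (F : ℕ → X → ℝ) (f : X → ℝ) :
    Prop where
  memLp_seq : ∀ n, MemLp (F n) 2 μ
  memLp : MemLp f 2 μ
  tendsto : Tendsto (fun n => sqInt μ (fun x => F n x - f x)) atTop (𝓝 0)

namespace L2Tendsto

variable {X : Type*} [MeasurableSpace X] {μ : Measure X} {F G : ℕ → X → ℝ} {f g : X → ℝ}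

theorem congr_ae (h : L2Tendsto μ F f) (hF : ∀ n, F n =ᵐ[μ] G n) (hf : f =ᵐ[μ] g) :
    L2Tendsto μ G g where
  memLp_seq n := (h.memLp_seq n).ae_eq (hF n)
  memLp := h.memLp.ae_eq hf
  tendsto := h.tendsto.congr fun n => sqInt_congr (by
    filter_upwards [hF n, hf] with x h1 h2
    rw [h1, h2])

theorem add (h : L2Tendsto μ F f) (h' : L2Tendsto μ G g) :
    L2Tendsto μ (fun n x => F n x + G n x) (fun x => f x + g x) where
  memLp_seq n := (h.memLp_seq n).add (h'.memLp_seq n)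
  memLp := h.memLp.add h'.memLp
  tendsto := by
    refine squeeze_zero (fun _ => sqInt_nonneg) (fun n => ?_)
      (by simpa using (h.tendsto.const_mul 2).add (h'.tendsto.const_mul 2))
    have := sqInt_add_le ((h.memLp_seq n).sub h.memLp) ((h'.memLp_seq n).sub h'.memLp)
    refine (le_of_eq ?_).trans this
    congr 1
    funext x
    simp only [Pi.sub_apply]
    ring

theorem const_mul (h : L2Tendsto μ F f) (c : ℝ) :
    L2Tendsto μ (fun n x => c * F n x) (fun x => c * f x) where
  memLp_seq n := (h.memLp_seq n).const_mul c
  memLp := h.memLp.const_mul c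
  tendsto := by
    simp only [← mul_sub, sqInt_const_mul]
    simpa using h.tendsto.const_mul (c ^ 2)

theorem sub (h : L2Tendsto μ F f) (h' : L2Tendsto μ G g) :
    L2Tendsto μ (fun n x => F n x - G n x) (fun x => f x - g x) := by
  have := h.add (h'.const_mul (-1))
  simpa only [neg_mul, one_mul, ← sub_eq_add_neg] using this

theorem zero : L2Tendsto μ (fun _ _ => (0 : ℝ)) (fun _ => 0) where
  memLp_seq _ := MemLp.zero'
  memLp := MemLp.zero'
  tendsto := by simp [sqInt]

theorem sum {ι : Type*} (s : Finset ι) {F : ι → ℕ → X → ℝ} {f : ι → X → ℝ}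
    (h : ∀ a ∈ s, L2Tendsto μ (F a) (f a)) :
    L2Tendsto μ (fun n x => ∑ a ∈ s, F a n x) (fun x => ∑ a ∈ s, f a x) := by
  classical
  induction s using Finset.induction_on with
  | empty => simpa using zero
  | insert a s ha ih =>
    simp only [Finset.sum_insert ha]
    exact (h a (by simp)).add (ih fun b hb => h b (by simp [hb]))

theorem bdd_mul (h : L2Tendsto μ F f) {c : X → ℝ} (hc : AEStronglyMeasurable c μ) {B : ℝ}
    (hB : ∀ᵐ x ∂μ, |c x| ≤ B) : L2Tendsto μ (fun n x => c x * F n x) (fun x => c x * f x) := by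
  have hm : ∀ {v : X → ℝ}, MemLp v 2 μ → MemLp (fun x => c x * v x) 2 μ := by
    intro v hv
    refine MemLp.of_le_mul hv (hc.mul hv.1) (c := B) (hB.mono fun x hx => ?_)
    rw [norm_mul]
    exact mul_le_mul_of_nonneg_right hx (norm_nonneg _)
  refine ⟨fun n => hm (h.memLp_seq n), hm h.memLp, ?_⟩
  refine squeeze_zero (fun _ => sqInt_nonneg) (fun n => ?_)
    (by simpa using h.tendsto.const_mul (B ^ 2))
  rw [← sqInt_const_mul]
  refine sqInt_mono (((h.memLp_seq n).sub h.memLp).const_mul B) (hB.mono fun x hx => ?_)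
  rw [← mul_sub, abs_mul, abs_mul]
  exact mul_le_mul_of_nonneg_right (hx.trans (le_abs_self B)) (abs_nonneg _)

/-- If the limit vanishes almost everywhere, the squared norms tend to zero. -/
theorem tendsto_sqInt (h : L2Tendsto μ F f) (hf : f =ᵐ[μ] 0) :
    Tendsto (fun n => sqInt μ (F n)) atTop (𝓝 0) := by
  refine h.tendsto.congr fun n => sqInt_congr ?_
  filter_upwards [hf] with x hx
  simp [hx]

end L2Tendsto

/-! ### Half rectangles and scaling to the unit square -/

/-- The open half `0 < σ η < h`, `a < ξ < b` of a Frenet rectangle, where `σ = 1` or `σ = -1`. -/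
def halfRect (σ h a b : ℝ) : Set (ℝ × ℝ) := {p | σ * p.1 ∈ Ioo 0 h ∧ p.2 ∈ Ioo a b}

/-- The closed half `0 ≤ σ η ≤ h`, `a ≤ ξ ≤ b` of a Frenet rectangle. -/
def closedHalfRect (σ h a b : ℝ) : Set (ℝ × ℝ) := {p | σ * p.1 ∈ Icc 0 h ∧ p.2 ∈ Icc a b}

theorem FrenetRect.plus_eq (F : FrenetRect) : F.plus = halfRect 1 F.h F.a F.b := by
  ext p; simp [FrenetRect.plus, halfRect]

theorem FrenetRect.minus_eq (F : FrenetRect) : F.minus = halfRect (-1) F.h F.a F.b := by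
  ext p
  simp only [FrenetRect.minus, halfRect, mem_prod, mem_Ioo, mem_ofPred_eq]
  constructor <;> rintro ⟨⟨h1, h2⟩, h3⟩ <;> exact ⟨⟨by linarith, by linarith⟩, h3⟩

section HalfRect

variable {σ h a b : ℝ}

theorem isOpen_halfRect : IsOpen (halfRect σ h a b) :=
  (isOpen_Ioo.preimage (by fun_prop : Continuous fun p : ℝ × ℝ => σ * p.1)).inter
    (isOpen_Ioo.preimage continuous_snd)

theorem convex_halfRect : Convex ℝ (halfRect σ h a b) :=
  ((convex_Ioo 0 h).linear_preimage (σ • LinearMap.fst ℝ ℝ ℝ)).inter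
    ((convex_Ioo a b).linear_preimage (LinearMap.snd ℝ ℝ ℝ))

theorem halfRect_subset : halfRect σ h a b ⊆ closedHalfRect σ h a b :=
  fun _ hp => ⟨Ioo_subset_Icc_self hp.1, Ioo_subset_Icc_self hp.2⟩

theorem abs_fst_le (hσ : σ ^ 2 = 1) {p : ℝ × ℝ} (hp : p ∈ closedHalfRect σ h a b) :
    |p.1| ≤ h := by
  obtain ⟨⟨h1, h2⟩, -⟩ := hp
  have hz : (σ - 1) * (σ + 1) = 0 := by linear_combination hσ
  rcases mul_eq_zero.1 hz with hz | hz
  · obtain rfl : σ = 1 := by linarith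
    exact abs_le.2 ⟨by linarith, by linarith⟩
  · obtain rfl : σ = -1 := by linarith
    exact abs_le.2 ⟨by linarith, by linarith⟩

theorem isCompact_closedHalfRect (hσ : σ ^ 2 = 1) : IsCompact (closedHalfRect σ h a b) := by
  refine (isCompact_Icc.prod isCompact_Icc : IsCompact (Icc (-h) h ×ˢ Icc a b)).of_isClosed_subset
    ?_ fun p hp => ⟨abs_le.1 (abs_fst_le hσ hp), hp.2⟩
  exact (isClosed_Icc.preimage (by fun_prop : Continuous fun p : ℝ × ℝ => σ * p.1)).inter
    (isClosed_Icc.preimage continuous_snd)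

theorem isBounded_halfRect (hσ : σ ^ 2 = 1) : Bornology.IsBounded (halfRect σ h a b) :=
  (isCompact_closedHalfRect hσ).isBounded.subset halfRect_subset

theorem halfRect_nonempty (hσ : σ ^ 2 = 1) (hh : 0 < h) (hab : a < b) :
    (halfRect σ h a b).Nonempty := by
  refine ⟨(σ * (h / 2), (a + b) / 2), ?_, by constructor <;> simp only <;> linarith⟩
  simp only
  rw [← mul_assoc, ← sq, hσ, one_mul]
  constructor <;> linarith

theorem memLp_halfRect (hσ : σ ^ 2 = 1) {f : ℝ × ℝ → ℝ}
    (hf : ContinuousOn f (closedHalfRect σ h a b)) :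
    MemLp f 2 (volume.restrict (halfRect σ h a b)) :=
  memLp_of_continuousOn (isCompact_closedHalfRect hσ) isOpen_halfRect.measurableSet
    halfRect_subset hf 2

theorem memLp_Ioo {f : ℝ → ℝ} (hf : ContinuousOn f (Icc a b)) :
    MemLp f 2 (volume.restrict (Ioo a b)) :=
  memLp_of_continuousOn isCompact_Icc measurableSet_Ioo Ioo_subset_Icc_self hf 2

theorem map_affine_volume {d : ℝ} (hd : d ≠ 0) (a : ℝ) :
    Measure.map (fun t => a + d * t) volume = ENNReal.ofReal |d⁻¹| • (volume : Measure ℝ) := by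
  have h1 : (fun t : ℝ => a + d * t) = (fun t => a + t) ∘ fun t => d * t := rfl
  rw [h1, ← Measure.map_map (by fun_prop) (by fun_prop), Real.map_volume_mul_left hd,
    Measure.map_smul, map_add_left_eq_self]

theorem measurableEmbedding_affine {d : ℝ} (hd : d ≠ 0) (a : ℝ) :
    MeasurableEmbedding fun t : ℝ => a + d * t :=
  ((Homeomorph.mulLeft₀ d hd).trans (Homeomorph.addLeft a)).measurableEmbedding

theorem setIntegral_Ioo_eq {L : ℝ} (hL : 0 < L) (a : ℝ) (f : ℝ → ℝ) :
    ∫ ξ in Ioo a (a + L), f ξ = L * ∫ t, f (a + L * t) ∂unitMeasure := by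
  have h := (measurableEmbedding_affine hL.ne' a).setIntegral_map (μ := volume) f (Ioo a (a + L))
  have hpre : (fun t => a + L * t) ⁻¹' Ioo a (a + L) = Ioo 0 1 := by
    ext t
    simp only [mem_preimage, mem_Ioo]
    constructor
    · rintro ⟨h1, h2⟩; constructor <;> nlinarith
    · rintro ⟨h1, h2⟩; constructor <;> nlinarith
  rw [hpre, map_affine_volume hL.ne', Measure.restrict_smul, integral_smul_measure,
    ENNReal.toReal_ofReal (abs_nonneg _), abs_of_pos (inv_pos.2 hL), smul_eq_mul] at h
  rw [← h, mul_inv_cancel_left₀ hL.ne']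

theorem setIntegral_halfRect_eq (hσ : σ ^ 2 = 1) (hh : 0 < h) {L : ℝ} (hL : 0 < L) (a : ℝ)
    (f : ℝ × ℝ → ℝ) : ∫ p in halfRect σ h a (a + L), f p =
      h * L * ∫ p, f (0 + σ * h * p.1, a + L * p.2) ∂squareMeasure := by
  have hσ0 : σ ≠ 0 := by rintro rfl; norm_num at hσ
  have hc : σ * h ≠ 0 := mul_ne_zero hσ0 hh.ne'
  have hσa : |σ| = 1 := by rw [← sq_eq_sq₀ (abs_nonneg _) zero_le_one, sq_abs, hσ, one_pow]
  let T : ℝ × ℝ → ℝ × ℝ := Prod.map (fun s => 0 + σ * h * s) (fun t => a + L * t)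
  have hT : MeasurableEmbedding T :=
    (measurableEmbedding_affine hc 0).prodMap (measurableEmbedding_affine hL.ne' a)
  have hmap : Measure.map T volume = ENNReal.ofReal (h⁻¹ * L⁻¹) • (volume : Measure (ℝ × ℝ)) := by
    rw [Measure.volume_eq_prod, ← Measure.map_prod_map _ _ (by fun_prop) (by fun_prop),
      map_affine_volume hc, map_affine_volume hL.ne', Measure.prod_smul_left,
      Measure.prod_smul_right, smul_smul, ← ENNReal.ofReal_mul (abs_nonneg _), abs_inv, abs_inv,
      abs_mul, hσa, one_mul, abs_of_pos hh, abs_of_pos hL]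
  have h1 := hT.setIntegral_map (μ := volume) f (halfRect σ h a (a + L))
  have hpre : T ⁻¹' halfRect σ h a (a + L) = Ioo 0 1 ×ˢ Ioo 0 1 := by
    ext p
    have e : σ * (0 + σ * h * p.1) = h * p.1 := by
      calc _ = σ ^ 2 * (h * p.1) := by ring
        _ = _ := by rw [hσ, one_mul]
    simp only [T, mem_preimage, halfRect, mem_ofPred_eq, Prod.map_fst, Prod.map_snd, mem_prod, mem_Ioo, e]
    constructor
    · rintro ⟨⟨h1, h2⟩, h3, h4⟩
      exact ⟨⟨by nlinarith, by nlinarith⟩, by nlinarith, by nlinarith⟩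
    · rintro ⟨⟨h1, h2⟩, h3, h4⟩
      exact ⟨⟨by nlinarith, by nlinarith⟩, by nlinarith, by nlinarith⟩
  rw [hpre, hmap, Measure.restrict_smul, integral_smul_measure,
    ENNReal.toReal_ofReal (by positivity), smul_eq_mul] at h1
  change _ = h * L * ∫ p in Ioo 0 1 ×ˢ Ioo 0 1, f (T p)
  rw [← h1]
  field_simp

theorem sqInt_Ioo_eq {L : ℝ} (hL : 0 < L) (a : ℝ) (f : ℝ → ℝ) :
    sqInt (volume.restrict (Ioo a (a + L))) f = L * sqInt unitMeasure (fun t => f (a + L * t)) :=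
  setIntegral_Ioo_eq hL a fun ξ => f ξ ^ 2

theorem sqInt_halfRect_eq (hσ : σ ^ 2 = 1) (hh : 0 < h) {L : ℝ} (hL : 0 < L) (a : ℝ)
    (f : ℝ × ℝ → ℝ) : sqInt (volume.restrict (halfRect σ h a (a + L))) f =
      h * L * sqInt squareMeasure (fun p => f (0 + σ * h * p.1, a + L * p.2)) :=
  setIntegral_halfRect_eq hσ hh hL a fun p => f p ^ 2

theorem affine_mem_closedHalfRect (hσ : σ ^ 2 = 1) (hh : 0 < h) {L : ℝ} (hL : 0 < L) {p : ℝ × ℝ}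
    (hp : p ∈ Icc (0 : ℝ) 1 ×ˢ Icc (0 : ℝ) 1) :
    (0 + σ * h * p.1, a + L * p.2) ∈ closedHalfRect σ h a (a + L) := by
  obtain ⟨⟨h1, h2⟩, h3, h4⟩ := hp
  have e : σ * (0 + σ * h * p.1) = h * p.1 := by
    calc _ = σ ^ 2 * (h * p.1) := by ring
      _ = _ := by rw [hσ, one_mul]
  simp only [closedHalfRect, mem_ofPred_eq, mem_Icc, e]
  exact ⟨⟨by nlinarith, by nlinarith⟩, by nlinarith, by nlinarith⟩

/-- The trace inequality on the side `η = 0` of a half rectangle. -/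
theorem sqInt_trace_halfRect_le (hσ : σ ^ 2 = 1) (hh : 0 < h) {L : ℝ} (hL : 0 < L)
    {f f' : ℝ × ℝ → ℝ} (hf : ContinuousOn f (closedHalfRect σ h a (a + L)))
    (hf' : ContinuousOn f' (closedHalfRect σ h a (a + L)))
    (hd : ∀ p ∈ closedHalfRect σ h a (a + L), HasDerivAt (fun s => f (s, p.2)) (f' p) p.1) :
    sqInt (volume.restrict (Ioo a (a + L))) (fun ξ => f (0, ξ)) ≤
      2 / h * sqInt (volume.restrict (halfRect σ h a (a + L))) f +
        2 * h * sqInt (volume.restrict (halfRect σ h a (a + L))) f' := by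
  have hc : Continuous fun p : ℝ × ℝ => (0 + σ * h * p.1, a + L * p.2) := by fun_prop
  have key := sqInt_trace_le (f := fun p => f (0 + σ * h * p.1, a + L * p.2))
    (f' := fun p => (σ * h) * f' (0 + σ * h * p.1, a + L * p.2))
    (hf.comp hc.continuousOn fun p hp => affine_mem_closedHalfRect hσ hh hL hp)
    (continuousOn_const.mul
      (hf'.comp hc.continuousOn fun p hp => affine_mem_closedHalfRect hσ hh hL hp)) ?_
  · rw [sqInt_const_mul, mul_pow, hσ, one_mul] at key
    rw [sqInt_Ioo_eq hL, sqInt_halfRect_eq hσ hh hL, sqInt_halfRect_eq hσ hh hL]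
    simp only [mul_zero, add_zero] at key
    refine (mul_le_mul_of_nonneg_left key hL.le).trans (le_of_eq ?_)
    field_simp
  · intro p hp
    have h1 := hd _ (affine_mem_closedHalfRect (a := a) hσ hh hL hp)
    have h2 : HasDerivAt (fun s : ℝ => 0 + σ * h * s) (σ * h) p.1 := by
      simpa using ((hasDerivAt_id p.1).const_mul (σ * h)).const_add 0
    have h3 := HasDerivAt.scomp p.1 h1 h2
    exact h3

/-- Identification of traces: if functions that are regular in the normal direction up to the
boundary converge to `w`, and their normal derivatives to that of `w`, then their boundary values
converge to the trace of `w`. -/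
theorem HasTrace.tendsto (hσ : σ ^ 2 = 1) (hh : 0 < h) {L : ℝ} (hL : 0 < L) {w : ℝ × ℝ → ℝ}
    {t : ℝ → ℝ} (ht : HasTrace (halfRect σ h a (a + L)) a (a + L) w t) {Ω Ω' : ℕ → ℝ × ℝ → ℝ}
    (hΩ : ∀ n, ContinuousOn (Ω n) (closedHalfRect σ h a (a + L)))
    (hΩ' : ∀ n, ContinuousOn (Ω' n) (closedHalfRect σ h a (a + L)))
    (hd : ∀ n, ∀ p ∈ closedHalfRect σ h a (a + L),
      HasDerivAt (fun s => Ω n (s, p.2)) (Ω' n p) p.1)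
    (hw : L2Tendsto (volume.restrict (halfRect σ h a (a + L))) Ω w)
    (hw' : L2Tendsto (volume.restrict (halfRect σ h a (a + L))) Ω'
      (weakDeriv (halfRect σ h a (a + L)) 1 0 w)) :
    L2Tendsto (volume.restrict (Ioo a (a + L))) (fun n ξ => Ω n (0, ξ)) t := by
  obtain ⟨-, htm, ψ, hψ, hψ0, hψ1, -, hψt⟩ := ht
  set U := halfRect σ h a (a + L)
  have h0 : ∀ ξ ∈ Icc a (a + L), ((0 : ℝ), ξ) ∈ closedHalfRect σ h a (a + L) := fun ξ hξ =>
    ⟨by simpa using hh.le, hξ⟩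
  have hcs : Continuous fun ξ : ℝ => ((0 : ℝ), ξ) := by fun_prop
  have mψ : ∀ n, MemLp (ψ n) 2 (volume.restrict U) := fun n =>
    memLp_halfRect hσ (hψ n).continuous.continuousOn
  have mψ' : ∀ n, MemLp (dEta (ψ n)) 2 (volume.restrict U) := fun n =>
    memLp_halfRect hσ (smooth_dEta (hψ n)).continuous.continuousOn
  have mψt : ∀ n, MemLp (fun ξ => ψ n (0, ξ)) 2 (volume.restrict (Ioo a (a + L))) := fun n =>
    memLp_Ioo ((hψ n).continuous.comp hcs).continuousOn
  have c0 : L2Tendsto (volume.restrict U) ψ w := ⟨mψ, hw.memLp,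
    tendsto_sqInt_of_tendsto_eLpNorm (fun n => (mψ n).sub hw.memLp) hψ0⟩
  have c1 : L2Tendsto (volume.restrict U) (fun n => dEta (ψ n)) (weakDeriv U 1 0 w) :=
    ⟨mψ', hw'.memLp, tendsto_sqInt_of_tendsto_eLpNorm (fun n => (mψ' n).sub hw'.memLp) hψ1⟩
  have ct : L2Tendsto (volume.restrict (Ioo a (a + L))) (fun n ξ => ψ n (0, ξ)) t :=
    ⟨mψt, htm, tendsto_sqInt_of_tendsto_eLpNorm (fun n => (mψt n).sub htm) hψt⟩
  have d0 := (hw.sub c0).tendsto_sqInt (ae_of_all _ fun p => sub_self _)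
  have d1 := (hw'.sub c1).tendsto_sqInt (ae_of_all _ fun p => sub_self _)
  have dt : L2Tendsto (volume.restrict (Ioo a (a + L)))
      (fun n ξ => Ω n (0, ξ) - ψ n (0, ξ)) (fun _ => 0) := by
    refine ⟨fun n => (memLp_Ioo ((hΩ n).comp hcs.continuousOn h0)).sub (mψt n), MemLp.zero', ?_⟩
    simp only [sub_zero]
    refine squeeze_zero (fun _ => sqInt_nonneg) (fun n => ?_)
      (by simpa using (d0.const_mul (2 / h)).add (d1.const_mul (2 * h)))
    exact sqInt_trace_halfRect_le (f := fun p => Ω n p - ψ n p)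
      (f' := fun p => Ω' n p - dEta (ψ n) p) hσ hh hL
      ((hΩ n).sub (hψ n).continuous.continuousOn)
      ((hΩ' n).sub (smooth_dEta (hψ n)).continuous.continuousOn)
      fun p hp => (hd n p hp).sub (hasDerivAt_dEta (hψ n) p.1 p.2)
  exact (dt.add ct).congr_ae (fun n => ae_of_all _ fun ξ => by simp)
    (ae_of_all _ fun ξ => by simp)

end HalfRect

/-! ### Traces of the normal data of Sobolev functions -/

namespace InterfaceCurve

variable {m : ℕ} (Γ : InterfaceCurve (m + 2))

/-- The weak counterpart, on an open set, of the normal data. -/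
noncomputable def weakNormalField (U : Set (ℝ × ℝ)) : ℕ → (ℝ × ℝ → ℝ) → ℝ × ℝ → ℝ
  | 0, u => u
  | 1, u => weakDeriv U 1 0 u
  | j + 2, u => weakDeriv U j 0 (Γ.weakLap U u)

/-- The classical normal data as functions of both variables. -/
noncomputable def normalField : ℕ → (ℝ × ℝ → ℝ) → ℝ × ℝ → ℝ
  | 0, v => v
  | 1, v => dEta v
  | j + 2, v => dEta^[j] (Γ.classicalLap v)

theorem normalData_eq (k : ℕ) (v : ℝ × ℝ → ℝ) (ξ : ℝ) :
    Γ.normalData k v ξ = Γ.normalField k v (0, ξ) := by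
  match k with
  | 0 => rfl
  | 1 => rfl
  | j + 2 => rfl

theorem normalField_regular (hm : 1 ≤ m) {v : ℝ × ℝ → ℝ} (hv : ContDiff ℝ ∞ v) (k : ℕ) :
    ContinuousOn (Γ.normalField k v) Γ.regularRegion ∧
      ContinuousOn (dEta (Γ.normalField k v)) Γ.regularRegion ∧
      ∀ p ∈ Γ.regularRegion, HasDerivAt (fun s => Γ.normalField k v (s, p.2))
        (dEta (Γ.normalField k v) p) p.1 := by
  match k with
  | 0 => exact ⟨hv.continuous.continuousOn, (smooth_dEta hv).continuous.continuousOn,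
      fun p _ => hasDerivAt_dEta hv p.1 p.2⟩
  | 1 =>
    have hv' := smooth_dEta hv
    exact ⟨hv'.continuous.continuousOn, (smooth_dEta hv').continuous.continuousOn,
      fun p _ => hasDerivAt_dEta hv' p.1 p.2⟩
  | j + 2 =>
    have hl := Γ.etaSmooth_classicalLap hm hv
    have e : dEta (dEta^[j] (Γ.classicalLap v)) = dEta^[j + 1] (Γ.classicalLap v) :=
      (Function.iterate_succ_apply' dEta j _).symm
    simp only [normalField, e]
    exact ⟨hl.continuousOn j, hl.continuousOn (j + 1), fun p hp => hl.hasDerivAt j hp⟩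

theorem hasWeakDeriv_classicalLap (hm : 1 ≤ m) {U : Set (ℝ × ℝ)} (hU : IsOpen U)
    (hUr : U ⊆ Γ.regularRegion) {v : ℝ × ℝ → ℝ} (hv : ContDiff ℝ ∞ v) (j : ℕ) :
    HasWeakDeriv U j 0 (Γ.classicalLap v) (dEta^[j] (Γ.classicalLap v)) := by
  have hl := Γ.etaSmooth_classicalLap hm hv
  induction j with
  | zero =>
    have h0 : ContinuousOn (Γ.classicalLap v) U := (hl.continuousOn 0).mono hUr
    exact hasWeakDeriv_zero (h0.locallyIntegrableOn hU.measurableSet)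
  | succ j ih =>
    exact ih.dEta_comp (hasWeakDeriv_of_hasDerivAt_fst hU ((hl.continuousOn j).mono hUr)
      ((hl.continuousOn (j + 1)).mono hUr) fun p hp => hl.hasDerivAt j (hUr hp))

section

variable {σ h a b : ℝ}

theorem l2Tendsto_lapDeriv (hm : 1 ≤ m) (hσ : σ ^ 2 = 1)
    (hr : closedHalfRect σ h a b ⊆ Γ.regularRegion)
    {V : ℕ → ℕ → ℕ → ℝ × ℝ → ℝ} {W : ℕ → ℕ → ℝ × ℝ → ℝ} {j N : ℕ} (hj : j + 2 ≤ N)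
    (hVW : ∀ i l, i + l ≤ N →
      L2Tendsto (volume.restrict (halfRect σ h a b)) (fun n => V n i l) (W i l)) :
    L2Tendsto (volume.restrict (halfRect σ h a b)) (fun n => Γ.lapDeriv j (V n))
      (Γ.lapDeriv j W) := by
  have hmul : ∀ f, EtaSmooth Γ.regularRegion f → ∀ i k l, k + l ≤ N →
      L2Tendsto (volume.restrict (halfRect σ h a b)) (fun n p => dEta^[i] f p * V n k l p)
        (fun p => dEta^[i] f p * W k l p) := by
    intro f hf i k l hkl
    have hc := (hf.continuousOn i).mono hr
    obtain ⟨B, hB⟩ := (isCompact_closedHalfRect hσ).exists_bound_of_continuousOn hc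
    exact (hVW k l hkl).bdd_mul (memLp_halfRect hσ hc).1
      ((ae_restrict_iff' isOpen_halfRect.measurableSet).2
        (ae_of_all _ fun p hp => hB p (halfRect_subset hp)))
  refine (hVW (j + 2) 0 (by omega)).add (L2Tendsto.sum _ fun i hi => ?_)
  have hij : i ≤ j := Nat.lt_succ_iff.1 (Finset.mem_range.1 hi)
  exact (((hmul _ Γ.etaSmooth_J0 i (j - i) 2 (by omega)).add
    (hmul _ Γ.etaSmooth_J1 i (j - i + 1) 0 (by omega))).add
    (hmul _ (Γ.etaSmooth_J2 hm) i (j - i) 1 (by omega))).const_mul _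

/-- The normal data of smooth functions converging to `u` in `H^{m+1}` converge in `L²`, together
with their normal derivatives, to the weak normal data of `u`. -/
theorem l2Tendsto_normalField (hm : 1 ≤ m) (hσ : σ ^ 2 = 1)
    (hr : closedHalfRect σ h a b ⊆ Γ.regularRegion) {u : ℝ × ℝ → ℝ}
    (hu : MemSobolev (halfRect σ h a b) (m + 1) u) {v : ℕ → ℝ × ℝ → ℝ}
    (hv : ∀ n, ContDiff ℝ ∞ (v n))
    (hvu : ∀ i l, i + l ≤ m + 1 → L2Tendsto (volume.restrict (halfRect σ h a b))
      (fun n => mixedDeriv i l (v n)) (weakDeriv (halfRect σ h a b) i l u))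
    {k : ℕ} (hk : k ≤ m) :
    L2Tendsto (volume.restrict (halfRect σ h a b)) (fun n => Γ.normalField k (v n))
        (Γ.weakNormalField (halfRect σ h a b) k u) ∧
      ∃ w, L2Tendsto (volume.restrict (halfRect σ h a b))
        (fun n => dEta (Γ.normalField k (v n))) w ∧
        HasWeakDeriv (halfRect σ h a b) 1 0 (Γ.weakNormalField (halfRect σ h a b) k u) w := by
  set U := halfRect σ h a b with hUdef
  have hU : IsOpen U := isOpen_halfRect
  have hUr : U ⊆ Γ.regularRegion := halfRect_subset.trans hr
  have hvU : ∀ n i l, HasWeakDeriv U i l (v n) (mixedDeriv i l (v n)) := fun n i l =>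
    hasWeakDeriv_of_smooth hU (hv n) i l
  match k, hk with
  | 0, _ =>
    have h0 : weakDeriv U 0 0 u =ᵐ[volume.restrict U] u :=
      (hasWeakDeriv_zero (hu.weakDeriv_spec hU (i := 0) (j := 0) (by omega)).1.1).weakDeriv_ae_eq hU
    exact ⟨(hvu 0 0 (by omega)).congr_ae (fun n => Filter.EventuallyEq.rfl) h0,
      weakDeriv U 1 0 u, hvu 1 0 (by omega), (hu.weakDeriv_spec hU (by omega)).1⟩
  | 1, _ =>
    refine ⟨hvu 1 0 (by omega), weakDeriv U 2 0 u, hvu 2 0 (by omega), ?_⟩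
    exact HasWeakDeriv.of_tendsto (fun n => hasWeakDeriv_of_smooth hU (smooth_dEta (hv n)) 1 0)
      (hvu 1 0 (by omega)).memLp_seq (hvu 2 0 (by omega)).memLp_seq (hvu 1 0 (by omega)).memLp
      (hvu 2 0 (by omega)).memLp (hvu 1 0 (by omega)).tendsto (hvu 2 0 (by omega)).tendsto
  | j + 2, hk =>
    let W : ℕ → ℕ → ℝ × ℝ → ℝ := fun i l => weakDeriv U i l u
    have hconv : ∀ j, j + 2 ≤ m + 1 → L2Tendsto (volume.restrict U)
        (fun n => dEta^[j] (Γ.classicalLap (v n))) (Γ.lapDeriv j W) := by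
      intro j hj
      refine (Γ.l2Tendsto_lapDeriv hm hσ hr (V := fun n i l => mixedDeriv i l (v n)) hj
        hvu).congr_ae (fun n => ?_) Filter.EventuallyEq.rfl
      exact (ae_restrict_iff' hU.measurableSet).2 (ae_of_all _ fun p hp =>
        (Γ.dEta_iterate_classicalLap hm (hv n) j (hUr hp)).symm)
    have hlap : Γ.weakLap U u = Γ.lapDeriv 0 W := by
      funext p
      simp only [weakLap, lap, lapDeriv, W, zero_add, Finset.sum_range_one, Nat.choose_self,
        Nat.cast_one, Nat.sub_self, Function.iterate_zero, id]
      ring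
    have hweak : ∀ j, j + 2 ≤ m + 1 → HasWeakDeriv U j 0 (Γ.weakLap U u) (Γ.lapDeriv j W) := by
      intro j hj
      rw [hlap]
      have c0 := hconv 0 (by omega)
      have c1 := hconv j hj
      exact HasWeakDeriv.of_tendsto (fun n => Γ.hasWeakDeriv_classicalLap hm hU hUr (hv n) j)
        c0.memLp_seq c1.memLp_seq c0.memLp c1.memLp c0.tendsto c1.tendsto
    have hae : weakDeriv U j 0 (Γ.weakLap U u) =ᵐ[volume.restrict U] Γ.lapDeriv j W :=
      (hweak j (by omega)).weakDeriv_ae_eq hU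
    have c1 : L2Tendsto (volume.restrict U) (fun n => dEta^[j] (Γ.classicalLap (v n)))
        (weakDeriv U j 0 (Γ.weakLap U u)) :=
      (hconv j (by omega)).congr_ae (fun n => Filter.EventuallyEq.rfl) hae.symm
    have c2 := hconv (j + 1) (by omega)
    have e : ∀ n, dEta (dEta^[j] (Γ.classicalLap (v n))) = dEta^[j + 1] (Γ.classicalLap (v n)) :=
      fun n => (Function.iterate_succ_apply' dEta j _).symm
    simp only [normalField, weakNormalField, e]
    refine ⟨c1, Γ.lapDeriv (j + 1) W, c2, ?_⟩
    refine HasWeakDeriv.of_tendsto (fun n => ?_) c1.memLp_seq c2.memLp_seq c1.memLp c2.memLp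
      c1.tendsto c2.tendsto
    have hl := Γ.etaSmooth_classicalLap hm (hv n)
    exact hasWeakDeriv_of_hasDerivAt_fst hU ((hl.continuousOn j).mono hUr)
      ((hl.continuousOn (j + 1)).mono hUr) fun p hp => hl.hasDerivAt j (hUr hp)

/-- The traces of the weighted normal data of a Sobolev function are the limits of the normal data
of its smooth approximations. -/
theorem l2Tendsto_normalData (hm : 1 ≤ m) (hσ : σ ^ 2 = 1) (hh : 0 < h) {L : ℝ} (hL : 0 < L)
    (hr : closedHalfRect σ h a (a + L) ⊆ Γ.regularRegion) {u : ℝ × ℝ → ℝ}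
    (hu : MemSobolev (halfRect σ h a (a + L)) (m + 1) u) {v : ℕ → ℝ × ℝ → ℝ}
    (hv : ∀ n, ContDiff ℝ ∞ (v n))
    (hvu : ∀ i l, i + l ≤ m + 1 → L2Tendsto (volume.restrict (halfRect σ h a (a + L)))
      (fun n => mixedDeriv i l (v n)) (weakDeriv (halfRect σ h a (a + L)) i l u))
    {k : ℕ} (hk : k ≤ m) {β : ℝ} {t : ℝ → ℝ}
    (ht : HasTrace (halfRect σ h a (a + L)) a (a + L)
      (fun p => β * Γ.weakNormalField (halfRect σ h a (a + L)) k u p) t) :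
    L2Tendsto (volume.restrict (Ioo a (a + L))) (fun n ξ => β * Γ.normalData k (v n) ξ) t := by
  obtain ⟨c0, w, c1, hw⟩ := Γ.l2Tendsto_normalField hm hσ hr hu hv hvu hk
  have hae := ((hw.const_mul β).weakDeriv_ae_eq isOpen_halfRect).symm
  simp only [normalData_eq]
  have hreg := fun n => Γ.normalField_regular hm (hv n) k
  exact ht.tendsto hσ hh hL
    (Ω := fun n p => β * Γ.normalField k (v n) p)
    (Ω' := fun n p => β * dEta (Γ.normalField k (v n)) p)
    (fun n => continuousOn_const.mul ((hreg n).1.mono hr))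
    (fun n => continuousOn_const.mul ((hreg n).2.1.mono hr))
    (fun n p hp => ((hreg n).2.2 p (hr hp)).const_mul β)
    (c0.const_mul β) ((c1.const_mul β).congr_ae (fun n => Filter.EventuallyEq.rfl) hae)

end

end InterfaceCurve

/-! ### Shape of the Frenet fictitious elements -/

theorem plane_norm_sq (v : Plane) : ‖v‖ ^ 2 = v 0 ^ 2 + v 1 ^ 2 := by
  rw [EuclideanSpace.real_norm_sq_eq, Fin.sum_univ_two]

theorem plane_abs_apply_le (v : Plane) (i : Fin 2) : |v i| ≤ ‖v‖ := PiLp.norm_apply_le v i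

theorem plane_norm_le_add (v : Plane) : ‖v‖ ≤ |v 0| + |v 1| := by
  refine abs_le_of_sq_le_sq' ?_ (by positivity) |>.2
  rw [plane_norm_sq, ← sq_abs (v 0), ← sq_abs (v 1)]
  nlinarith [abs_nonneg (v 0), abs_nonneg (v 1)]

theorem hasDerivWithinAt_plane_apply {f : ℝ → Plane} {f' : Plane} {s : Set ℝ} {x : ℝ}
    (hf : HasDerivWithinAt f f' s x) (i : Fin 2) :
    HasDerivWithinAt (fun t => f t i) (f' i) s x :=
  (EuclideanSpace.proj (𝕜 := ℝ) i).hasFDerivAt.comp_hasDerivWithinAt x hf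

namespace RectElement

variable (K : RectElement)

theorem dist_le_add {A B : Plane} (hA : A ∈ K.toSet) (hB : B ∈ K.toSet) :
    dist A B ≤ K.p + K.q := by
  obtain ⟨⟨a1, a2⟩, a3, a4⟩ := hA
  obtain ⟨⟨b1, b2⟩, b3, b4⟩ := hB
  rw [dist_eq_norm]
  refine (plane_norm_le_add _).trans (add_le_add ?_ ?_)
  · exact abs_le.2 ⟨by simp only [PiLp.sub_apply]; linarith, by simp only [PiLp.sub_apply]; linarith⟩
  · exact abs_le.2 ⟨by simp only [PiLp.sub_apply]; linarith, by simp only [PiLp.sub_apply]; linarith⟩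

theorem h_le_add : K.h ≤ K.p + K.q :=
  Metric.diam_le_of_forall_dist_le (add_pos K.p_pos K.q_pos).le fun _ hA _ hB => K.dist_le_add hA hB

theorem dist_le_h {A B : Plane} (hA : A ∈ K.toSet) (hB : B ∈ K.toSet) : dist A B ≤ K.h :=
  Metric.dist_le_diam_of_mem (Metric.isBounded_iff.2
    ⟨K.p + K.q, fun _ hA _ hB => K.dist_le_add hA hB⟩) hA hB

theorem A1_mem : K.A1 ∈ K.toSet := by
  have := K.p_pos; have := K.q_pos
  constructor <;> constructor <;> simp [A1] <;> linarith

theorem A2_mem : K.A2 ∈ K.toSet := by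
  have := K.p_pos; have := K.q_pos
  constructor <;> simp [A2] <;> linarith

theorem A3_mem : K.A3 ∈ K.toSet := by
  have := K.p_pos; have := K.q_pos
  constructor <;> simp [A3] <;> linarith

theorem A4_mem : K.A4 ∈ K.toSet := by
  have := K.p_pos; have := K.q_pos
  constructor <;> simp [A4] <;> linarith

theorem h_pos : 0 < K.h := by
  refine lt_of_lt_of_le ?_ (K.dist_le_h K.A1_mem K.A2_mem)
  refine dist_pos.2 fun h => ?_
  have h0 := congrArg (fun v : Plane => v 0) h
  have := K.p_pos
  simp [A1, A2] at h0
  linarith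

end RectElement

namespace InterfaceCurve

section

variable {m : ℕ} (Γ : InterfaceCurve (m + 2))

theorem hasDerivWithinAt_g {ξ : ℝ} (hξ : ξ ∈ Γ.I) : HasDerivWithinAt Γ.g (Γ.g1 ξ) Γ.I ξ :=
  ((Γ.contDiffOn.differentiableOn (by norm_cast)) ξ hξ).hasDerivWithinAt

theorem hasDerivWithinAt_g1 {ξ : ℝ} (hξ : ξ ∈ Γ.I) : HasDerivWithinAt Γ.g1 (Γ.g2 ξ) Γ.I ξ :=
  ((Γ.g1_contDiffOn.differentiableOn (by norm_cast)) ξ hξ).hasDerivWithinAt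

theorem tangent_norm {ξ : ℝ} (hξ : ξ ∈ Γ.I) : ‖Γ.tangent ξ‖ = 1 :=
  norm_smul_inv_norm (𝕜 := ℝ) (Γ.g1_ne_zero hξ)

theorem normal_norm {ξ : ℝ} (hξ : ξ ∈ Γ.I) : ‖Γ.normal ξ‖ = 1 := by
  have h1 := Γ.tangent_norm hξ
  have h2 : ‖Γ.normal ξ‖ ^ 2 = ‖Γ.tangent ξ‖ ^ 2 := by
    rw [plane_norm_sq, plane_norm_sq]
    simp [normal]
    ring
  rw [h1, one_pow] at h2
  nlinarith [norm_nonneg (Γ.normal ξ)]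

/-- The Frenet formula `n' = κ g'`. -/
theorem hasDerivWithinAt_normal {ξ : ℝ} (hξ : ξ ∈ Γ.I) (i : Fin 2) :
    HasDerivWithinAt (fun t => Γ.normal t i) (Γ.curvature ξ * Γ.g1 ξ i) Γ.I ξ := by
  have hx := hasDerivWithinAt_plane_apply (Γ.hasDerivWithinAt_g1 hξ) 0
  have hy := hasDerivWithinAt_plane_apply (Γ.hasDerivWithinAt_g1 hξ) 1
  have hs0 : ‖Γ.g1 ξ‖ ≠ 0 := norm_ne_zero_iff.2 (Γ.g1_ne_zero hξ)
  have hsq := plane_norm_sq (Γ.g1 ξ)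
  have hs : HasDerivWithinAt (fun t => ‖Γ.g1 t‖)
      ((Γ.g1 ξ 0 * Γ.g2 ξ 0 + Γ.g1 ξ 1 * Γ.g2 ξ 1) / ‖Γ.g1 ξ‖) Γ.I ξ := by
    have e : (fun t => ‖Γ.g1 t‖) = fun t => √(Γ.g1 t 0 ^ 2 + Γ.g1 t 1 ^ 2) := by
      funext t
      rw [← plane_norm_sq, Real.sqrt_sq (norm_nonneg _)]
    have h1 := ((hx.pow 2).add (hy.pow 2)).sqrt (by
      simp only [Pi.add_apply, Pi.pow_apply]
      rw [← hsq]; exact pow_ne_zero 2 hs0)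
    rw [e]
    refine h1.congr_deriv ?_
    simp only [Pi.add_apply, Pi.pow_apply]
    rw [← hsq, Real.sqrt_sq (norm_nonneg _)]
    field_simp
    norm_num
    ring
  have hinv := hs.inv hs0
  have hk : Γ.curvature ξ =
      (Γ.g1 ξ 0 * Γ.g2 ξ 1 - Γ.g1 ξ 1 * Γ.g2 ξ 0) / ‖Γ.g1 ξ‖ ^ 3 := rfl
  fin_cases i
  · have e : (fun t => Γ.normal t 0) = fun t => ‖Γ.g1 t‖⁻¹ * Γ.g1 t 1 := by
      funext t; simp [normal, tangent]
    simp only [Fin.zero_eta, e]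
    refine (hinv.mul hy).congr_deriv ?_
    simp only [Pi.inv_apply]
    rw [hk]
    field_simp
    rw [hsq]
    ring
  · have e : (fun t => Γ.normal t 1) = fun t => -(‖Γ.g1 t‖⁻¹ * Γ.g1 t 0) := by
      funext t; simp [normal, tangent]
    simp only [Fin.mk_one, e]
    refine (hinv.mul hx).neg.congr_deriv ?_
    simp only [Pi.inv_apply]
    rw [hk]
    field_simp
    rw [hsq]
    ring

/-- An injective regular curve is bi-Lipschitz onto its image. -/
theorem exists_mul_abs_sub_le_norm (hinj : InjOn Γ.g Γ.I) :
    ∃ c : ℝ, 0 < c ∧ ∀ ξ ∈ Γ.I, ∀ ξ' ∈ Γ.I, c * |ξ - ξ'| ≤ ‖Γ.g ξ - Γ.g ξ'‖ := by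
  have hI : IsCompact Γ.I := isCompact_Icc
  have hne : Γ.I.Nonempty := nonempty_Icc.2 Γ.lt.le
  have hg1 : ContinuousOn Γ.g1 Γ.I := Γ.g1_contDiffOn.continuousOn
  have hg : ContinuousOn Γ.g Γ.I := Γ.contDiffOn.continuousOn
  obtain ⟨ξ₀, hξ₀, hmin⟩ := hI.exists_isMinOn hne hg1.norm
  set γ := ‖Γ.g1 ξ₀‖ with hγ
  have hγ0 : 0 < γ := norm_pos_iff.2 (Γ.g1_ne_zero hξ₀)
  obtain ⟨δ, hδ, hunif⟩ := Metric.uniformContinuousOn_iff.1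
    (hI.uniformContinuousOn_of_continuous hg1) (γ / 2) (by positivity)
  -- Nearby parameters: the derivative varies by at most half of its minimal length.
  have hnear : ∀ ξ ∈ Γ.I, ∀ ξ' ∈ Γ.I, |ξ - ξ'| < δ → γ / 2 * |ξ - ξ'| ≤ ‖Γ.g ξ - Γ.g ξ'‖ := by
    intro ξ hξ ξ' hξ' hd
    have hs : uIcc ξ' ξ ⊆ Γ.I := uIcc_subset_Icc hξ' hξ
    have hder : ∀ x ∈ uIcc ξ' ξ, HasDerivWithinAt (fun t => Γ.g t - t • Γ.g1 ξ')
        (Γ.g1 x - Γ.g1 ξ') (uIcc ξ' ξ) x := by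
      intro x hx
      have := ((Γ.hasDerivWithinAt_g (hs hx)).mono hs).sub
        ((hasDerivWithinAt_id x _).smul_const (Γ.g1 ξ'))
      rwa [one_smul] at this
    have hle := (convex_uIcc ξ' ξ).norm_image_sub_le_of_norm_hasDerivWithin_le hder
      (C := γ / 2) (fun x hx => ?_) left_mem_uIcc right_mem_uIcc
    · have e : Γ.g ξ - ξ • Γ.g1 ξ' - (Γ.g ξ' - ξ' • Γ.g1 ξ') =
          (Γ.g ξ - Γ.g ξ') - (ξ - ξ') • Γ.g1 ξ' := by
        rw [sub_smul]; abel
      rw [e, Real.norm_eq_abs] at hle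
      have h1 := norm_sub_norm_le ((ξ - ξ') • Γ.g1 ξ') (Γ.g ξ - Γ.g ξ')
      rw [norm_sub_rev ((ξ - ξ') • Γ.g1 ξ'), norm_smul, Real.norm_eq_abs] at h1
      have h2 : γ ≤ ‖Γ.g1 ξ'‖ := hmin hξ'
      have h3 := mul_le_mul_of_nonneg_left h2 (abs_nonneg (ξ - ξ'))
      linarith
    · have hx' : dist x ξ' < δ := by
        rw [Real.dist_eq]
        refine lt_of_le_of_lt ?_ hd
        simpa only [abs_sub_comm] using abs_sub_left_of_mem_uIcc hx
      have := hunif x (hs hx) ξ' hξ' hx'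
      rw [dist_eq_norm] at this
      exact this.le
  let S : Set (ℝ × ℝ) := (Γ.I ×ˢ Γ.I) ∩ {p | δ ≤ |p.1 - p.2|}
  have hS : IsCompact S := (hI.prod hI).inter_right
    (isClosed_le continuous_const (by fun_prop))
  have hdist : ∀ ξ ∈ Γ.I, ∀ ξ' ∈ Γ.I, |ξ - ξ'| ≤ Γ.ξe - Γ.ξs := by
    rintro ξ ⟨h1, h2⟩ ξ' ⟨h3, h4⟩
    exact abs_le.2 ⟨by linarith, by linarith⟩
  have hℓ : 0 < Γ.ξe - Γ.ξs := sub_pos.2 Γ.lt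
  rcases S.eq_empty_or_nonempty with hSe | hSn
  · refine ⟨γ / 2, by positivity, fun ξ hξ ξ' hξ' => hnear ξ hξ ξ' hξ' ?_⟩
    by_contra! hlt
    exact (hSe ▸ (⟨⟨hξ, hξ'⟩, hlt⟩ : (ξ, ξ') ∈ S) : (ξ, ξ') ∈ (∅ : Set (ℝ × ℝ)))
  · have hc : ContinuousOn (fun p : ℝ × ℝ => ‖Γ.g p.1 - Γ.g p.2‖) S :=
      ((hg.comp continuousOn_fst fun p hp => hp.1.1).sub
        (hg.comp continuousOn_snd fun p hp => hp.1.2)).norm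
    obtain ⟨p₀, hp₀, hpmin⟩ := hS.exists_isMinOn hSn hc
    have hμ : 0 < ‖Γ.g p₀.1 - Γ.g p₀.2‖ := by
      refine norm_pos_iff.2 (sub_ne_zero.2 fun h => ?_)
      have h1 := hinj hp₀.1.1 hp₀.1.2 h
      have h2 : δ ≤ |p₀.1 - p₀.2| := hp₀.2
      rw [h1, sub_self, abs_zero] at h2
      linarith
    refine ⟨min (γ / 2) (‖Γ.g p₀.1 - Γ.g p₀.2‖ / (Γ.ξe - Γ.ξs)), by positivity,
      fun ξ hξ ξ' hξ' => ?_⟩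
    rcases lt_or_ge |ξ - ξ'| δ with hlt | hge
    · exact (mul_le_mul_of_nonneg_right (min_le_left _ _) (abs_nonneg _)).trans
        (hnear ξ hξ ξ' hξ' hlt)
    · refine (mul_le_mul (min_le_right _ _) (hdist ξ hξ ξ' hξ') (abs_nonneg _)
        (by positivity)).trans ?_
      rw [div_mul_cancel₀ _ hℓ.ne']
      exact isMinOn_iff.1 hpmin (ξ, ξ') ⟨⟨hξ, hξ'⟩, hge⟩

theorem abs_sub_le_of_hasDerivWithinAt {f f' : ℝ → ℝ} {B : ℝ}
    (hf : ∀ ξ ∈ Γ.I, HasDerivWithinAt f (f' ξ) Γ.I ξ) (hB : ∀ ξ ∈ Γ.I, |f' ξ| ≤ B) {ξ ξ' : ℝ}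
    (hξ : ξ ∈ Γ.I) (hξ' : ξ' ∈ Γ.I) : |f ξ' - f ξ| ≤ B * |ξ' - ξ| :=
  (convex_Icc _ _).norm_image_sub_le_of_norm_hasDerivWithin_le hf hB hξ hξ'

/-- The tangential component of a chord between two points of a tube whose half-width `h`
satisfies `h |κ| ≤ 1 / 2` is controlled by the distance of their `ξ`-coordinates. The bound on
`h |κ|` enters through `n' = κ g'`. -/
theorem abs_chord_tangent_le {h G : ℝ} (hG : ∀ ξ ∈ Γ.I, ‖Γ.g1 ξ‖ ≤ G)
    (hκ : ∀ ξ ∈ Γ.I, h * |Γ.curvature ξ| ≤ 1 / 2) {p p' : ℝ × ℝ} (hp : p ∈ Γ.tubeDomain h)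
    (hp' : p' ∈ Γ.tubeDomain h) :
    |(Γ.P p' 0 - Γ.P p 0) * Γ.tangent p.2 0 + (Γ.P p' 1 - Γ.P p 1) * Γ.tangent p.2 1| ≤
      3 * G * |p'.2 - p.2| := by
  obtain ⟨hη, hξ⟩ := hp
  obtain ⟨hη', hξ'⟩ := hp'
  have hh : 0 ≤ h := by linarith [hη.1, hη.2]
  have hg : ∀ i, |Γ.g p'.2 i - Γ.g p.2 i| ≤ G * |p'.2 - p.2| := fun i =>
    Γ.abs_sub_le_of_hasDerivWithinAt (f' := fun ξ => Γ.g1 ξ i)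
      (fun ξ h => hasDerivWithinAt_plane_apply (Γ.hasDerivWithinAt_g h) i)
      (fun ξ h => (plane_abs_apply_le _ i).trans (hG ξ h)) hξ hξ'
  have hn : ∀ i, |h * Γ.normal p'.2 i - h * Γ.normal p.2 i| ≤ 1 / 2 * G * |p'.2 - p.2| := fun i =>
    Γ.abs_sub_le_of_hasDerivWithinAt (f := fun t => h * Γ.normal t i)
      (f' := fun ξ => h * (Γ.curvature ξ * Γ.g1 ξ i))
      (fun ξ hx => (Γ.hasDerivWithinAt_normal hx i).const_mul h)
      (fun ξ hx => by
        rw [abs_mul, abs_mul, abs_of_nonneg hh, ← mul_assoc]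
        exact mul_le_mul (hκ ξ hx) ((plane_abs_apply_le _ i).trans (hG ξ hx)) (abs_nonneg _)
          (by norm_num)) hξ hξ'
  have hn' : ∀ i, |p'.1 * (Γ.normal p'.2 i - Γ.normal p.2 i)| ≤ 1 / 2 * G * |p'.2 - p.2| := by
    intro i
    refine le_trans ?_ (hn i)
    rw [← mul_sub, abs_mul, abs_mul, abs_of_nonneg hh]
    exact mul_le_mul_of_nonneg_right (abs_le.2 hη') (abs_nonneg _)
  have ht : ∀ i, |Γ.tangent p.2 i| ≤ 1 := fun i =>
    (plane_abs_apply_le _ i).trans (Γ.tangent_norm hξ).le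
  have e : (Γ.P p' 0 - Γ.P p 0) * Γ.tangent p.2 0 + (Γ.P p' 1 - Γ.P p 1) * Γ.tangent p.2 1 =
      (Γ.g p'.2 0 - Γ.g p.2 0 + p'.1 * (Γ.normal p'.2 0 - Γ.normal p.2 0)) * Γ.tangent p.2 0 +
      (Γ.g p'.2 1 - Γ.g p.2 1 + p'.1 * (Γ.normal p'.2 1 - Γ.normal p.2 1)) * Γ.tangent p.2 1 := by
    simp [P, normal]
    ring
  have hterm : ∀ i, |(Γ.g p'.2 i - Γ.g p.2 i + p'.1 * (Γ.normal p'.2 i - Γ.normal p.2 i)) *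
      Γ.tangent p.2 i| ≤ 3 / 2 * G * |p'.2 - p.2| := by
    intro i
    rw [abs_mul]
    refine (mul_le_of_le_one_right (abs_nonneg _) (ht i)).trans ((abs_add_le _ _).trans ?_)
    linarith [hg i, hn' i]
  rw [e]
  refine (abs_add_le _ _).trans ?_
  linarith [hterm 0, hterm 1]

end

theorem R_P {k : ℕ} (Γ : InterfaceCurve k) {ε : ℝ} (hε : Γ.IsTubeWidth ε) {p : ℝ × ℝ}
    (hp : p ∈ Γ.tubeDomain ε) : Γ.R ε (Γ.P p) = p :=
  hε.2.leftInvOn_invFunOn hp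

theorem IsTubeWidth.injOn {k : ℕ} {Γ : InterfaceCurve k} {ε : ℝ} (hε : Γ.IsTubeWidth ε) :
    InjOn Γ.g Γ.I := by
  intro ξ hξ ξ' hξ' h
  have h0 : (0 : ℝ) ∈ Icc (-ε) ε := ⟨by linarith [hε.1], hε.1.le⟩
  have := hε.2 (show ((0 : ℝ), ξ) ∈ Γ.tubeDomain ε from ⟨h0, hξ⟩)
    (show ((0 : ℝ), ξ') ∈ Γ.tubeDomain ε from ⟨h0, hξ'⟩) (by simpa [P] using h)
  exact congrArg Prod.snd this

/-- The length of a fictitious element in the direction `ξ` is comparable to the diameter of the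
element. -/
theorem exists_frenetElement_bounds {m : ℕ} (Γ : InterfaceCurve (m + 2)) (hinj : InjOn Γ.g Γ.I)
    (ρ : ℝ) : ∃ c : ℝ, 0 < c ∧ ∀ ε, Γ.IsTubeWidth ε → ∀ K : RectElement, K.AspectLe ρ → K.h < ε →
      (∀ ξ ∈ Γ.I, K.h * |Γ.curvature ξ| ≤ 1 / 2) → K.toSet ⊆ Γ.tube K.h →
      (Γ.frenetElement ε K).a ∈ Γ.I ∧ (Γ.frenetElement ε K).b ∈ Γ.I ∧
      K.h ≤ c * ((Γ.frenetElement ε K).b - (Γ.frenetElement ε K).a) ∧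
      (Γ.frenetElement ε K).b - (Γ.frenetElement ε K).a ≤ c * K.h := by
  obtain ⟨c₀, hc₀, hlip⟩ := Γ.exists_mul_abs_sub_le_norm hinj
  obtain ⟨G, hG⟩ := (isCompact_Icc : IsCompact Γ.I).exists_bound_of_continuousOn
    Γ.g1_contDiffOn.continuousOn
  have hG0 : 0 ≤ G := (norm_nonneg _).trans (hG Γ.ξs (left_mem_Icc.2 Γ.lt.le))
  refine ⟨max ((1 + |ρ|) * (6 * G)) (3 / c₀), by positivity, ?_⟩
  intro ε hε K hK hKε hκ hKt
  have hh := K.h_pos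
  have hR : ∀ A ∈ K.toSet, Γ.R ε A ∈ Γ.tubeDomain K.h ∧ Γ.P (Γ.R ε A) = A := by
    intro A hA
    obtain ⟨p, hp, rfl⟩ := hKt hA
    rw [Γ.R_P hε ⟨⟨by linarith [hp.1.1], by linarith [hp.1.2]⟩, hp.2⟩]
    exact ⟨hp, rfl⟩
  obtain ⟨hr1, hP1⟩ := hR _ K.A1_mem
  obtain ⟨hr2, hP2⟩ := hR _ K.A2_mem
  obtain ⟨hr3, hP3⟩ := hR _ K.A3_mem
  obtain ⟨hr4, hP4⟩ := hR _ K.A4_mem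
  have hup : ∀ A ∈ K.toSet, ∀ B ∈ K.toSet, (Γ.R ε A).2 ≤ (Γ.R ε B).2 + 3 / c₀ * K.h := by
    intro A hA B hB
    obtain ⟨hrA, hPA⟩ := hR A hA
    obtain ⟨hrB, hPB⟩ := hR B hB
    have h1 := hlip _ hrA.2 _ hrB.2
    have h2 := K.dist_le_h hA hB
    have h3 : Γ.g (Γ.R ε A).2 - Γ.g (Γ.R ε B).2 = (A - B) -
        (Γ.R ε A).1 • Γ.normal (Γ.R ε A).2 + (Γ.R ε B).1 • Γ.normal (Γ.R ε B).2 := by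
      conv_rhs => rw [← congrArg₂ (· - ·) hPA hPB]
      simp only [P]
      abel
    have h4 : ∀ p ∈ Γ.tubeDomain K.h, ‖p.1 • Γ.normal p.2‖ ≤ K.h := by
      intro p hp
      rw [norm_smul, Γ.normal_norm hp.2, mul_one]
      exact abs_le.2 hp.1
    have h5 : ‖Γ.g (Γ.R ε A).2 - Γ.g (Γ.R ε B).2‖ ≤ 3 * K.h := by
      rw [h3]
      rw [dist_eq_norm] at h2
      refine (norm_add_le _ _).trans ((add_le_add_left (norm_sub_le _ _) _).trans ?_)
      linarith [h4 _ hrA, h4 _ hrB]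
    have h6 : (Γ.R ε A).2 - (Γ.R ε B).2 ≤ 3 * K.h / c₀ := by
      rw [le_div_iff₀ hc₀, mul_comm]
      exact (mul_le_mul_of_nonneg_left (le_abs_self _) hc₀.le).trans (h1.trans h5)
    rw [div_mul_eq_mul_div]
    linarith
  have hρ : 0 < ρ := by
    by_contra! hle
    have := hK.1
    nlinarith [K.p_pos, K.q_pos]
  set L := (Γ.frenetElement ε K).b - (Γ.frenetElement ε K).a with hL
  have habs : ∀ x y, (Γ.frenetElement ε K).a ≤ x → x ≤ (Γ.frenetElement ε K).b →
      (Γ.frenetElement ε K).a ≤ y → y ≤ (Γ.frenetElement ε K).b → |x - y| ≤ L := by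
    intro x y h1 h2 h3 h4
    exact abs_le.2 ⟨by linarith, by linarith⟩
  have ha1 : (Γ.frenetElement ε K).a ≤ (Γ.R ε K.A1).2 := by simp [frenetElement]
  have ha2 : (Γ.frenetElement ε K).a ≤ (Γ.R ε K.A2).2 := by simp [frenetElement]
  have ha4 : (Γ.frenetElement ε K).a ≤ (Γ.R ε K.A4).2 := by simp [frenetElement]
  have hb1 : (Γ.R ε K.A1).2 ≤ (Γ.frenetElement ε K).b := by simp [frenetElement]
  have hb2 : (Γ.R ε K.A2).2 ≤ (Γ.frenetElement ε K).b := by simp [frenetElement]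
  have hb4 : (Γ.R ε K.A4).2 ≤ (Γ.frenetElement ε K).b := by simp [frenetElement]
  refine ⟨?_, ?_, ?_, ?_⟩
  · have h1 := hr1.2; have h2 := hr2.2; have h3 := hr3.2; have h4 := hr4.2
    simp only [I, mem_Icc] at h1 h2 h3 h4
    simp only [frenetElement, I, mem_Icc, le_min_iff, min_le_iff]
    tauto
  · have h1 := hr1.2; have h2 := hr2.2; have h3 := hr3.2; have h4 := hr4.2
    simp only [I, mem_Icc] at h1 h2 h3 h4
    simp only [frenetElement, I, mem_Icc, le_max_iff, max_le_iff]
    tauto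
  · -- The two edges at the first vertex have tangential components `p τ₁` and `q τ₂`.
    have t2 := Γ.abs_chord_tangent_le hG hκ hr1 hr2
    have t4 := Γ.abs_chord_tangent_le hG hκ hr1 hr4
    rw [hP1, hP2] at t2
    rw [hP1, hP4] at t4
    have e2 : (K.A2 0 - K.A1 0) * Γ.tangent (Γ.R ε K.A1).2 0 +
        (K.A2 1 - K.A1 1) * Γ.tangent (Γ.R ε K.A1).2 1 = K.p * Γ.tangent (Γ.R ε K.A1).2 0 := by
      simp [RectElement.A1, RectElement.A2]
    have e4 : (K.A4 0 - K.A1 0) * Γ.tangent (Γ.R ε K.A1).2 0 +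
        (K.A4 1 - K.A1 1) * Γ.tangent (Γ.R ε K.A1).2 1 = K.q * Γ.tangent (Γ.R ε K.A1).2 1 := by
      simp [RectElement.A1, RectElement.A4]
    rw [e2, abs_mul, abs_of_pos K.p_pos] at t2
    rw [e4, abs_mul, abs_of_pos K.q_pos] at t4
    have l2 := mul_le_mul_of_nonneg_left (habs _ _ ha2 hb2 ha1 hb1)
      (by positivity : 0 ≤ 3 * G)
    have l4 := mul_le_mul_of_nonneg_left (habs _ _ ha4 hb4 ha1 hb1)
      (by positivity : 0 ≤ 3 * G)
    have hτ : 1 ≤ |Γ.tangent (Γ.R ε K.A1).2 0| + |Γ.tangent (Γ.R ε K.A1).2 1| := by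
      rw [← Γ.tangent_norm hr1.2]
      exact plane_norm_le_add _
    set τ₀ := |Γ.tangent (Γ.R ε K.A1).2 0|
    set τ₁ := |Γ.tangent (Γ.R ε K.A1).2 1|
    have hτ₀ : 0 ≤ τ₀ := abs_nonneg _
    have hτ₁ : 0 ≤ τ₁ := abs_nonneg _
    have hmin : min K.p K.q ≤ 6 * G * L := by
      have h1 : min K.p K.q * τ₀ ≤ K.p * τ₀ := mul_le_mul_of_nonneg_right (min_le_left _ _) hτ₀
      have h2 : min K.p K.q * τ₁ ≤ K.q * τ₁ := mul_le_mul_of_nonneg_right (min_le_right _ _) hτ₁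
      have h3 := mul_le_mul_of_nonneg_left hτ (le_min K.p_pos.le K.q_pos.le)
      linarith
    have hpq : K.p + K.q ≤ (1 + ρ) * min K.p K.q := by
      rcases min_cases K.p K.q with ⟨e, -⟩ | ⟨e, -⟩ <;> rw [e] <;> linarith [hK.1, hK.2]
    have hL0 : 0 ≤ L := by linarith
    calc K.h ≤ (1 + ρ) * min K.p K.q := K.h_le_add.trans hpq
      _ ≤ (1 + |ρ|) * (6 * G * L) := by
        rw [abs_of_pos hρ]
        exact mul_le_mul_of_nonneg_left hmin (by positivity)
      _ = ((1 + |ρ|) * (6 * G)) * L := by ring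
      _ ≤ _ := mul_le_mul_of_nonneg_right (le_max_left _ _) hL0
  · refine le_trans ?_ (mul_le_mul_of_nonneg_right (le_max_right ((1 + |ρ|) * (6 * G)) (3 / c₀)) hh.le)
    have m1 := K.A1_mem; have m2 := K.A2_mem; have m3 := K.A3_mem; have m4 := K.A4_mem
    rw [hL, sub_le_iff_le_add']
    simp only [frenetElement, max_le_iff, ← min_add_add_right, le_min_iff]
    exact ⟨⟨⟨⟨hup _ m1 _ m1, hup _ m2 _ m1⟩, hup _ m3 _ m1, hup _ m4 _ m1⟩,
      ⟨hup _ m1 _ m2, hup _ m2 _ m2⟩, hup _ m3 _ m2, hup _ m4 _ m2⟩,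
      ⟨⟨hup _ m1 _ m3, hup _ m2 _ m3⟩, hup _ m3 _ m3, hup _ m4 _ m3⟩,
      ⟨hup _ m1 _ m4, hup _ m2 _ m4⟩, hup _ m3 _ m4, hup _ m4 _ m4⟩

end InterfaceCurve

/-! ### Scaled estimates on half rectangles -/

/-- The sum of the squared `L²` norms of the classical derivatives of order `k`. -/
noncomputable def smoothSeminormSq (U : Set (ℝ × ℝ)) (k : ℕ) (v : ℝ × ℝ → ℝ) : ℝ :=
  ∑ x ∈ Finset.HasAntidiagonal.antidiagonal k, sqInt (volume.restrict U) (mixedDeriv x.1 x.2 v)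

theorem smooth_comp_affine {v : ℝ × ℝ → ℝ} (hv : ContDiff ℝ ∞ v) (b c a d : ℝ) :
    ContDiff ℝ ∞ fun p : ℝ × ℝ => v (b + c * p.1, a + d * p.2) :=
  hv.comp (by fun_prop)

section Scaling

variable {σ h a L B : ℝ}

theorem scale_ne_zero (hσ : σ ^ 2 = 1) (hh : 0 < h) : σ * h ≠ 0 := by
  refine mul_ne_zero ?_ hh.ne'
  rintro rfl
  norm_num at hσ

theorem abs_scale_pow (hσ : σ ^ 2 = 1) (hh : 0 < h) (k : ℕ) : |(σ * h) ^ k| = h ^ k := by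
  have : |σ| = 1 := by rw [← sq_eq_sq₀ (abs_nonneg _) zero_le_one, sq_abs, hσ, one_pow]
  rw [abs_pow, abs_mul, this, one_mul, abs_of_pos hh]

theorem sqInt_mixedDeriv_pullback (hσ : σ ^ 2 = 1) (hh : 0 < h) (hL : 0 < L) (a : ℝ)
    (v : ℝ × ℝ → ℝ) (i j : ℕ) :
    h * L * sqInt squareMeasure (mixedDeriv i j fun p => v (0 + σ * h * p.1, a + L * p.2)) =
      h ^ (2 * i) * L ^ (2 * j) *
        sqInt (volume.restrict (halfRect σ h a (a + L))) (mixedDeriv i j v) := by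
  rw [mixedDeriv_comp_affine, sqInt_const_mul, sqInt_halfRect_eq hσ hh hL]
  have e : ((σ * h) ^ i * L ^ j) ^ 2 = h ^ (2 * i) * L ^ (2 * j) := by
    rw [mul_pow, ← pow_mul, ← pow_mul, mul_comm i 2, mul_comm j 2, pow_mul (σ * h), mul_pow σ, hσ,
      one_mul, ← pow_mul]
  rw [e]
  ring

theorem squareSeminormSq_pullback_le (hσ : σ ^ 2 = 1) (hh : 0 < h) (hL : 0 < L) (hB : 1 ≤ B)
    (hLh : L ≤ B * h) (a : ℝ) (v : ℝ × ℝ → ℝ) (k : ℕ) :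
    h * L * squareSeminormSq k (fun p => v (0 + σ * h * p.1, a + L * p.2)) ≤
      B ^ (2 * k) * (h ^ (2 * k) * smoothSeminormSq (halfRect σ h a (a + L)) k v) := by
  rw [squareSeminormSq, smoothSeminormSq, Finset.mul_sum, Finset.mul_sum, Finset.mul_sum]
  refine Finset.sum_le_sum fun x hx => ?_
  rw [sqInt_mixedDeriv_pullback hσ hh hL, ← mul_assoc]
  refine mul_le_mul_of_nonneg_right ?_ sqInt_nonneg
  have hxk : x.1 + x.2 = k := Finset.HasAntidiagonal.mem_antidiagonal.1 hx
  calc h ^ (2 * x.1) * L ^ (2 * x.2) ≤ h ^ (2 * x.1) * (B * h) ^ (2 * x.2) := by gcongr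
    _ = B ^ (2 * x.2) * h ^ (2 * k) := by rw [mul_pow, ← hxk]; ring
    _ ≤ B ^ (2 * k) * h ^ (2 * k) := by
      gcongr
      omega

/-- With `q` the Bramble–Hilbert polynomial of `v`, the error splits as `φ - v = (φ - q) - (v - q)`:
the inverse estimate for polynomials applies to the first part. -/
theorem exists_square_inverse_estimate (m : ℕ) : ∃ C : ℝ, 0 ≤ C ∧ ∀ v : ℝ × ℝ → ℝ,
    ContDiff ℝ ∞ v → ∀ φ ∈ tensorPoly m, ∀ i j, i + j ≤ m + 1 →
    sqInt squareMeasure (mixedDeriv i j fun p => φ p - v p) ≤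
      C * (sqInt squareMeasure (fun p => φ p - v p) + squareSeminormSq (m + 1) v) := by
  obtain ⟨C₁, hC₁, hBH⟩ := exists_polynomial_approx m
  choose c hc hinv using exists_sqInt_mixedDeriv_le m
  set S := ∑ i ∈ Finset.range (m + 2), ∑ j ∈ Finset.range (m + 2), c i j with hS
  have hS0 : 0 ≤ S := Finset.sum_nonneg fun i _ => Finset.sum_nonneg fun j _ => hc i j
  have hcS : ∀ i j, i + j ≤ m + 1 → c i j ≤ S := by
    intro i j hij
    refine (Finset.single_le_sum (f := fun j => c i j) (fun j _ => hc i j)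
      (Finset.mem_range.2 (by omega : j < m + 2))).trans ?_
    exact Finset.single_le_sum (f := fun i => ∑ j ∈ Finset.range (m + 2), c i j)
      (fun i _ => Finset.sum_nonneg fun j _ => hc i j)
      (Finset.mem_range.2 (by omega : i < m + 2))
  refine ⟨4 * S + 4 * S * C₁ + 2 * C₁, by positivity, fun v hv φ hφ i j hij => ?_⟩
  obtain ⟨q, hq, hvq⟩ := hBH v hv
  have hφs := tensorPoly_smooth hφ
  have hqs := tensorPoly_smooth hq
  have h1 := hinv i j _ ((tensorPoly m).sub_mem hφ hq)
  have h2 := hvq i j hij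
  have h3 : sqInt squareMeasure (fun p => v p - q p) ≤ C₁ * squareSeminormSq (m + 1) v :=
    hvq 0 0 (by omega)
  have h4 := sqInt_add_le (μ := squareMeasure) (f := fun p => φ p - v p) (g := fun p => v p - q p)
    (memLp_square_of_smooth (hφs.sub hv)) (memLp_square_of_smooth (hv.sub hqs))
  have e4 : (fun p => φ p - v p + (v p - q p)) = φ - q := by
    funext p; simp
  rw [e4] at h4
  have h5 := sqInt_sub_le (μ := squareMeasure) (f := mixedDeriv i j (φ - q))
    (g := mixedDeriv i j fun p => v p - q p)
    (memLp_square_of_smooth (smooth_mixedDeriv (hφs.sub hqs) i j))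
    (memLp_square_of_smooth (smooth_mixedDeriv (hv.sub hqs) i j))
  have e5 : (fun p => mixedDeriv i j (φ - q) p - mixedDeriv i j (fun p => v p - q p) p) =
      mixedDeriv i j fun p => φ p - v p := by
    have := mixedDeriv_sub (hφs.sub hqs) (hv.sub hqs) i j
    refine Eq.trans (Eq.trans rfl this.symm) ?_
    congr 1
    funext p
    ring
  rw [e5] at h5
  have h6 : sqInt squareMeasure (mixedDeriv i j (φ - q)) ≤
      S * sqInt squareMeasure (φ - q) :=
    h1.trans (mul_le_mul_of_nonneg_right (hcS i j hij) sqInt_nonneg)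
  have h7 := mul_le_mul_of_nonneg_left h4 hS0
  have h8 := mul_le_mul_of_nonneg_left h3 hS0
  have n1 : 0 ≤ sqInt squareMeasure (fun p => φ p - v p) := sqInt_nonneg
  have n2 := squareSeminormSq_nonneg (k := m + 1) (v := v)
  nlinarith [mul_nonneg hC₁ n1, mul_nonneg (mul_nonneg hS0 hC₁) n1, mul_nonneg hS0 n2]

/-- The derivatives of the distance between a polynomial and a smooth function are controlled by
the distance in `L²` and the seminorm of top order. -/
theorem exists_inverse_estimate (m : ℕ) (hB : 1 ≤ B) : ∃ C : ℝ, 0 ≤ C ∧ ∀ σ h a L : ℝ, σ ^ 2 = 1 →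
    0 < h → 0 < L → h ≤ B * L → L ≤ B * h → ∀ v : ℝ × ℝ → ℝ, ContDiff ℝ ∞ v → ∀ φ ∈ tensorPoly m,
    ∀ i j, i + j ≤ m + 1 →
    h ^ (2 * (i + j)) *
        sqInt (volume.restrict (halfRect σ h a (a + L))) (mixedDeriv i j fun p => φ p - v p) ≤
      C * (sqInt (volume.restrict (halfRect σ h a (a + L))) (fun p => φ p - v p) +
        h ^ (2 * (m + 1)) * smoothSeminormSq (halfRect σ h a (a + L)) (m + 1) v) := by
  obtain ⟨C₀, hC₀, H⟩ := exists_square_inverse_estimate m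
  refine ⟨B ^ (2 * (m + 1)) * (C₀ * B ^ (2 * (m + 1))), by positivity, ?_⟩
  intro σ h a L hσ hh hL hhL hLh v hv φ hφ i j hij
  have hB0 : 0 < B := by linarith
  have hφ' : (fun p : ℝ × ℝ => φ (0 + σ * h * p.1, a + L * p.2)) ∈ tensorPoly m := by
    simpa only [zero_add] using tensorPoly_comp_affine hφ (σ * h) a L
  have h1 := mul_le_mul_of_nonneg_left (H _ (smooth_comp_affine hv 0 (σ * h) a L) _ hφ' i j hij)
    (mul_pos hh hL).le
  rw [sqInt_mixedDeriv_pullback hσ hh hL a (fun p => φ p - v p)] at h1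
  have h2 := squareSeminormSq_pullback_le (σ := σ) hσ hh hL hB hLh a v (m + 1)
  have h3 := sqInt_halfRect_eq hσ hh hL a (fun p => φ p - v p)
  set X := sqInt (volume.restrict (halfRect σ h a (a + L))) (mixedDeriv i j fun p => φ p - v p)
  set Y := sqInt (volume.restrict (halfRect σ h a (a + L))) (fun p => φ p - v p)
  set Z := h ^ (2 * (m + 1)) * smoothSeminormSq (halfRect σ h a (a + L)) (m + 1) v
  have hX : 0 ≤ X := sqInt_nonneg
  have hY : 0 ≤ Y := sqInt_nonneg
  have hp1 : 1 ≤ B ^ (2 * (m + 1)) := one_le_pow₀ hB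
  have h4 : h ^ (2 * i) * L ^ (2 * j) * X ≤ C₀ * (B ^ (2 * (m + 1)) * (Y + Z)) := by
    have e : h * L * (C₀ * (sqInt squareMeasure (fun p =>
        φ (0 + σ * h * p.1, a + L * p.2) - v (0 + σ * h * p.1, a + L * p.2)) +
        squareSeminormSq (m + 1) fun p => v (0 + σ * h * p.1, a + L * p.2))) =
        C₀ * (Y + h * L * squareSeminormSq (m + 1) fun p => v (0 + σ * h * p.1, a + L * p.2)) := by
      rw [h3]; ring
    rw [e] at h1
    refine h1.trans (mul_le_mul_of_nonneg_left ?_ hC₀)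
    nlinarith
  have h5 : h ^ (2 * (i + j)) ≤ B ^ (2 * (m + 1)) * (h ^ (2 * i) * L ^ (2 * j)) := by
    calc h ^ (2 * (i + j)) = h ^ (2 * i) * h ^ (2 * j) := by ring
      _ ≤ h ^ (2 * i) * (B * L) ^ (2 * j) := by gcongr
      _ = B ^ (2 * j) * (h ^ (2 * i) * L ^ (2 * j)) := by ring
      _ ≤ B ^ (2 * (m + 1)) * (h ^ (2 * i) * L ^ (2 * j)) := by
        gcongr
        omega
  calc h ^ (2 * (i + j)) * X ≤ B ^ (2 * (m + 1)) * (h ^ (2 * i) * L ^ (2 * j)) * X :=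
        mul_le_mul_of_nonneg_right h5 hX
    _ = B ^ (2 * (m + 1)) * (h ^ (2 * i) * L ^ (2 * j) * X) := by ring
    _ ≤ B ^ (2 * (m + 1)) * (C₀ * (B ^ (2 * (m + 1)) * (Y + Z))) :=
        mul_le_mul_of_nonneg_left h4 (by positivity)
    _ = _ := by ring

theorem L2Tendsto.tendsto_sqInt_self {X : Type*} [MeasurableSpace X] {μ : Measure X}
    {F : ℕ → X → ℝ} {f : X → ℝ} (hF : L2Tendsto μ F f) :
    Tendsto (fun n => sqInt μ (F n)) atTop (𝓝 (sqInt μ f)) := by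
  have h1 := tendsto_integral_mul_of_tendsto_sqInt hF.memLp_seq hF.memLp hF.memLp hF.tendsto
  have h2 := (hF.tendsto.add (h1.const_mul 2)).sub_const (sqInt μ f)
  have e : ∀ n, sqInt μ (fun x => F n x - f x) + 2 * ∫ x, F n x * f x ∂μ - sqInt μ f =
      sqInt μ (F n) := by
    intro n
    have i1 : Integrable (fun x => F n x * f x) μ := (hF.memLp_seq n).integrable_mul hF.memLp
    have i2 := (hF.memLp_seq n).integrable_sq
    have i3 := hF.memLp.integrable_sq
    have : ∀ x, (F n x - f x) ^ 2 = F n x ^ 2 - 2 * (F n x * f x) + f x ^ 2 := fun x => by ring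
    simp only [sqInt, this]
    have i4 : Integrable (fun x => F n x ^ 2 - 2 * (F n x * f x)) μ := i2.sub (i1.const_mul 2)
    rw [integral_add i4 i3, integral_sub i2 (i1.const_mul 2), integral_const_mul]
    ring
  simp only [e] at h2
  refine h2.trans (le_of_eq ?_)
  congr 1
  have : ∫ x, f x * f x ∂μ = sqInt μ f := by simp only [sqInt, sq]
  rw [this]
  ring

/-- The estimate of `exists_inverse_estimate` for Sobolev functions. -/
theorem exists_sobolev_inverse_estimate (m : ℕ) (hB : 1 ≤ B) : ∃ C : ℝ, 0 ≤ C ∧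
    ∀ σ h a L : ℝ, σ ^ 2 = 1 → 0 < h → 0 < L → h ≤ B * L → L ≤ B * h → ∀ u : ℝ × ℝ → ℝ,
    ∀ v : ℕ → ℝ × ℝ → ℝ, (∀ n, ContDiff ℝ ∞ (v n)) →
    (∀ i j, i + j ≤ m + 1 → L2Tendsto (volume.restrict (halfRect σ h a (a + L)))
      (fun n => mixedDeriv i j (v n)) (weakDeriv (halfRect σ h a (a + L)) i j u)) →
    weakDeriv (halfRect σ h a (a + L)) 0 0 u =ᵐ[volume.restrict (halfRect σ h a (a + L))] u →
    ∀ φ ∈ tensorPoly m, ∀ i j, i + j ≤ m + 1 →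
    h ^ (2 * (i + j)) * sqInt (volume.restrict (halfRect σ h a (a + L)))
        (fun p => mixedDeriv i j φ p - weakDeriv (halfRect σ h a (a + L)) i j u p) ≤
      C * (sqInt (volume.restrict (halfRect σ h a (a + L))) (fun p => φ p - u p) +
        h ^ (2 * (m + 1)) * ∑ x ∈ Finset.HasAntidiagonal.antidiagonal (m + 1),
          sqInt (volume.restrict (halfRect σ h a (a + L)))
            (weakDeriv (halfRect σ h a (a + L)) x.1 x.2 u)) := by
  obtain ⟨C, hC, H⟩ := exists_inverse_estimate (B := B) m hB
  refine ⟨C, hC, ?_⟩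
  intro σ h a L hσ hh hL hhL hLh u v hv hvu h00 φ hφ i j hij
  have hφs := tensorPoly_smooth hφ
  have hconst : ∀ i j, L2Tendsto (volume.restrict (halfRect σ h a (a + L)))
      (fun _ : ℕ => mixedDeriv i j φ) (mixedDeriv i j φ) := fun i j => by
    have := memLp_halfRect hσ (a := a) (b := a + L) (h := h)
      (smooth_mixedDeriv hφs i j).continuous.continuousOn
    exact ⟨fun _ => this, this, by simp [sqInt]⟩
  have t1 := ((hconst i j).sub (hvu i j hij)).tendsto_sqInt_self
  have t0 := ((hconst 0 0).sub ((hvu 0 0 (by omega)).congr_ae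
    (fun n => Filter.EventuallyEq.rfl) h00)).tendsto_sqInt_self
  have t2 : Tendsto (fun n => smoothSeminormSq (halfRect σ h a (a + L)) (m + 1) (v n)) atTop
      (𝓝 (∑ x ∈ Finset.HasAntidiagonal.antidiagonal (m + 1),
          sqInt (volume.restrict (halfRect σ h a (a + L)))
            (weakDeriv (halfRect σ h a (a + L)) x.1 x.2 u))) :=
    tendsto_finsetSum _ fun x hx => (hvu x.1 x.2
      (Finset.HasAntidiagonal.mem_antidiagonal.1 hx).le).tendsto_sqInt_self
  refine le_of_tendsto_of_tendsto' (t1.const_mul _)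
    ((t0.add (t2.const_mul (h ^ (2 * (m + 1))))).const_mul C) fun n => ?_
  have := H σ h a L hσ hh hL hhL hLh (v n) (hv n) φ hφ i j hij
  rw [mixedDeriv_sub hφs (hv n)] at this
  exact this

end Scaling

/-! ### Approximation by immersed polynomials on a fictitious element -/

namespace InterfaceCurve

variable {m : ℕ} (Γ : InterfaceCurve (m + 2))

/-- The normal data transported to the unit square by the affine map `(s, t) ↦ (σ h s, a + L t)`,
with the weight `(σ h)^k`. -/
noncomputable def scaledNormalData (σ h a L : ℝ) (k : ℕ) (w : ℝ × ℝ → ℝ) (t : ℝ) : ℝ :=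
  (σ * h) ^ k *
    Γ.normalData k (fun p => w (0 + (σ * h)⁻¹ * p.1, -(a / L) + L⁻¹ * p.2)) (a + L * t)

theorem affine_mem_I {a L : ℝ} (ha : a ∈ Γ.I) (hL : 0 < L) (hb : a + L ∈ Γ.I) {t : ℝ}
    (ht : t ∈ Icc (0 : ℝ) 1) : a + L * t ∈ Γ.I := by
  refine ⟨ha.1.trans ?_, le_trans ?_ hb.2⟩
  · nlinarith [ht.1]
  · nlinarith [ht.2]

theorem exists_isNormalData_scaled (hm : 1 ≤ m) {B : ℝ} (hB : 1 ≤ B) :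
    ∃ M : ℝ, ∀ σ h a L : ℝ, σ ^ 2 = 1 →
    0 < h → 0 < L → h ≤ B → h ≤ B * L → a ∈ Γ.I → a + L ∈ Γ.I →
    IsNormalData m M (Γ.scaledNormalData σ h a L) := by
  obtain ⟨M, hM, hbound⟩ := Γ.exists_normalData_bound hm
  refine ⟨M * B ^ m, ?_⟩
  intro σ h a L hσ hh hL hhB hhL ha hb
  have hc : σ * h ≠ 0 := scale_ne_zero hσ hh
  have hB0 : 0 < B := by linarith
  refine ⟨fun k hk v w hv hw t ht => ?_, fun k hk v hv => ?_, fun k hk v hv t ht => ?_⟩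
  · simp only [scaledNormalData]
    rw [Γ.normalData_add hm (smooth_comp_affine hv _ _ _ _) (smooth_comp_affine hw _ _ _ _) k
      (Γ.affine_mem_I ha hL hb ht), mul_add]
  · exact continuousOn_const.mul ((Γ.normalData_continuousOn hm
      (smooth_comp_affine hv _ _ _ _) k).comp (by fun_prop) fun t ht => Γ.affine_mem_I ha hL hb ht)
  · have hξ := Γ.affine_mem_I ha hL hb ht
    have h1 := hbound k hk _ (smooth_comp_affine hv 0 (σ * h)⁻¹ (-(a / L)) L⁻¹) _ hξ
    have e : ∀ i j, mixedDeriv i j (fun p => v (0 + (σ * h)⁻¹ * p.1, -(a / L) + L⁻¹ * p.2))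
        (0, a + L * t) = ((σ * h)⁻¹) ^ i * L⁻¹ ^ j * mixedDeriv i j v (0, t) := by
      intro i j
      rw [mixedDeriv_comp_affine]
      simp only [mul_zero, add_zero]
      congr 3
      field_simp
      ring
    simp only [e] at h1
    have h2 := mul_le_mul_of_nonneg_left h1 (abs_nonneg ((σ * h) ^ k))
    rw [← abs_mul, mul_sub] at h2
    have e2 : (σ * h) ^ k * (((σ * h)⁻¹) ^ k * L⁻¹ ^ 0 * mixedDeriv k 0 v (0, t)) =
        mixedDeriv k 0 v (0, t) := by
      rw [pow_zero, mul_one, inv_pow, mul_inv_cancel_left₀ (pow_ne_zero k hc)]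
    rw [e2] at h2
    refine h2.trans ?_
    rw [mul_left_comm, mul_assoc M]
    refine mul_le_mul_of_nonneg_left ?_ hM
    rw [Finset.mul_sum, Finset.mul_sum]
    refine Finset.sum_le_sum fun x hx => ?_
    obtain ⟨hx1, hx2⟩ := mem_lowerOrder.1 hx
    rw [abs_mul, ← mul_assoc]
    refine mul_le_mul_of_nonneg_right ?_ (abs_nonneg _)
    obtain ⟨d, rfl⟩ := Nat.exists_eq_add_of_le hx2
    rw [abs_mul, inv_pow, abs_inv, abs_scale_pow hσ hh, abs_scale_pow hσ hh, abs_of_pos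
      (by positivity : 0 < L⁻¹ ^ x.2)]
    calc h ^ (x.1 + x.2 + d) * ((h ^ x.1)⁻¹ * L⁻¹ ^ x.2) = (h / L) ^ x.2 * h ^ d := by
          rw [div_pow, inv_pow, pow_add, pow_add]
          field_simp
      _ ≤ B ^ x.2 * B ^ d := by
          have : h / L ≤ B := by rwa [div_le_iff₀ hL]
          gcongr
      _ = B ^ (x.2 + d) := (pow_add _ _ _).symm
      _ ≤ B ^ m := pow_le_pow_right₀ hB (by omega)

/-- Simultaneous approximation on the two halves of a fictitious element by polynomials whose
weighted normal data agree in the weak sense. -/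
theorem exists_immersed_approx (hm : 1 ≤ m) {B : ℝ} (hB : 1 ≤ B) :
    ∃ C : ℝ, 0 ≤ C ∧ ∀ σ₁ σ₂ h a L : ℝ, σ₁ ^ 2 = 1 → σ₂ ^ 2 = 1 →
    0 < h → 0 < L → h ≤ B → h ≤ B * L → L ≤ B * h → a ∈ Γ.I → a + L ∈ Γ.I →
    ∀ γ₁ γ₂ : ℕ → ℝ, (∀ k, 0 < γ₁ k) → (∀ k, |γ₂ k| ≤ γ₁ k) →
    ∀ v₁ v₂ : ℝ × ℝ → ℝ, ContDiff ℝ ∞ v₁ → ContDiff ℝ ∞ v₂ →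
    ∃ φ₁ ∈ tensorPoly m, ∃ φ₂ ∈ tensorPoly m,
      (∀ k ≤ m, ∀ R : Polynomial ℝ, R.natDegree ≤ m →
        ∫ ξ in Ioo a (a + L), (γ₁ k * Γ.normalData k φ₁ ξ - γ₂ k * Γ.normalData k φ₂ ξ) *
          R.eval ξ = 0) ∧
      sqInt (volume.restrict (halfRect σ₁ h a (a + L))) (fun p => φ₁ p - v₁ p) +
        sqInt (volume.restrict (halfRect σ₂ h a (a + L))) (fun p => φ₂ p - v₂ p) ≤
      C * (h ^ (2 * (m + 1)) * (smoothSeminormSq (halfRect σ₁ h a (a + L)) (m + 1) v₁ +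
          smoothSeminormSq (halfRect σ₂ h a (a + L)) (m + 1) v₂) +
        ∑ k ∈ Finset.range (m + 1), h * (h ^ k / γ₁ k) ^ 2 *
          sqInt (volume.restrict (Ioo a (a + L)))
            (fun ξ => γ₁ k * Γ.normalData k v₁ ξ - γ₂ k * Γ.normalData k v₂ ξ)) := by
  obtain ⟨M, hM⟩ := Γ.exists_isNormalData_scaled hm hB
  obtain ⟨C₀, hC₀, H⟩ := exists_interface_approx m M
  have hp1 : 1 ≤ B ^ (2 * (m + 1)) := one_le_pow₀ hB
  refine ⟨C₀ * B ^ (2 * (m + 1)), by positivity, ?_⟩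
  intro σ₁ σ₂ h a L hσ₁ hσ₂ hh hL hhB hhL hLh ha hb γ₁ γ₂ hγ₁ hγ₂ v₁ v₂ hv₁ hv₂
  have hr : ∀ k, |γ₂ k / γ₁ k * (σ₁ * σ₂) ^ k| ≤ 1 := by
    intro k
    have h1 : |σ₁ * σ₂| = 1 := by
      rw [← sq_eq_sq₀ (abs_nonneg _) zero_le_one, sq_abs, mul_pow, hσ₁, hσ₂, one_mul, one_pow]
    rw [abs_mul, abs_pow, h1, one_pow, mul_one, abs_div, abs_of_pos (hγ₁ k)]
    exact div_le_one_of_le₀ (hγ₂ k) (hγ₁ k).le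
  have hjump : ∀ k x y, (σ₁ * h) ^ k * x - γ₂ k / γ₁ k * (σ₁ * σ₂) ^ k * ((σ₂ * h) ^ k * y) =
      (σ₁ * h) ^ k / γ₁ k * (γ₁ k * x - γ₂ k * y) := by
    intro k x y
    have hne := (hγ₁ k).ne'
    have e : (σ₁ * σ₂) ^ k * (σ₂ * h) ^ k = (σ₁ * h) ^ k := by
      rw [← mul_pow]
      congr 1
      linear_combination σ₁ * h * hσ₂
    calc _ = (σ₁ * h) ^ k * x - γ₂ k / γ₁ k * ((σ₁ * σ₂) ^ k * (σ₂ * h) ^ k) * y := by ring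
      _ = _ := by rw [e]; field_simp
  have hpull : ∀ σ : ℝ, σ ^ 2 = 1 → ∀ (w : ℝ × ℝ → ℝ) (p : ℝ × ℝ),
      w (0 + (σ * h)⁻¹ * (0 + σ * h * p.1), -(a / L) + L⁻¹ * (a + L * p.2)) = w p := by
    intro σ hσ w p
    have hc := scale_ne_zero hσ hh
    congr 1
    refine Prod.ext ?_ ?_
    · simp only [zero_add]
      rw [inv_mul_cancel_left₀ hc]
    · simp only
      field_simp
      ring
  have hpush : ∀ σ : ℝ, σ ^ 2 = 1 → ∀ w : ℝ × ℝ → ℝ, (fun p : ℝ × ℝ =>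
      w (0 + σ * h * (0 + (σ * h)⁻¹ * p.1), a + L * (-(a / L) + L⁻¹ * p.2))) = w := by
    intro σ hσ w
    have hc := scale_ne_zero hσ hh
    funext p
    congr 1
    refine Prod.ext ?_ ?_
    · simp only [zero_add]
      rw [mul_inv_cancel_left₀ hc]
    · simp only
      field_simp
      ring
  obtain ⟨φ₁, hφ₁, φ₂, hφ₂, hortho, hest⟩ := H _ _
    (hM σ₁ h a L hσ₁ hh hL hhB hhL ha hb) (hM σ₂ h a L hσ₂ hh hL hhB hhL ha hb) _ hr _ _
    (smooth_comp_affine hv₁ 0 (σ₁ * h) a L) (smooth_comp_affine hv₂ 0 (σ₂ * h) a L)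
  have hback : ∀ (σ : ℝ) (φ : ℝ × ℝ → ℝ), φ ∈ tensorPoly m →
      (fun p : ℝ × ℝ => φ (0 + (σ * h)⁻¹ * p.1, -(a / L) + L⁻¹ * p.2)) ∈ tensorPoly m := by
    intro σ φ hφ
    simpa only [zero_add] using tensorPoly_comp_affine hφ (σ * h)⁻¹ (-(a / L)) L⁻¹
  refine ⟨_, hback σ₁ φ₁ hφ₁, _, hback σ₂ φ₂ hφ₂, fun k hk R hR => ?_, ?_⟩
  · have hdeg : (R.comp (Polynomial.C L * Polynomial.X + Polynomial.C a)).natDegree ≤ m := by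
      refine Polynomial.natDegree_comp_le.trans ?_
      calc _ ≤ m * 1 := Nat.mul_le_mul hR Polynomial.natDegree_linear_le
        _ = m := mul_one m
    have h1 := hortho k hk _ hdeg
    simp only [scaledNormalData, hjump] at h1
    simp only [mul_assoc ((σ₁ * h) ^ k / γ₁ k), integral_const_mul] at h1
    rw [setIntegral_Ioo_eq hL]
    have hne : (σ₁ * h) ^ k / γ₁ k ≠ 0 :=
      div_ne_zero (pow_ne_zero k (scale_ne_zero hσ₁ hh)) (hγ₁ k).ne'
    refine mul_eq_zero_of_right _ (Eq.trans ?_ ((mul_eq_zero.1 h1).resolve_left hne))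
    refine integral_congr_ae (ae_of_all _ fun t => ?_)
    simp [add_comm]
  · have h1 := mul_le_mul_of_nonneg_left hest (mul_pos hh hL).le
    rw [sqInt_halfRect_eq hσ₁ hh hL, sqInt_halfRect_eq hσ₂ hh hL]
    simp only [hpull σ₁ hσ₁ φ₁, hpull σ₂ hσ₂ φ₂]
    rw [← mul_add]
    refine h1.trans ?_
    have b1 := squareSeminormSq_pullback_le (σ := σ₁) hσ₁ hh hL hB hLh a v₁ (m + 1)
    have b2 := squareSeminormSq_pullback_le (σ := σ₂) hσ₂ hh hL hB hLh a v₂ (m + 1)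
    have b3 : h * L * ∑ k ∈ Finset.range (m + 1), sqInt unitMeasure (fun t =>
        Γ.scaledNormalData σ₁ h a L k (fun p => v₁ (0 + σ₁ * h * p.1, a + L * p.2)) t -
        γ₂ k / γ₁ k * (σ₁ * σ₂) ^ k *
          Γ.scaledNormalData σ₂ h a L k (fun p => v₂ (0 + σ₂ * h * p.1, a + L * p.2)) t) =
        ∑ k ∈ Finset.range (m + 1), h * (h ^ k / γ₁ k) ^ 2 *
          sqInt (volume.restrict (Ioo a (a + L)))
            (fun ξ => γ₁ k * Γ.normalData k v₁ ξ - γ₂ k * Γ.normalData k v₂ ξ) := by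
      rw [Finset.mul_sum]
      refine Finset.sum_congr rfl fun k _ => ?_
      simp only [scaledNormalData, hpush σ₁ hσ₁ v₁, hpush σ₂ hσ₂ v₂, hjump]
      rw [sqInt_const_mul, sqInt_Ioo_eq hL]
      have e : ((σ₁ * h) ^ k / γ₁ k) ^ 2 = (h ^ k / γ₁ k) ^ 2 := by
        rw [div_pow, div_pow, ← sq_abs ((σ₁ * h) ^ k), abs_scale_pow hσ₁ hh]
      rw [e]
      ring
    set J := ∑ k ∈ Finset.range (m + 1), h * (h ^ k / γ₁ k) ^ 2 *
          sqInt (volume.restrict (Ioo a (a + L)))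
            (fun ξ => γ₁ k * Γ.normalData k v₁ ξ - γ₂ k * Γ.normalData k v₂ ξ) with hJ
    have hJ0 : 0 ≤ J := Finset.sum_nonneg fun k _ => by
      have := sqInt_nonneg (μ := volume.restrict (Ioo a (a + L)))
        (f := fun ξ => γ₁ k * Γ.normalData k v₁ ξ - γ₂ k * Γ.normalData k v₂ ξ)
      positivity
    rw [mul_left_comm, mul_add (h * L), mul_add (h * L), b3, mul_assoc C₀]
    refine mul_le_mul_of_nonneg_left ?_ hC₀
    nlinarith

end InterfaceCurve

/-! ### The `L²` projection onto the immersed finite element space -/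

theorem memLp_two_add_measure {X : Type*} [MeasurableSpace X] {μ ν : Measure X} {f : X → ℝ}
    (h : MemLp f 2 μ) (h' : MemLp f 2 ν) : MemLp f 2 (μ + ν) :=
  (memLp_two_iff_integrable_sq (h.1.add_measure h'.1)).2
    (h.integrable_sq.add_measure h'.integrable_sq)

theorem sqInt_add_measure {X : Type*} [MeasurableSpace X] {μ ν : Measure X} {f : X → ℝ}
    (h : MemLp f 2 μ) (h' : MemLp f 2 ν) : sqInt (μ + ν) f = sqInt μ f + sqInt ν f :=
  integral_add_measure h.integrable_sq h'.integrable_sq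

section Projection

variable {X E : Type*} [MeasurableSpace X] {μ : Measure X} [AddCommGroup E] [Module ℝ E]
  {A : E →ₗ[ℝ] (X → ℝ)} {u : X → ℝ}

/-- Two `L²` projections of the same function agree. -/
theorem l2_projection_unique (hA : ∀ e, MemLp (A e) 2 μ) (hu : MemLp u 2 μ) {e e' : E}
    (he : ∀ d, ∫ x, (A e x - u x) * A d x ∂μ = 0) (he' : ∀ d, ∫ x, (A e' x - u x) * A d x ∂μ = 0) :
    A (e' - e) =ᵐ[μ] 0 := by
  refine (sqInt_eq_zero_iff (hA (e' - e))).1 ?_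
  have h3 := integral_sub (((hA e').sub hu).integrable_mul (hA (e' - e)))
    (((hA e).sub hu).integrable_mul (hA (e' - e)))
  simp only [Pi.mul_apply, Pi.sub_apply] at h3
  rw [he', he, sub_zero] at h3
  refine Eq.trans (integral_congr_ae (ae_of_all _ fun x => ?_)) h3
  simp only [map_sub, Pi.sub_apply]
  ring

/-- The `L²` projection is the best approximation. -/
theorem l2_projection_le (hA : ∀ e, MemLp (A e) 2 μ) (hu : MemLp u 2 μ) {e : E}
    (he : ∀ d, ∫ x, (A e x - u x) * A d x ∂μ = 0) (e' : E) :
    sqInt μ (fun x => A e x - u x) ≤ sqInt μ (fun x => A e' x - u x) := by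
  have i1 : Integrable (fun x => (A e x - u x) ^ 2) μ := ((hA e).sub hu).integrable_sq
  have i2 : Integrable (fun x => A (e' - e) x ^ 2) μ := (hA (e' - e)).integrable_sq
  have i3 : Integrable (fun x => (A e x - u x) * A (e' - e) x) μ :=
    ((hA e).sub hu).integrable_mul (hA (e' - e))
  have h6 : ∀ x, (A e' x - u x) ^ 2 = (A e x - u x) ^ 2 + A (e' - e) x ^ 2 +
      2 * ((A e x - u x) * A (e' - e) x) := fun x => by
    simp only [map_sub, Pi.sub_apply]; ring
  have i4 : Integrable (fun x => (A e x - u x) ^ 2 + A (e' - e) x ^ 2) μ := i1.add i2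
  have h5 : sqInt μ (fun x => A e' x - u x) =
      sqInt μ (fun x => A e x - u x) + sqInt μ (A (e' - e)) := by
    simp only [sqInt, h6]
    rw [integral_add i4 (i3.const_mul 2), integral_add i1 i2, integral_const_mul, he, mul_zero,
      add_zero]
  rw [h5]
  exact le_add_of_nonneg_right sqInt_nonneg

end Projection

/-- Up to a null set, a Frenet rectangle consists of its two open halves. -/
theorem FrenetRect.restrict_full (F : FrenetRect) (hh : 0 ≤ F.h) :
    volume.restrict F.full = volume.restrict F.minus + volume.restrict F.plus := by
  have e : Icc (-F.h) F.h =ᵐ[volume] (Ioc (-F.h) 0 ∪ Ioc 0 F.h : Set ℝ) := by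
    rw [Ioc_union_Ioc_eq_Ioc (neg_nonpos.2 hh) hh]
    exact Ioc_ae_eq_Icc.symm
  have e1 : (volume : Measure ℝ).restrict (Icc (-F.h) F.h) =
      volume.restrict (Ioo (-F.h) 0) + volume.restrict (Ioo 0 F.h) := by
    rw [Measure.restrict_congr_set e, Measure.restrict_union
      (Set.disjoint_left.2 fun x hx hx' => not_lt.2 hx.2 hx'.1) measurableSet_Ioc,
      Measure.restrict_congr_set (Ioo_ae_eq_Ioc (a := -F.h) (b := (0 : ℝ))),
      Measure.restrict_congr_set (Ioo_ae_eq_Ioc (a := (0 : ℝ)) (b := F.h))]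
  have e2 : (volume : Measure ℝ).restrict (Icc F.a F.b) = volume.restrict (Ioo F.a F.b) :=
    (Measure.restrict_congr_set Ioo_ae_eq_Icc).symm
  rw [full, minus, plus, Measure.volume_eq_prod, ← Measure.prod_restrict, ← Measure.prod_restrict,
    ← Measure.prod_restrict, e1, e2, Measure.add_prod]

/-- The weight of the jump of the `k`-th normal datum: the function itself is not weighted. -/
noncomputable def jumpWeight (β : ℝ) (k : ℕ) : ℝ := if k = 0 then 1 else β

theorem jumpWeight_pos {β : ℝ} (hβ : 0 < β) (k : ℕ) : 0 < jumpWeight β k := by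
  unfold jumpWeight; split_ifs <;> simp [hβ]

theorem jumpWeight_mono {β β' : ℝ} (h : β ≤ β') (k : ℕ) : jumpWeight β k ≤ jumpWeight β' k := by
  unfold jumpWeight; split_ifs <;> simp [h]

/-- The function equal to `φm` for `η < 0` and to `φp` for `η ≥ 0`. -/
noncomputable def glue (φm φp : ℝ × ℝ → ℝ) (p : ℝ × ℝ) : ℝ := if p.1 < 0 then φm p else φp p

theorem glue_of_mem_minus {F : FrenetRect} (φm φp : ℝ × ℝ → ℝ) {p : ℝ × ℝ} (hp : p ∈ F.minus) :
    glue φm φp p = φm p := if_pos hp.1.2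

theorem glue_of_mem_plus {F : FrenetRect} (φm φp : ℝ × ℝ → ℝ) {p : ℝ × ℝ} (hp : p ∈ F.plus) :
    glue φm φp p = φp p := if_neg hp.1.1.le.not_gt

theorem FrenetRect.isOpen_plus (F : FrenetRect) : IsOpen F.plus := isOpen_Ioo.prod isOpen_Ioo

theorem FrenetRect.isOpen_minus (F : FrenetRect) : IsOpen F.minus := isOpen_Ioo.prod isOpen_Ioo

theorem glue_ae_minus (F : FrenetRect) (φm φp : ℝ × ℝ → ℝ) :
    glue φm φp =ᵐ[volume.restrict F.minus] φm :=
  (ae_restrict_iff' F.isOpen_minus.measurableSet).2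
    (ae_of_all _ fun _ hp => glue_of_mem_minus φm φp hp)

theorem glue_ae_plus (F : FrenetRect) (φm φp : ℝ × ℝ → ℝ) :
    glue φm φp =ᵐ[volume.restrict F.plus] φp :=
  (ae_restrict_iff' F.isOpen_plus.measurableSet).2
    (ae_of_all _ fun _ hp => glue_of_mem_plus φm φp hp)

theorem memLp_minus (F : FrenetRect) {v : ℝ × ℝ → ℝ} (hv : Continuous v) :
    MemLp v 2 (volume.restrict F.minus) := by
  rw [F.minus_eq]
  exact memLp_halfRect (by norm_num) hv.continuousOn

theorem memLp_plus (F : FrenetRect) {v : ℝ × ℝ → ℝ} (hv : Continuous v) :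
    MemLp v 2 (volume.restrict F.plus) := by
  rw [F.plus_eq]
  exact memLp_halfRect (by norm_num) hv.continuousOn

/-- Gluing of two polynomials, as a linear map. -/
noncomputable def glueLinear (m : ℕ) : (tensorPoly m × tensorPoly m) →ₗ[ℝ] (ℝ × ℝ → ℝ) where
  toFun e := glue e.1 e.2
  map_add' e e' := by
    funext p
    by_cases hp : p.1 < 0 <;> simp [glue, hp]
  map_smul' c e := by
    funext p
    by_cases hp : p.1 < 0 <;> simp [glue, hp]

theorem memLp_glue {F : FrenetRect} (hh : 0 ≤ F.h) {φm φp : ℝ × ℝ → ℝ} (hm : Continuous φm)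
    (hp : Continuous φp) : MemLp (glue φm φp) 2 (volume.restrict F.full) := by
  rw [F.restrict_full hh]
  exact memLp_two_add_measure ((memLp_minus F hm).ae_eq (glue_ae_minus F φm φp).symm)
    ((memLp_plus F hp).ae_eq (glue_ae_plus F φm φp).symm)

theorem sqInt_glue_sub {F : FrenetRect} (hh : 0 ≤ F.h) {φm φp u : ℝ × ℝ → ℝ} (hm : Continuous φm)
    (hp : Continuous φp) (hum : MemLp u 2 (volume.restrict F.minus))
    (hup : MemLp u 2 (volume.restrict F.plus)) :
    sqInt (volume.restrict F.full) (fun p => glue φm φp p - u p) =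
      sqInt (volume.restrict F.minus) (fun p => φm p - u p) +
        sqInt (volume.restrict F.plus) (fun p => φp p - u p) := by
  have em : (fun p => glue φm φp p - u p) =ᵐ[volume.restrict F.minus] fun p => φm p - u p :=
    (glue_ae_minus F φm φp).mono fun p hp => by simp only [hp]
  have ep : (fun p => glue φm φp p - u p) =ᵐ[volume.restrict F.plus] fun p => φp p - u p :=
    (glue_ae_plus F φm φp).mono fun p hp => by simp only [hp]
  rw [F.restrict_full hh, sqInt_add_measure (((memLp_minus F hm).sub hum).ae_eq em.symm)
    (((memLp_plus F hp).sub hup).ae_eq ep.symm), sqInt_congr em, sqInt_congr ep]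

namespace InterfaceCurve

variable {m : ℕ} (Γ : InterfaceCurve (m + 2))

theorem weakJumps_iff (hm : 1 ≤ m) {F : FrenetRect} (hab : F.a ≤ F.b) {βm βp : ℝ}
    {φm φp : ℝ × ℝ → ℝ} : Γ.WeakJumps m F βm βp φm φp ↔
    ∀ k ≤ m, ∀ R : Polynomial ℝ, R.natDegree ≤ m →
      ∫ ξ in Ioo F.a F.b, (jumpWeight βp k * Γ.normalData k φp ξ -
        jumpWeight βm k * Γ.normalData k φm ξ) * R.eval ξ = 0 := by
  simp only [WeakJumps, intervalIntegral.integral_of_le hab, integral_Ioc_eq_integral_Ioo]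
  constructor
  · intro H k hk R hR
    match k, hk with
    | 0, _ => simpa [jumpWeight, normalData] using (H R hR).1
    | 1, _ => simpa [jumpWeight, normalData] using (H R hR).2.1
    | j + 2, hk => simpa [jumpWeight, normalData] using (H R hR).2.2 j hk
  · intro H R hR
    refine ⟨?_, ?_, fun j hj => ?_⟩
    · simpa [jumpWeight, normalData] using H 0 (Nat.zero_le m) R hR
    · simpa [jumpWeight, normalData] using H 1 hm R hR
    · simpa [jumpWeight, normalData] using H (j + 2) hj R hR

theorem integrableOn_jump (hm : 1 ≤ m) {a b : ℝ} (hI : Icc a b ⊆ Γ.I) (γm γp : ℝ)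
    {φm φp : ℝ × ℝ → ℝ} (hφm : ContDiff ℝ ∞ φm) (hφp : ContDiff ℝ ∞ φp) (k : ℕ)
    (R : Polynomial ℝ) :
    IntegrableOn (fun ξ => (γp * Γ.normalData k φp ξ - γm * Γ.normalData k φm ξ) * R.eval ξ)
      (Ioo a b) := by
  have hc : ContinuousOn
      (fun ξ => (γp * Γ.normalData k φp ξ - γm * Γ.normalData k φm ξ) * R.eval ξ) (Icc a b) :=
    ((continuousOn_const.mul ((Γ.normalData_continuousOn hm hφp k).mono hI)).sub
      (continuousOn_const.mul ((Γ.normalData_continuousOn hm hφm k).mono hI))).mul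
      R.continuous.continuousOn
  exact (hc.integrableOn_compact isCompact_Icc).mono_set Ioo_subset_Icc_self

/-- The pairs of polynomials that satisfy the weak jump conditions. -/
noncomputable def immersedPairs (hm : 1 ≤ m) (F : FrenetRect) (hab : F.a ≤ F.b)
    (hI : Icc F.a F.b ⊆ Γ.I) (βm βp : ℝ) : Submodule ℝ (tensorPoly m × tensorPoly m) where
  carrier := {e | Γ.WeakJumps m F βm βp e.1 e.2}
  zero_mem' := by
    refine (Γ.weakJumps_iff hm hab).2 fun k hk R hR => ?_
    refine (setIntegral_congr_fun measurableSet_Ioo fun ξ hξ => ?_).trans (integral_zero _ _)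
    have h0 : Γ.normalData k (fun _ => 0 * 0) ξ = 0 * Γ.normalData k (fun _ => 0) ξ :=
      Γ.normalData_const_mul hm contDiff_const 0 k (hI (Ioo_subset_Icc_self hξ))
    rw [mul_zero, zero_mul] at h0
    have h1 : Γ.normalData k (((0 : tensorPoly m × tensorPoly m).1 : ℝ × ℝ → ℝ)) ξ = 0 := h0
    have h2 : Γ.normalData k (((0 : tensorPoly m × tensorPoly m).2 : ℝ × ℝ → ℝ)) ξ = 0 := h0
    simp only [h1, h2]
    ring
  add_mem' := by
    intro e e' he he'
    have hs : ∀ q : tensorPoly m, ContDiff ℝ ∞ (q : ℝ × ℝ → ℝ) := fun q => tensorPoly_smooth q.2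
    have H := (Γ.weakJumps_iff hm hab).1 he
    have H' := (Γ.weakJumps_iff hm hab).1 he'
    refine (Γ.weakJumps_iff hm hab).2 fun k hk R hR => ?_
    have h := integral_add (Γ.integrableOn_jump hm hI (jumpWeight βm k) (jumpWeight βp k)
      (hs e.1) (hs e.2) k R) (Γ.integrableOn_jump hm hI (jumpWeight βm k) (jumpWeight βp k)
      (hs e'.1) (hs e'.2) k R)
    rw [H k hk R hR, H' k hk R hR, add_zero] at h
    refine (setIntegral_congr_fun measurableSet_Ioo fun ξ hξ => ?_).trans h
    have hξ' := hI (Ioo_subset_Icc_self hξ)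
    have h1 : Γ.normalData k (((e + e').1 : tensorPoly m) : ℝ × ℝ → ℝ) ξ =
      Γ.normalData k e.1 ξ + Γ.normalData k e'.1 ξ := Γ.normalData_add hm (hs _) (hs _) k hξ'
    have h2 : Γ.normalData k (((e + e').2 : tensorPoly m) : ℝ × ℝ → ℝ) ξ =
      Γ.normalData k e.2 ξ + Γ.normalData k e'.2 ξ := Γ.normalData_add hm (hs _) (hs _) k hξ'
    simp only [h1, h2]
    ring
  smul_mem' := by
    intro c e he
    have hs : ∀ q : tensorPoly m, ContDiff ℝ ∞ (q : ℝ × ℝ → ℝ) := fun q => tensorPoly_smooth q.2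
    have H := (Γ.weakJumps_iff hm hab).1 he
    refine (Γ.weakJumps_iff hm hab).2 fun k hk R hR => ?_
    have h : ∫ ξ in Ioo F.a F.b, c * ((jumpWeight βp k * Γ.normalData k e.2 ξ -
        jumpWeight βm k * Γ.normalData k e.1 ξ) * R.eval ξ) = 0 := by
      rw [integral_const_mul, H k hk R hR, mul_zero]
    refine (setIntegral_congr_fun measurableSet_Ioo fun ξ hξ => ?_).trans h
    have hξ' := hI (Ioo_subset_Icc_self hξ)
    have h1 : Γ.normalData k (((c • e).1 : tensorPoly m) : ℝ × ℝ → ℝ) ξ =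
      c * Γ.normalData k e.1 ξ := Γ.normalData_const_mul hm (hs _) c k hξ'
    have h2 : Γ.normalData k (((c • e).2 : tensorPoly m) : ℝ × ℝ → ℝ) ξ =
      c * Γ.normalData k e.2 ξ := Γ.normalData_const_mul hm (hs _) c k hξ'
    simp only [h1, h2]
    ring

/-- Existence, uniqueness and optimality of the `L²` projection. -/
theorem exists_isL2Projection (hm : 1 ≤ m) (F : FrenetRect) (hh : 0 < F.h) (hab : F.a < F.b)
    (hI : Icc F.a F.b ⊆ Γ.I) (βm βp : ℝ) {u : ℝ × ℝ → ℝ}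
    (hum : MemLp u 2 (volume.restrict F.minus)) (hup : MemLp u 2 (volume.restrict F.plus)) :
    ∃ φm ∈ tensorPoly m, ∃ φp ∈ tensorPoly m,
      Γ.IsL2Projection m F βm βp u (glue φm φp) ∧
      (∀ w', Γ.IsL2Projection m F βm βp u w' → EqOn w' (glue φm φp) F.full) ∧
      ∀ ψm ∈ tensorPoly m, ∀ ψp ∈ tensorPoly m, Γ.WeakJumps m F βm βp ψm ψp →
        sqInt (volume.restrict F.minus) (fun p => φm p - u p) +
          sqInt (volume.restrict F.plus) (fun p => φp p - u p) ≤
        sqInt (volume.restrict F.minus) (fun p => ψm p - u p) +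
          sqInt (volume.restrict F.plus) (fun p => ψp p - u p) := by
  obtain ⟨S, hS⟩ : ∃ S : Submodule ℝ (tensorPoly m × tensorPoly m),
      ∀ e, e ∈ S ↔ Γ.WeakJumps m F βm βp e.1 e.2 :=
    ⟨Γ.immersedPairs hm F hab.le hI βm βp, fun _ => Iff.rfl⟩
  obtain ⟨A, hAe⟩ : ∃ A : S →ₗ[ℝ] (ℝ × ℝ → ℝ), ∀ e, A e = glue e.1.1 e.1.2 :=
    ⟨(glueLinear m).comp S.subtype, fun _ => rfl⟩
  have hc : ∀ q : tensorPoly m, Continuous (q : ℝ × ℝ → ℝ) := fun q =>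
    (tensorPoly_smooth q.2).continuous
  have hA : ∀ e, MemLp (A e) 2 (volume.restrict F.full) := fun e => by
    rw [hAe]
    exact memLp_glue hh.le (hc e.1.1) (hc e.1.2)
  have hu : MemLp u 2 (volume.restrict F.full) := by
    rw [F.restrict_full hh.le]
    exact memLp_two_add_measure hum hup
  obtain ⟨e, he⟩ := exists_l2_projection (E := S) A hA hu
  have hmeas : MeasurableSet F.full := measurableSet_Icc.prod measurableSet_Icc
  have hmem : ∀ e, A e ∈ Γ.ifeSpace m F βm βp := fun e => by
    rw [hAe]
    exact ⟨e.1.1, e.1.1.2, e.1.2, e.1.2.2, fun p _ hp => if_pos hp,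
      fun p _ hp => if_neg hp.not_gt, (hS _).1 e.2⟩
  have hrep : ∀ v ∈ Γ.ifeSpace m F βm βp, ∃ e', EqOn v (A e') F.full := by
    rintro v ⟨vm, hvm, vp, hvp, h1, h2, h3⟩
    refine ⟨⟨(⟨vm, hvm⟩, ⟨vp, hvp⟩), (hS _).2 h3⟩, fun p hp => ?_⟩
    rw [hAe]
    rcases lt_or_ge p.1 0 with hlt | hge
    · exact (h1 p hp hlt).trans (if_pos hlt).symm
    · exact (h2 p hp hge).trans (if_neg hge.not_gt).symm
  refine ⟨e.1.1, e.1.1.2, e.1.2, e.1.2.2, ?_⟩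
  rw [← hAe e]
  refine ⟨⟨hmem e, fun v hv => ?_⟩, fun w' hw' => ?_, ?_⟩
  · obtain ⟨e', he'⟩ := hrep v hv
    refine (setIntegral_congr_fun hmeas fun p hp => ?_).trans (he e')
    simp only [he' hp]
  · obtain ⟨e', he'⟩ := hrep w' hw'.1
    have h1 : ∀ d, ∫ p in F.full, (A e' p - u p) * A d p = 0 := fun d => by
      refine (setIntegral_congr_fun hmeas fun p hp => ?_).trans (hw'.2 (A d) (hmem d))
      simp only [he' hp]
    have h4 := l2_projection_unique (E := S) (A := A) hA hu he h1
    rw [hAe] at h4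
    have hle1 : volume.restrict F.minus ≤ volume.restrict F.full := by
      rw [F.restrict_full hh.le]; exact Measure.le_add_right le_rfl
    have hle2 : volume.restrict F.plus ≤ volume.restrict F.full := by
      rw [F.restrict_full hh.le]; exact Measure.le_add_left le_rfl
    have z1 : ((e' - e).1.1 : ℝ × ℝ → ℝ) = 0 :=
      tensorPoly_eq_zero (e' - e).1.1.2 F.isOpen_minus
        (by rw [F.minus_eq]; exact halfRect_nonempty (by norm_num) hh hab)
        ((glue_ae_minus F _ _).symm.trans (ae_mono hle1 h4))
    have z2 : ((e' - e).1.2 : ℝ × ℝ → ℝ) = 0 :=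
      tensorPoly_eq_zero (e' - e).1.2.2 F.isOpen_plus
        (by rw [F.plus_eq]; exact halfRect_nonempty (by norm_num) hh hab)
        ((glue_ae_plus F _ _).symm.trans (ae_mono hle2 h4))
    have hz : e' - e = 0 :=
      Subtype.ext (Prod.ext (Subtype.ext z1) (Subtype.ext z2))
    have hee : e' = e := sub_eq_zero.1 hz
    subst hee
    exact he'
  · intro ψm hψm ψp hψp hψ
    have h1 := l2_projection_le (E := S) (A := A) hA hu he ⟨(⟨ψm, hψm⟩, ⟨ψp, hψp⟩), (hS _).2 hψ⟩
    rwa [hAe, hAe,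
      sqInt_glue_sub hh.le (hc e.1.1) (hc e.1.2) hum hup,
      sqInt_glue_sub hh.le (hc ⟨ψm, hψm⟩) (hc ⟨ψp, hψp⟩) hum hup] at h1

/-! ### The error estimate -/

/-- Simultaneous approximation in the immersed space. The constant does not depend on the
coefficients because the side with the larger coefficient carries the correction. -/
theorem exists_weakJumps_approx (hm : 1 ≤ m) {B : ℝ} (hB : 1 ≤ B) :
    ∃ C : ℝ, 0 ≤ C ∧ ∀ h a L : ℝ, 0 < h → 0 < L → h ≤ B → h ≤ B * L → L ≤ B * h → a ∈ Γ.I →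
    a + L ∈ Γ.I → ∀ βm βp : ℝ, 0 < βm → 0 < βp →
    ∀ vm vp : ℝ × ℝ → ℝ, ContDiff ℝ ∞ vm → ContDiff ℝ ∞ vp →
    ∃ φm ∈ tensorPoly m, ∃ φp ∈ tensorPoly m, Γ.WeakJumps m ⟨h, a, a + L⟩ βm βp φm φp ∧
      sqInt (volume.restrict (halfRect (-1) h a (a + L))) (fun p => φm p - vm p) +
        sqInt (volume.restrict (halfRect 1 h a (a + L))) (fun p => φp p - vp p) ≤
      C * (h ^ (2 * (m + 1)) * (smoothSeminormSq (halfRect (-1) h a (a + L)) (m + 1) vm +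
          smoothSeminormSq (halfRect 1 h a (a + L)) (m + 1) vp) +
        ∑ k ∈ Finset.range (m + 1), h * (h ^ k / max (jumpWeight βm k) (jumpWeight βp k)) ^ 2 *
          sqInt (volume.restrict (Ioo a (a + L)))
            (fun ξ => jumpWeight βp k * Γ.normalData k vp ξ -
              jumpWeight βm k * Γ.normalData k vm ξ)) := by
  obtain ⟨C, hC, H⟩ := Γ.exists_immersed_approx hm hB
  refine ⟨C, hC, ?_⟩
  intro h a L hh hL hhB hhL hLh ha hb βm βp hβm hβp vm vp hvm hvp
  have hab : a ≤ a + L := by linarith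
  rcases le_total βm βp with hle | hle
  · have hmax : ∀ k, max (jumpWeight βm k) (jumpWeight βp k) = jumpWeight βp k := fun k =>
      max_eq_right (jumpWeight_mono hle k)
    obtain ⟨φp, hφp, φm, hφm, hjump, hest⟩ := H 1 (-1) h a L (by norm_num) (by norm_num) hh hL hhB
      hhL hLh ha hb (jumpWeight βp) (jumpWeight βm) (jumpWeight_pos hβp)
      (fun k => by rw [abs_of_pos (jumpWeight_pos hβm k)]; exact jumpWeight_mono hle k)
      vp vm hvp hvm
    refine ⟨φm, hφm, φp, hφp, (Γ.weakJumps_iff hm hab).2 hjump, ?_⟩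
    simp only [hmax]
    rw [add_comm (sqInt _ _), add_comm (smoothSeminormSq _ _ _)]
    exact hest
  · have hmax : ∀ k, max (jumpWeight βm k) (jumpWeight βp k) = jumpWeight βm k := fun k =>
      max_eq_left (jumpWeight_mono hle k)
    obtain ⟨φm, hφm, φp, hφp, hjump, hest⟩ := H (-1) 1 h a L (by norm_num) (by norm_num) hh hL hhB
      hhL hLh ha hb (jumpWeight βm) (jumpWeight βp) (jumpWeight_pos hβm)
      (fun k => by rw [abs_of_pos (jumpWeight_pos hβp k)]; exact jumpWeight_mono hle k)
      vm vp hvm hvp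
    refine ⟨φm, hφm, φp, hφp, (Γ.weakJumps_iff hm hab).2 fun k hk R hR => ?_, ?_⟩
    · rw [← neg_eq_zero, ← integral_neg, ← hjump k hk R hR]
      congr 1
      funext ξ
      ring
    · simp only [hmax]
      refine hest.trans (le_of_eq ?_)
      congr 2
      refine Finset.sum_congr rfl fun k _ => ?_
      congr 1
      rw [← sqInt_neg]
      congr 1
      funext ξ
      ring

theorem closedHalfRect_subset_regularRegion {σ h a b : ℝ} (hσ : σ ^ 2 = 1) (hI : Icc a b ⊆ Γ.I)
    (hκ : ∀ ξ ∈ Γ.I, h * |Γ.curvature ξ| ≤ 1 / 2) :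
    closedHalfRect σ h a b ⊆ Γ.regularRegion := by
  intro p hp
  refine ⟨hI hp.2, ?_⟩
  rw [abs_mul]
  calc |p.1| * |Γ.curvature p.2| ≤ h * |Γ.curvature p.2| :=
        mul_le_mul_of_nonneg_right (abs_fst_le hσ hp) (abs_nonneg _)
    _ ≤ 1 / 2 := hκ _ (hI hp.2)
    _ < 1 := by norm_num

theorem FlattenedJumps.jumpZero {Γ : InterfaceCurve (m + 2)} {F : FrenetRect} {βm βp : ℝ}
    {u : ℝ × ℝ → ℝ} (H : Γ.FlattenedJumps m F βm βp u) {k : ℕ} (hk : k ≤ m) :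
    JumpZero F (fun p => jumpWeight βm k * Γ.weakNormalField F.minus k u p)
      (fun p => jumpWeight βp k * Γ.weakNormalField F.plus k u p) := by
  match k, hk with
  | 0, _ => simpa [jumpWeight, weakNormalField] using H.1
  | 1, _ => simpa [jumpWeight, weakNormalField] using H.2.1
  | j + 2, hk => simpa [jumpWeight, weakNormalField] using H.2.2 j hk

end InterfaceCurve

/-- The squared seminorm as a sum over the weak derivatives. -/
theorem sobolevSeminorm_sq (U : Set (ℝ × ℝ)) (k : ℕ) (f : ℝ × ℝ → ℝ) :
    sobolevSeminorm U k f ^ 2 = ∑ x ∈ Finset.HasAntidiagonal.antidiagonal k,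
      sqInt (volume.restrict U) (weakDeriv U x.1 x.2 f) :=
  Real.sq_sqrt (Finset.sum_nonneg fun _ _ => sqInt_nonneg)

theorem exists_l2Tendsto_smooth {σ h a L : ℝ} (hσ : σ ^ 2 = 1) (hh : 0 < h) (hL : 0 < L) {k : ℕ}
    {u : ℝ × ℝ → ℝ} (hu : MemSobolev (halfRect σ h a (a + L)) k u) :
    ∃ v : ℕ → ℝ × ℝ → ℝ, (∀ n, ContDiff ℝ ∞ (v n)) ∧ ∀ i j, i + j ≤ k →
      L2Tendsto (volume.restrict (halfRect σ h a (a + L))) (fun n => mixedDeriv i j (v n))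
        (weakDeriv (halfRect σ h a (a + L)) i j u) := by
  obtain ⟨v, hv, hvu⟩ := exists_smooth_approx isOpen_halfRect convex_halfRect
    (isBounded_halfRect hσ) (halfRect_nonempty hσ hh (by linarith)) hu
  exact ⟨v, hv, fun i j hij => ⟨fun n => memLp_halfRect hσ
    (smooth_mixedDeriv (hv n) i j).continuous.continuousOn,
    (hu.weakDeriv_spec isOpen_halfRect hij).2, hvu i j hij⟩⟩

theorem weakDeriv_zero_ae_eq {U : Set (ℝ × ℝ)} (hU : IsOpen U) {u : ℝ × ℝ → ℝ}
    (hu : MemLp u 2 (volume.restrict U)) : weakDeriv U 0 0 u =ᵐ[volume.restrict U] u :=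
  (hasWeakDeriv_zero (locallyIntegrableOn_of_memLp hu)).weakDeriv_ae_eq hU

theorem HasWeakDeriv.congr_left {U : Set (ℝ × ℝ)} (hU : IsOpen U) {i j : ℕ} {f f' w : ℝ × ℝ → ℝ}
    (h : HasWeakDeriv U i j f w) (hf : EqOn f' f U) : HasWeakDeriv U i j f' w := by
  refine ⟨?_, h.2.1, fun φ hφ hc hs => ?_⟩
  · intro x hx
    obtain ⟨s, hs, hi⟩ := h.1 x hx
    refine ⟨s ∩ U, inter_mem hs self_mem_nhdsWithin, ?_⟩
    refine (hi.mono_set inter_subset_left).congr ?_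
    filter_upwards [ae_restrict_of_ae_restrict_of_subset inter_subset_right
      (ae_restrict_mem hU.measurableSet)] with p hp
    exact (hf hp).symm
  · rw [← h.2.2 φ hφ hc hs]
    exact setIntegral_congr_fun hU.measurableSet fun p hp => by simp only [hf hp]

/-- On a half rectangle, the seminorm of the difference of a polynomial and a Sobolev function. -/
theorem sobolevSeminorm_sub_sq {σ h a b : ℝ} (hσ : σ ^ 2 = 1) {m k : ℕ} {u w φ : ℝ × ℝ → ℝ}
    (hu : MemSobolev (halfRect σ h a b) k u) (hφ : φ ∈ tensorPoly m)
    (hw : EqOn w φ (halfRect σ h a b)) {i : ℕ} (hi : i ≤ k) :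
    sobolevSeminorm (halfRect σ h a b) i (fun p => w p - u p) ^ 2 =
      ∑ x ∈ Finset.HasAntidiagonal.antidiagonal i, sqInt (volume.restrict (halfRect σ h a b))
        (fun p => mixedDeriv x.1 x.2 φ p - weakDeriv (halfRect σ h a b) x.1 x.2 u p) := by
  rw [sobolevSeminorm_sq]
  refine Finset.sum_congr rfl fun x hx => sqInt_congr ?_
  have hx' : x.1 + x.2 = i := Finset.HasAntidiagonal.mem_antidiagonal.1 hx
  obtain ⟨h1, h2⟩ := hu.weakDeriv_spec isOpen_halfRect (hx'.le.trans hi)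
  have hφs := tensorPoly_smooth hφ
  have h3 := (hasWeakDeriv_of_smooth isOpen_halfRect hφs x.1 x.2).sub h1
    (memLp_halfRect hσ hφs.continuous.continuousOn) (hu.memLp isOpen_halfRect)
    (memLp_halfRect hσ (smooth_mixedDeriv hφs _ _).continuous.continuousOn) h2
  exact (h3.congr_left isOpen_halfRect fun p hp => by simp only [hw hp]).weakDeriv_ae_eq
    isOpen_halfRect

namespace InterfaceCurve

variable {m : ℕ} (Γ : InterfaceCurve (m + 2))

/-- A quantity that is at most the `L²` error of every pair in the immersed space, such as the error
of the projection, is of order `h^{m+1}`. -/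
theorem exists_sqInt_projection_le (hm : 1 ≤ m) {B : ℝ} (hB : 1 ≤ B) :
    ∃ C : ℝ, 0 ≤ C ∧ ∀ h a L : ℝ, 0 < h → 0 < L → h ≤ B → h ≤ B * L → L ≤ B * h →
    Icc a (a + L) ⊆ Γ.I → (∀ ξ ∈ Γ.I, h * |Γ.curvature ξ| ≤ 1 / 2) →
    ∀ βm βp : ℝ, 0 < βm → 0 < βp → ∀ u : ℝ × ℝ → ℝ,
    MemSobolev (halfRect (-1) h a (a + L)) (m + 1) u →
    MemSobolev (halfRect 1 h a (a + L)) (m + 1) u →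
    Γ.FlattenedJumps m ⟨h, a, a + L⟩ βm βp u →
    ∀ E : ℝ, (∀ ψm ∈ tensorPoly m, ∀ ψp ∈ tensorPoly m,
      Γ.WeakJumps m ⟨h, a, a + L⟩ βm βp ψm ψp →
        E ≤ sqInt (volume.restrict (halfRect (-1) h a (a + L))) (fun p => ψm p - u p) +
          sqInt (volume.restrict (halfRect 1 h a (a + L))) (fun p => ψp p - u p)) →
    E ≤ C * (h ^ (2 * (m + 1)) * (sobolevSeminorm (halfRect (-1) h a (a + L)) (m + 1) u ^ 2 +
      sobolevSeminorm (halfRect 1 h a (a + L)) (m + 1) u ^ 2)) := by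
  obtain ⟨C, hC, H⟩ := Γ.exists_weakJumps_approx hm hB
  refine ⟨2 * C, by positivity, ?_⟩
  intro h a L hh hL hhB hhL hLh hI hκ βm βp hβm hβp u hum hup hjump E hE
  have hab : a < a + L := by linarith
  have s1 : (1 : ℝ) ^ 2 = 1 := by norm_num
  have s2 : (-1 : ℝ) ^ 2 = 1 := by norm_num
  have em : (⟨h, a, a + L⟩ : FrenetRect).minus = halfRect (-1) h a (a + L) :=
    FrenetRect.minus_eq _
  have ep : (⟨h, a, a + L⟩ : FrenetRect).plus = halfRect 1 h a (a + L) := FrenetRect.plus_eq _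
  obtain ⟨vm, hvm, hvmu⟩ := exists_l2Tendsto_smooth s2 hh hL hum
  obtain ⟨vp, hvp, hvpu⟩ := exists_l2Tendsto_smooth s1 hh hL hup
  have hzm := weakDeriv_zero_ae_eq isOpen_halfRect (hum.memLp isOpen_halfRect)
  have hzp := weakDeriv_zero_ae_eq isOpen_halfRect (hup.memLp isOpen_halfRect)
  have tm := ((hvmu 0 0 (by omega)).congr_ae (fun n => Filter.EventuallyEq.rfl) hzm)
  have tp := ((hvpu 0 0 (by omega)).congr_ae (fun n => Filter.EventuallyEq.rfl) hzp)
  have tsm : Tendsto (fun n => smoothSeminormSq (halfRect (-1) h a (a + L)) (m + 1) (vm n)) atTop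
      (𝓝 (sobolevSeminorm (halfRect (-1) h a (a + L)) (m + 1) u ^ 2)) := by
    rw [sobolevSeminorm_sq]
    exact tendsto_finsetSum _ fun x hx => (hvmu x.1 x.2
      (Finset.HasAntidiagonal.mem_antidiagonal.1 hx).le).tendsto_sqInt_self
  have tsp : Tendsto (fun n => smoothSeminormSq (halfRect 1 h a (a + L)) (m + 1) (vp n)) atTop
      (𝓝 (sobolevSeminorm (halfRect 1 h a (a + L)) (m + 1) u ^ 2)) := by
    rw [sobolevSeminorm_sq]
    exact tendsto_finsetSum _ fun x hx => (hvpu x.1 x.2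
      (Finset.HasAntidiagonal.mem_antidiagonal.1 hx).le).tendsto_sqInt_self
  -- The jumps of the smooth approximations tend to the jumps of `u`, which vanish.
  have tj : ∀ k ∈ Finset.range (m + 1), Tendsto (fun n =>
      h * (h ^ k / max (jumpWeight βm k) (jumpWeight βp k)) ^ 2 *
        sqInt (volume.restrict (Ioo a (a + L)))
        (fun ξ => jumpWeight βp k * Γ.normalData k (vp n) ξ -
          jumpWeight βm k * Γ.normalData k (vm n) ξ)) atTop (𝓝 0) := by
    intro k hk
    have hkm : k ≤ m := Nat.lt_succ_iff.1 (Finset.mem_range.1 hk)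
    obtain ⟨t, ht1, ht2⟩ := hjump.jumpZero hkm
    rw [em] at ht1
    rw [ep] at ht2
    have l1 := Γ.l2Tendsto_normalData hm s2 hh hL
      (Γ.closedHalfRect_subset_regularRegion s2 hI hκ) hum hvm hvmu hkm ht1
    have l2 := Γ.l2Tendsto_normalData hm s1 hh hL
      (Γ.closedHalfRect_subset_regularRegion s1 hI hκ) hup hvp hvpu hkm ht2
    simpa using ((l2.sub l1).tendsto_sqInt (ae_of_all _ fun ξ => sub_self _)).const_mul
      (h * (h ^ k / max (jumpWeight βm k) (jumpWeight βp k)) ^ 2)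
  have tjs := tendsto_finsetSum _ tj
  rw [Finset.sum_const_zero] at tjs
  have tlim := (((((tsm.add tsp).const_mul (h ^ (2 * (m + 1)))).add tjs).const_mul C).const_mul
    2).add ((tm.tendsto.add tp.tendsto).const_mul 2)
  rw [add_zero, add_zero, mul_zero, add_zero, ← mul_assoc 2 C] at tlim
  refine ge_of_tendsto' tlim fun n => ?_
  obtain ⟨φm, hφm, φp, hφp, hφ, hest⟩ := H h a L hh hL hhB hhL hLh (hI (left_mem_Icc.2 hab.le))
    (hI (right_mem_Icc.2 hab.le)) βm βp hβm hβp (vm n) (vp n) (hvm n) (hvp n)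
  have hsplit : ∀ (σ : ℝ), σ ^ 2 = 1 → ∀ φ v : ℝ × ℝ → ℝ, φ ∈ tensorPoly m → ContDiff ℝ ∞ v →
      MemLp u 2 (volume.restrict (halfRect σ h a (a + L))) →
      sqInt (volume.restrict (halfRect σ h a (a + L))) (fun p => φ p - u p) ≤
        2 * sqInt (volume.restrict (halfRect σ h a (a + L))) (fun p => φ p - v p) +
        2 * sqInt (volume.restrict (halfRect σ h a (a + L))) (fun p => v p - u p) := by
    intro σ hσ φ v hφ hv hu
    have hφc := (tensorPoly_smooth hφ).continuous
    have h1 := sqInt_add_le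
      ((memLp_halfRect hσ (h := h) (a := a) (b := a + L) (hφc.sub hv.continuous).continuousOn))
      ((memLp_halfRect hσ (h := h) (a := a) (b := a + L) hv.continuous.continuousOn).sub hu)
    refine (le_of_eq ?_).trans h1
    congr 1
    funext p
    simp
  have b0 := hE φm hφm φp hφp hφ
  have b1 := hsplit (-1) s2 φm (vm n) hφm (hvm n) (hum.memLp isOpen_halfRect)
  have b2 := hsplit 1 s1 φp (vp n) hφp (hvp n) (hup.memLp isOpen_halfRect)
  simp only [mixedDeriv, Function.iterate_zero, id]
  linarith

/-- The projection error on Frenet rectangles whose shape is controlled by `B`. -/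
theorem exists_projection_error_le (hm : 1 ≤ m) {B : ℝ} (hB : 1 ≤ B) :
    ∃ C : ℝ, 0 < C ∧ ∀ F : FrenetRect, 0 < F.h → F.a < F.b → F.h ≤ B →
    F.h ≤ B * (F.b - F.a) → F.b - F.a ≤ B * F.h → Icc F.a F.b ⊆ Γ.I →
    (∀ ξ ∈ Γ.I, F.h * |Γ.curvature ξ| ≤ 1 / 2) →
    ∀ βm βp : ℝ, 0 < βm → 0 < βp → ∀ u : ℝ × ℝ → ℝ, MemSobolev F.minus (m + 1) u →
    MemSobolev F.plus (m + 1) u → Γ.FlattenedJumps m F βm βp u →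
    ∃ w : ℝ × ℝ → ℝ, Γ.IsL2Projection m F βm βp u w ∧
      (∀ w' : ℝ × ℝ → ℝ, Γ.IsL2Projection m F βm βp u w' → EqOn w' w F.full) ∧
      ∀ i : ℕ, i ≤ m + 1 → brokenSeminorm F i (fun p => w p - u p) ≤
        C * F.h ^ (m + 1 - i) * brokenSeminorm F (m + 1) u := by
  obtain ⟨C₁, hC₁, H₁⟩ := Γ.exists_sqInt_projection_le hm hB
  obtain ⟨C₂, hC₂, H₂⟩ := exists_sobolev_inverse_estimate m hB
  set D : ℝ := (m + 2) * (C₂ * (C₁ + 1)) with hD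
  have hD0 : 0 ≤ D := by positivity
  refine ⟨√D + 1, by positivity, ?_⟩
  rintro ⟨h, a, b⟩ hh hab hhB hhL hLh hI hκ βm βp hβm hβp u hum hup hjump
  obtain ⟨L, rfl⟩ : ∃ L, b = a + L := ⟨b - a, by ring⟩
  simp only [add_sub_cancel_left] at hh hab hhB hhL hLh hI hκ
  have hL : 0 < L := by linarith
  have s1 : (1 : ℝ) ^ 2 = 1 := by norm_num
  have s2 : (-1 : ℝ) ^ 2 = 1 := by norm_num
  have em : (⟨h, a, a + L⟩ : FrenetRect).minus = halfRect (-1) h a (a + L) :=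
    FrenetRect.minus_eq _
  have ep : (⟨h, a, a + L⟩ : FrenetRect).plus = halfRect 1 h a (a + L) := FrenetRect.plus_eq _
  obtain ⟨φm, hφm, φp, hφp, hproj, huniq, hbest⟩ := Γ.exists_isL2Projection hm ⟨h, a, a + L⟩ hh hab
    hI βm βp (hum.memLp (FrenetRect.isOpen_minus _)) (hup.memLp (FrenetRect.isOpen_plus _))
  have wm : EqOn (glue φm φp) φm (halfRect (-1) h a (a + L)) := by
    rw [← em]; exact fun p hp => glue_of_mem_minus φm φp hp
  have wp : EqOn (glue φm φp) φp (halfRect 1 h a (a + L)) := by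
    rw [← ep]; exact fun p hp => glue_of_mem_plus φm φp hp
  rw [em] at hum hbest
  rw [ep] at hup hbest
  refine ⟨_, hproj, huniq, fun i hi => ?_⟩
  have hE := H₁ h a L hh hL hhB hhL hLh hI hκ βm βp hβm hβp u hum hup hjump _ hbest
  have hhalf : ∀ σ : ℝ, σ ^ 2 = 1 → ∀ φ ∈ tensorPoly m,
      EqOn (glue φm φp) φ (halfRect σ h a (a + L)) →
      MemSobolev (halfRect σ h a (a + L)) (m + 1) u →
      h ^ (2 * i) * sobolevSeminorm (halfRect σ h a (a + L)) i (fun p => glue φm φp p - u p) ^ 2 ≤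
        (m + 2) * (C₂ * (sqInt (volume.restrict (halfRect σ h a (a + L))) (fun p => φ p - u p) +
          h ^ (2 * (m + 1)) * sobolevSeminorm (halfRect σ h a (a + L)) (m + 1) u ^ 2)) := by
    intro σ hσ φ hφ hw hu
    obtain ⟨v, hv, hvu⟩ := exists_l2Tendsto_smooth hσ hh hL hu
    rw [sobolevSeminorm_sub_sq hσ hu hφ hw hi, sobolevSeminorm_sq, Finset.mul_sum]
    have hterm : ∀ x ∈ Finset.HasAntidiagonal.antidiagonal i, h ^ (2 * i) *
        sqInt (volume.restrict (halfRect σ h a (a + L))) (fun p => mixedDeriv x.1 x.2 φ p -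
          weakDeriv (halfRect σ h a (a + L)) x.1 x.2 u p) ≤
        C₂ * (sqInt (volume.restrict (halfRect σ h a (a + L))) (fun p => φ p - u p) +
        h ^ (2 * (m + 1)) * ∑ x ∈ Finset.HasAntidiagonal.antidiagonal (m + 1),
          sqInt (volume.restrict (halfRect σ h a (a + L)))
            (weakDeriv (halfRect σ h a (a + L)) x.1 x.2 u)) := by
      intro x hx
      have hx' : x.1 + x.2 = i := Finset.HasAntidiagonal.mem_antidiagonal.1 hx
      rw [← hx']
      exact H₂ σ h a L hσ hh hL hhL hLh u v hv hvu
        (weakDeriv_zero_ae_eq isOpen_halfRect (hu.memLp isOpen_halfRect)) φ hφ x.1 x.2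
        (hx'.le.trans hi)
    refine (Finset.sum_le_card_nsmul _ _ _ hterm).trans ?_
    rw [nsmul_eq_mul, Finset.Nat.card_antidiagonal]
    refine mul_le_mul_of_nonneg_right ?_ ?_
    · exact_mod_cast (by omega : i + 1 ≤ m + 2)
    · refine mul_nonneg hC₂ (add_nonneg sqInt_nonneg (mul_nonneg (by positivity)
        (Finset.sum_nonneg fun _ _ => sqInt_nonneg)))
  have g1 := hhalf (-1) s2 φm hφm wm hum
  have g2 := hhalf 1 s1 φp hφp wp hup
  simp only [brokenSeminorm, em, ep]
  rw [add_comm (_ ^ 2), add_comm (sobolevSeminorm _ (m + 1) u ^ 2)]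
  set Xm := sobolevSeminorm (halfRect (-1) h a (a + L)) i (fun p => glue φm φp p - u p)
  set Xp := sobolevSeminorm (halfRect 1 h a (a + L)) i (fun p => glue φm φp p - u p)
  set Ym := sobolevSeminorm (halfRect (-1) h a (a + L)) (m + 1) u
  set Yp := sobolevSeminorm (halfRect 1 h a (a + L)) (m + 1) u
  have hX : h ^ (2 * i) * (Xm ^ 2 + Xp ^ 2) ≤
      h ^ (2 * i) * (D * (h ^ (m + 1 - i)) ^ 2 * (Ym ^ 2 + Yp ^ 2)) := by
    have e : h ^ (2 * i) * (D * (h ^ (m + 1 - i)) ^ 2 * (Ym ^ 2 + Yp ^ 2)) =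
        D * (h ^ (2 * (m + 1)) * (Ym ^ 2 + Yp ^ 2)) := by
      have : h ^ (2 * (m + 1)) = h ^ (2 * i) * (h ^ (m + 1 - i)) ^ 2 := by
        rw [← pow_mul, ← pow_add]
        congr 1
        omega
      rw [this]
      ring
    rw [e, mul_add]
    have h2 := mul_le_mul_of_nonneg_left hE (by positivity : (0 : ℝ) ≤ (m + 2) * C₂)
    calc _ ≤ _ := add_le_add g1 g2
      _ = (m + 2) * C₂ * (sqInt (volume.restrict (halfRect (-1) h a (a + L)))
            (fun p => φm p - u p) +
          sqInt (volume.restrict (halfRect 1 h a (a + L))) (fun p => φp p - u p)) +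
          (m + 2) * C₂ * (h ^ (2 * (m + 1)) * (Ym ^ 2 + Yp ^ 2)) := by ring
      _ ≤ _ := add_le_add_left h2 _
      _ = D * (h ^ (2 * (m + 1)) * (Ym ^ 2 + Yp ^ 2)) := by rw [hD]; ring
  have hX' := le_of_mul_le_mul_left hX (by positivity)
  calc √(Xm ^ 2 + Xp ^ 2) ≤ √(D * (h ^ (m + 1 - i)) ^ 2 * (Ym ^ 2 + Yp ^ 2)) :=
        Real.sqrt_le_sqrt hX'
    _ = √D * h ^ (m + 1 - i) * √(Ym ^ 2 + Yp ^ 2) := by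
        rw [Real.sqrt_mul (by positivity), Real.sqrt_mul hD0, Real.sqrt_sq (by positivity)]
    _ ≤ (√D + 1) * h ^ (m + 1 - i) * √(Ym ^ 2 + Yp ^ 2) := by
        gcongr
        linarith

end InterfaceCurve

end FrenetIFE

theorem mainTheorem1 (m : ℕ) (hm : 1 ≤ m) (Γ : FrenetIFE.InterfaceCurve (m + 2)) (ρ : ℝ) :
    ∃ C : ℝ, 0 < C ∧
      ∀ ε : ℝ, Γ.IsTubeWidth ε →
      ∀ K : FrenetIFE.RectElement, K.AspectLe ρ → K.h < ε →
        (∀ ξ ∈ Set.Icc Γ.ξs Γ.ξe, K.h * |Γ.curvature ξ| ≤ 1 / 2) →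
        Γ.IsInterfaceElement K → K.toSet ⊆ Γ.tube K.h →
      ∀ βm βp : ℝ, 0 < βm → 0 < βp →
      ∀ u : ℝ × ℝ → ℝ,
        FrenetIFE.MemImmersedSobolev (Γ.frenetElement ε K) (m + 1) βm βp u →
        Γ.FlattenedJumps m (Γ.frenetElement ε K) βm βp u →
        ∃ w : ℝ × ℝ → ℝ,
          Γ.IsL2Projection m (Γ.frenetElement ε K) βm βp u w ∧
          (∀ w' : ℝ × ℝ → ℝ, Γ.IsL2Projection m (Γ.frenetElement ε K) βm βp u w' →
            Set.EqOn w' w (Γ.frenetElement ε K).full) ∧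
          ∀ i : ℕ, i ≤ m + 1 →
            FrenetIFE.brokenSeminorm (Γ.frenetElement ε K) i (fun p => w p - u p) ≤
              C * K.h ^ (m + 1 - i) *
                FrenetIFE.brokenSeminorm (Γ.frenetElement ε K) (m + 1) u := by
  by_cases hinj : Set.InjOn Γ.g Γ.I
  · obtain ⟨c, hc, hshape⟩ := Γ.exists_frenetElement_bounds hinj ρ
    -- Both the shape ratios and the diameter of the fictitious elements are bounded by `B`.
    set B : ℝ := 1 + c + c * (Γ.ξe - Γ.ξs) with hBdef
    have hlen : 0 < Γ.ξe - Γ.ξs := sub_pos.2 Γ.lt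
    have hclen : 0 < c * (Γ.ξe - Γ.ξs) := mul_pos hc hlen
    obtain ⟨C, hC, H⟩ := Γ.exists_projection_error_le hm (B := B) (by linarith)
    refine ⟨C, hC, ?_⟩
    intro ε hε K hK hKε hκ _ hKt βm βp hβm hβp u hu hjump
    obtain ⟨ha, hb, hlow, hup⟩ := hshape ε hε K hK hKε hκ hKt
    have hh := K.h_pos
    have hcB : c ≤ B := by linarith
    have hL : 0 < (Γ.frenetElement ε K).b - (Γ.frenetElement ε K).a := by
      by_contra! hle
      nlinarith
    have hle : (Γ.frenetElement ε K).b - (Γ.frenetElement ε K).a ≤ Γ.ξe - Γ.ξs := by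
      linarith [ha.1, hb.2]
    exact H (Γ.frenetElement ε K) hh (sub_pos.1 hL)
      (hlow.trans ((mul_le_mul_of_nonneg_left hle hc.le).trans (by linarith)))
      (hlow.trans (mul_le_mul_of_nonneg_right hcB hL.le))
      (hup.trans (mul_le_mul_of_nonneg_right hcB hh.le))
      (fun ξ hξ => ⟨ha.1.trans hξ.1, hξ.2.trans hb.2⟩) hκ βm βp hβm hβp u hu.1 hu.2.1 hjump
  · -- A curve with double points has no tubular neighbourhood.
    exact ⟨1, one_pos, fun ε hε => absurd hε.injOn hinj⟩
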